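/- For integers $a,b,c$ with $a>0$ and $b^2-4ac<0$ and for complex $q$ with $|q|<1$, let $$(a,b,c)=(a,b,c)(q):=\sum_{n,m=-\infty}^{\infty}q^{an^2+bnm+cm^2}$$ denote the generating function of the positive definite binary quadratic form $an^2+bnm+cm^2$, and let $$E(q):=\sum_{n=-\infty}^{\infty}(-1)^nq^{n(3n-1)/2}\qquad\Bigl(=\prod_{k\ge1}(1-q^k)\Bigr).$$ **Theorem.** Put $Q:=q^7$. All these series converge absolutely for $|q|<1$. Moreover $E(q^8)E(Q^4)\neq0$ for $|q|<1$, the zeros of $(7,0,8)+(3,2,19)$ are isolated in the open unit disk, and the following identity between generating functions of quadratic forms of discriminant $-224$ holds: $$\frac{(1,0,56)-(5,4,12)}{(7,0,8)+(3,2,19)}=q\,\frac{E(q^4)E(Q^8)}{E(q^8)E(Q^4)}.$$ Here the identity is one of meromorphic functions on the open unit disk: it holds at every $q$ with $|q|<1$ at which $(7,0,8)+(3,2,19)\neq0$, and $$\bigl((1,0,56)-(5,4,12)\bigr)\,E(q^8)E(Q^4)=q\,E(q^4)E(Q^8)\,\bigl((7,0,8)+(3,2,19)\bigr)$$ holds for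 every $q$ with $|q|<1$. -/

import Mathlib

/-- The generating function `∑ q ^ (a n² + b n m + c m²)`, summed over all pairs of integers
`(n, m)`, of the binary quadratic form `(a, b, c)`. For a positive definite form all exponents are
nonnegative (and the exponent `0` gives the term `1`, also at `q = 0`). -/
noncomputable def formSeries (a b c : ℤ) (q : ℂ) : ℂ :=
  ∑' p : ℤ × ℤ, q ^ (a * p.1 ^ 2 + b * p.1 * p.2 + c * p.2 ^ 2)

/-- The function `E(q) = ∑ (-1) ^ n q ^ (n (3 n - 1) / 2)`, summed over all integers `n`
(the division is exact and all exponents are nonnegative). -/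
noncomputable def eulerE (q : ℂ) : ℂ :=
  ∑' n : ℤ, (-1 : ℂ) ^ n * q ^ (n * (3 * n - 1) / 2)

open Complex Real

/-! Write `q = 𝐞 (τ / 4)` with `Im τ > 0`. Splitting the first variable by parity, each series of
discriminant -224 is a sum of two theta series of a form of discriminant -56 over cosets of ℤ² in
(1/2)ℤ². The forms that occur are P = x² + 14y², S = 2x² + 7y² and T = 3x² + 2xy + 5y². The quotient
of Euler products times `q` becomes r(τ) = η(τ)η(14τ) / (η(2τ)η(7τ)). The theorem follows from
adding two of four relations between the components of P - T and those of r (S + T); the four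
together are stable under a group of transformations. `defect` is the vector of differences of the
two sides.

Poisson summation shows how the coset series behave under τ ↦ τ + 1, the Fricke involution and two
Atkin-Lehner type maps attached to 2 and 7. The first two preserve P, S and T; the last two exchange
P and S and send T to -T (`thetaT_two`, `thetaT_seven`), because T lies outside the principal genus.
Hence they exchange P - T with S + T, while r goes to a unit times 1/r (`etaQuot_two`,
`etaQuot_seven`). All matrices involved are unitary up to a scalar, so `defectNorm`, the squared
norm of `defect` divided by |η(τ)η(14τ)|², is invariant under all these maps.

These maps bring every point of the upper half plane to height at least 1/100 (`exists_im_ge`), so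
only the cusp i∞ needs inspection. There the defect is O(𝐞(3τ/4)), while η(τ)η(14τ) has the order of
𝐞(5τ/8), and the invariant tends to 0 (`tendsto_defectNorm`). If it were nonzero somewhere it would
attain a positive maximum; by the maximum principle for the holomorphic vector `normalizedDefect` it
would be constant, contradicting the limit (`defectNorm_eq_zero`). Euler's pentagonal number theorem
(`eulerE_eq_eulerProd`) converts the eta quotient back to the series E. -/

/-! ### Poisson summation for Gaussians on ℤ and ℤ² -/

/-- One-dimensional Poisson summation for a Gaussian with shift `ξ` and character `lam`. -/
lemma tsum_gaussian_char (t ξ lam : ℂ) :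
    ∑' n : ℤ, cexp (π * I * (t * (n + ξ) ^ 2 + 2 * lam * n)) =
      1 / (-I * t) ^ (1 / 2 : ℂ) *
        ∑' k : ℤ, cexp (π * I * (-(k - lam) ^ 2 / t + 2 * (k - lam) * ξ)) := by
  rcases eq_or_ne t 0 with rfl | ht
  -- At `t = 0` both sides are 0 by convention: division by zero on the right, a divergent sum on
  -- the left.
  · have h0 : ((-I * 0 : ℂ)) ^ (1 / 2 : ℂ) = 0 := by simp
    rw [h0]
    simp only [zero_mul, zero_add, div_zero, zero_mul]
    refine tsum_eq_zero_of_not_summable fun h => ?_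
    have h1 := (summable_jacobiTheta₂_term_iff lam 0).1 (by
      refine h.congr fun n => ?_
      rw [jacobiTheta₂_term]; congr 1; ring)
    simp at h1
  have h1 : ∑' n : ℤ, cexp (π * I * (t * (n + ξ) ^ 2 + 2 * lam * n)) =
      cexp (π * I * (t * ξ ^ 2)) * jacobiTheta₂ (t * ξ + lam) t := by
    rw [jacobiTheta₂, ← tsum_mul_left]
    refine tsum_congr fun n => ?_
    rw [jacobiTheta₂_term, ← Complex.exp_add]
    congr 1; ring
  have h2 : ∑' k : ℤ, cexp (π * I * (-(k - lam) ^ 2 / t + 2 * (k - lam) * ξ)) =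
      cexp (π * I * (-lam ^ 2 / t - 2 * lam * ξ)) * jacobiTheta₂ ((t * ξ + lam) / t) (-1 / t) := by
    rw [jacobiTheta₂, ← tsum_mul_left]
    refine tsum_congr fun n => ?_
    rw [jacobiTheta₂_term, ← Complex.exp_add]
    congr 1; field_simp; ring
  rw [h1, h2, jacobiTheta₂_functional_equation]
  have h3 : cexp (π * I * (t * ξ ^ 2)) * cexp (-π * I * (t * ξ + lam) ^ 2 / t) =
      cexp (π * I * (-lam ^ 2 / t - 2 * lam * ξ)) := by
    rw [← Complex.exp_add]; congr 1; field_simp; ring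
  rw [← h3]; ring

/-- The theta series of the binary form `a x² + b x y + c y²` with characteristic `(α, β)` and
character `(lam, mu)`. -/
noncomputable def binTheta (a b c α β lam mu : ℝ) (τ : ℂ) : ℂ :=
  ∑' p : ℤ × ℤ, cexp (2 * π * I * (τ * (a * (p.1 + α) ^ 2 + b * (p.1 + α) * (p.2 + β) +
    c * (p.2 + β) ^ 2) + lam * p.1 + mu * p.2))

lemma summable_exp_neg_mul_sq {y : ℝ} (hy : 0 < y) (α : ℝ) :
    Summable fun n : ℤ => rexp (-(y * (n + α) ^ 2)) := by
  have h := ((summable_jacobiTheta₂_term_iff (y / π * α * I) (y / π * I)).2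
    (by simpa using by positivity)).norm.mul_left (rexp (-(y * α ^ 2)))
  refine h.congr fun n => ?_
  rw [norm_jacobiTheta₂_term, ← Real.exp_add]
  congr 1
  have h1 : ((y : ℂ) / π * I).im = y / π := by
    rw [← Complex.ofReal_div, Complex.im_ofReal_mul]; simp
  have h2 : ((y : ℂ) / π * α * I).im = y / π * α := by
    rw [← Complex.ofReal_div, ← Complex.ofReal_mul, Complex.im_ofReal_mul]; simp
  rw [h1, h2]
  field_simp
  ring

/-- The constant is determinant over trace of the Gram matrix M. By Cayley-Hamilton tr(M)·M - det(M)
= M², which is positive semidefinite; the two squares in the proof are the coordinates of 2M(x, y).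
-/
lemma exists_binForm_ge {a b c : ℝ} (ha : 0 < a) (hd : 0 < 4 * a * c - b ^ 2) :
    ∃ δ > 0, ∀ x y : ℝ, δ * (x ^ 2 + y ^ 2) ≤ a * x ^ 2 + b * x * y + c * y ^ 2 := by
  have hc : 0 < c := by
    by_contra h
    nlinarith [sq_nonneg b, mul_nonneg ha.le (not_lt.1 h |> sub_nonneg.2)]
  refine ⟨(4 * a * c - b ^ 2) / (4 * (a + c)), by positivity, fun x y => ?_⟩
  rw [div_mul_eq_mul_div, div_le_iff₀ (by positivity)]
  nlinarith [sq_nonneg (2 * a * x + b * y), sq_nonneg (b * x + 2 * c * y)]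

lemma norm_binTheta_term (a b c α β lam mu : ℝ) (τ : ℂ) (n m : ℤ) :
    ‖cexp (2 * π * I * (τ * (a * (n + α) ^ 2 + b * (n + α) * (m + β) +
      c * (m + β) ^ 2) + lam * n + mu * m))‖ =
    rexp (-(2 * π * τ.im * (a * (n + α) ^ 2 + b * (n + α) * (m + β) + c * (m + β) ^ 2))) := by
  rw [Complex.norm_exp]
  congr 1
  have : (2 * π * I * (τ * (a * (n + α) ^ 2 + b * (n + α) * (m + β) +
      c * (m + β) ^ 2) + lam * n + mu * m) : ℂ) =
      ((2 * π * (a * (n + α) ^ 2 + b * (n + α) * (m + β) + c * (m + β) ^ 2) : ℝ) : ℂ) * (τ * I) +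
      ((2 * π * (lam * n + mu * m) : ℝ) : ℂ) * I := by
    push_cast; ring
  rw [this, Complex.add_re, Complex.re_ofReal_mul, Complex.re_ofReal_mul]
  simp
  ring

lemma summable_binTheta {a b c : ℝ} (ha : 0 < a) (hd : 0 < 4 * a * c - b ^ 2)
    (α β lam mu : ℝ) {τ : ℂ} (hτ : 0 < τ.im) :
    Summable fun p : ℤ × ℤ => cexp (2 * π * I * (τ * (a * (p.1 + α) ^ 2 +
      b * (p.1 + α) * (p.2 + β) + c * (p.2 + β) ^ 2) + lam * p.1 + mu * p.2)) := by
  obtain ⟨δ, hδ, h⟩ := exists_binForm_ge ha hd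
  have hy : 0 < 2 * π * τ.im * δ := by positivity
  refine Summable.of_norm_bounded ((summable_exp_neg_mul_sq hy α).mul_of_nonneg
    (summable_exp_neg_mul_sq hy β) (fun _ => (Real.exp_pos _).le) (fun _ => (Real.exp_pos _).le))
    fun p => ?_
  rw [norm_binTheta_term, ← Real.exp_add, Real.exp_le_exp]
  have := mul_le_mul_of_nonneg_left (h (p.1 + α) (p.2 + β)) (by positivity : 0 ≤ 2 * π * τ.im)
  nlinarith [this]

lemma im_neg_one_div_pos {z : ℂ} (hz : 0 < z.im) : 0 < (-1 / z).im := by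
  have h : z ≠ 0 := by rintro rfl; simp at hz
  rw [neg_div, one_div, Complex.neg_im, Complex.inv_im, neg_div, neg_neg]
  exact div_pos hz (Complex.normSq_pos.2 h)

/-- Positive real factors split off the principal logarithm without a branch jump. This merges the
normalising factors of two successive one-dimensional Poisson summations. -/
lemma cpow_half_mul_cpow_half {z : ℂ} (hz : 0 < z.im) {x y : ℝ} (hx : 0 < x) (hy : 0 < y) :
    (-I * (x * z)) ^ (1 / 2 : ℂ) * (-I * (y * z)) ^ (1 / 2 : ℂ) = √(x * y) * (-I * z) := by
  have h0 : -I * z ≠ 0 := by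
    refine mul_ne_zero (by simp) ?_; rintro rfl; simp at hz
  have hx' : (x : ℂ) ≠ 0 := by exact_mod_cast hx.ne'
  have hy' : (y : ℂ) ≠ 0 := by exact_mod_cast hy.ne'
  rw [mul_left_comm, mul_left_comm _ (y : ℂ), Complex.cpow_def_of_ne_zero (mul_ne_zero hx' h0),
    Complex.cpow_def_of_ne_zero (mul_ne_zero hy' h0), Complex.log_ofReal_mul hx h0,
    Complex.log_ofReal_mul hy h0, ← Complex.exp_add,
    show ((Real.log x : ℂ) + Complex.log (-I * z)) * (1 / 2) +
      ((Real.log y : ℂ) + Complex.log (-I * z)) * (1 / 2) =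
      ((Real.log x / 2 + Real.log y / 2 : ℝ) : ℂ) + Complex.log (-I * z) by push_cast; ring,
    Complex.exp_add, Complex.exp_log h0, ← Complex.ofReal_exp]
  congr 2
  rw [Real.sqrt_eq_rpow, Real.rpow_def_of_pos (by positivity), Real.log_mul hx.ne' hy.ne']
  congr 1; ring

lemma tsum_prod_swap {f : ℤ × ℤ → ℂ} (hf : Summable f) :
    ∑' p, f p = ∑' m : ℤ, ∑' n : ℤ, f (n, m) := by
  rw [← (Equiv.prodComm ℤ ℤ).tsum_eq]
  exact Summable.tsum_prod hf.prod_symm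

lemma tsum_comm_of_summable {f : ℤ → ℤ → ℂ} (hf : Summable (Function.uncurry f)) :
    ∑' m : ℤ, ∑' n : ℤ, f n m = ∑' n : ℤ, ∑' m : ℤ, f n m :=
  Summable.tsum_comm hf

set_option maxHeartbeats 1000000 in
/-- Two-dimensional Poisson summation for a Gaussian given by a binary quadratic form. -/
lemma binTheta_eq {a b c : ℝ} (ha : 0 < a) {Δ : ℝ} (hΔ : 4 * a * c - b ^ 2 = Δ) (hd : 0 < Δ)
    (α β lam mu : ℝ) {τ : ℂ} (hτ : 0 < τ.im) :
    binTheta a b c α β lam mu τ = 1 / (√Δ * (-I * τ)) * ∑' p : ℤ × ℤ,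
      cexp (2 * π * I * (-1 / (Δ * τ) * (c * (p.1 - lam) ^ 2 - b * (p.1 - lam) * (p.2 - mu) +
        a * (p.2 - mu) ^ 2) + (p.1 - lam) * α + (p.2 - mu) * β)) := by
  have hτ0 : τ ≠ 0 := by rintro rfl; simp at hτ
  have hI : (-1 / (Δ * τ)).im > 0 := im_neg_one_div_pos (by simpa using by positivity)
  have ha' : (a : ℂ) ≠ 0 := by exact_mod_cast ha.ne'
  have hd' : (Δ : ℂ) ≠ 0 := by exact_mod_cast hd.ne'
  have hc : 0 < c := by
    by_contra h
    nlinarith [sq_nonneg b, mul_nonneg ha.le (not_lt.1 h |> sub_nonneg.2)]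
  have hΔ' : (Δ : ℂ) = 4 * a * c - b ^ 2 := by rw [← hΔ]; push_cast; ring
  have hs := summable_binTheta ha (hΔ ▸ hd) α β lam mu hτ
  -- Completing the square in the first variable leaves a one-dimensional Gaussian sum whose shift
  -- depends on `m`.
  have h1 : ∀ m n : ℤ, cexp (2 * π * I * (τ * (a * (n + α) ^ 2 + b * (n + α) * (m + β) +
      c * (m + β) ^ 2) + lam * n + mu * m)) =
      cexp (2 * π * I * (τ * (Δ / (4 * a)) * (m + β) ^ 2 + mu * m)) *
      cexp (π * I * ((2 * a : ℝ) * τ * (n + (α + b * (m + β) / (2 * a))) ^ 2 + 2 * lam * n)) := by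
    intro m n
    rw [← Complex.exp_add]
    congr 1
    rw [hΔ']
    push_cast
    field_simp
    ring
  -- After dualising the first variable, the dependence on `m` is again Gaussian: the cross term is
  -- linear in `m` and joins the character.
  have h2 : ∀ m k : ℤ, cexp (2 * π * I * (τ * (Δ / (4 * a)) * (m + β) ^ 2 + mu * m)) *
      cexp (π * I * (-(k - lam) ^ 2 / ((2 * a : ℝ) * τ) +
        2 * (k - lam) * (α + b * (m + β) / (2 * a)))) =
      cexp (π * I * (-(k - lam) ^ 2 / ((2 * a : ℝ) * τ) +
        2 * (k - lam) * (α + b * β / (2 * a)))) *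
      cexp (π * I * ((Δ / (2 * a) : ℝ) * τ * (m + β) ^ 2 +
        2 * (mu + (k - lam) * b / (2 * a)) * m)) := by
    intro m k
    rw [← Complex.exp_add, ← Complex.exp_add]
    congr 1
    push_cast
    field_simp
    ring
  have h3 : ∀ k l : ℤ, cexp (π * I * (-(k - lam) ^ 2 / ((2 * a : ℝ) * τ) +
        2 * (k - lam) * (α + b * β / (2 * a)))) *
      cexp (π * I * (-(l - (mu + (k - lam) * b / (2 * a))) ^ 2 / ((Δ / (2 * a) : ℝ) * τ) +
        2 * (l - (mu + (k - lam) * b / (2 * a))) * β)) =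
      cexp (2 * π * I * (-1 / (Δ * τ) * (c * (k - lam) ^ 2 - b * (k - lam) * (l - mu) +
        a * (l - mu) ^ 2) + (k - lam) * α + (l - mu) * β)) := by
    intro k l
    rw [← Complex.exp_add]
    congr 1
    have hc' : (c : ℂ) = (Δ + b ^ 2) / (4 * a) := by rw [hΔ']; field_simp; ring
    rw [hc']
    push_cast
    field_simp
    ring
  -- The mixed series, dual in one variable only, needs its own absolute convergence before the sums
  -- over `k` and `m` are exchanged.
  have hsw : Summable (Function.uncurry fun (k m : ℤ) =>
      cexp (π * I * (-(k - lam) ^ 2 / ((2 * a : ℝ) * τ) +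
        2 * (k - lam) * (α + b * β / (2 * a)))) *
      cexp (π * I * ((Δ / (2 * a) : ℝ) * τ * (m + β) ^ 2 +
        2 * (mu + (k - lam) * b / (2 * a)) * m))) := by
    have hy1 : 0 < π * (-1 / ((2 * a : ℝ) * τ)).im :=
      mul_pos Real.pi_pos (im_neg_one_div_pos (by rw [Complex.im_ofReal_mul]; positivity))
    have hy2 : 0 < π * (Δ / (2 * a) * τ.im) := by positivity
    refine Summable.of_norm_bounded ((summable_exp_neg_mul_sq hy1 (-lam)).mul_of_nonneg
      (summable_exp_neg_mul_sq hy2 β) (fun _ => (Real.exp_pos _).le)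
      (fun _ => (Real.exp_pos _).le)) fun p => le_of_eq ?_
    simp only [Function.uncurry]
    rw [norm_mul, Complex.norm_exp, Complex.norm_exp]
    congr 2
    · rw [show (π * I * (-((p.1 : ℂ) - lam) ^ 2 / ((2 * a : ℝ) * τ) +
        2 * (p.1 - lam) * (α + b * β / (2 * a)))) =
        ((π * (p.1 - lam) ^ 2 : ℝ) : ℂ) * (-1 / ((2 * a : ℝ) * τ) * I) +
        ((2 * π * (p.1 - lam) * (α + b * β / (2 * a)) : ℝ) : ℂ) * I by push_cast; ring]
      rw [Complex.add_re, Complex.re_ofReal_mul, Complex.re_ofReal_mul, Complex.mul_I_re,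
        Complex.I_re]
      ring
    · rw [show (π * I * ((Δ / (2 * a) : ℝ) * τ * ((p.2 : ℂ) + β) ^ 2 +
        2 * (mu + (p.1 - lam) * b / (2 * a)) * p.2)) =
        ((π * (Δ / (2 * a)) * (p.2 + β) ^ 2 : ℝ) : ℂ) * (τ * I) +
        ((2 * π * (mu + (p.1 - lam) * b / (2 * a)) * p.2 : ℝ) : ℂ) * I by push_cast; ring]
      rw [Complex.add_re, Complex.re_ofReal_mul, Complex.re_ofReal_mul, Complex.mul_I_re,
        Complex.I_re]
      ring
  have hsf : Summable fun p : ℤ × ℤ =>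
      cexp (2 * π * I * (-1 / (Δ * τ) * (c * (p.1 - lam) ^ 2 - b * (p.1 - lam) * (p.2 - mu) +
        a * (p.2 - mu) ^ 2) + (p.1 - lam) * α + (p.2 - mu) * β)) := by
    refine ((summable_binTheta (b := -b) hc (by rw [← hΔ] at hd; linarith : 0 < 4 * c * a - (-b) ^ 2)
      (-lam) (-mu) α β hI).mul_left (cexp (2 * π * I * (-lam * α - mu * β)))).congr fun p => ?_
    rw [← Complex.exp_add]
    congr 1
    push_cast
    ring
  have hC1 : (-I * ((2 * a : ℝ) * τ)) ^ (1 / 2 : ℂ) * (-I * ((Δ / (2 * a) : ℝ) * τ)) ^ (1 / 2 : ℂ) =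
      √Δ * (-I * τ) := by
    rw [cpow_half_mul_cpow_half hτ (by positivity) (by positivity)]
    congr 3; field_simp
  rw [binTheta, tsum_prod_swap hs, hsf.tsum_prod, ← hC1, one_div, mul_inv]
  calc _ = ∑' m : ℤ, ((-I * ((2 * a : ℝ) * τ)) ^ (1 / 2 : ℂ))⁻¹ * ∑' k : ℤ,
      cexp (π * I * (-(k - lam) ^ 2 / ((2 * a : ℝ) * τ) +
        2 * (k - lam) * (α + b * β / (2 * a)))) *
      cexp (π * I * ((Δ / (2 * a) : ℝ) * τ * (m + β) ^ 2 +
        2 * (mu + (k - lam) * b / (2 * a)) * m)) := by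
        refine tsum_congr fun m => (tsum_congr (h1 m)).trans ?_
        rw [tsum_mul_left, tsum_gaussian_char, ← tsum_congr (h2 m),
          tsum_mul_left, one_div, mul_left_comm]
    _ = _ := by
        rw [tsum_mul_left, tsum_comm_of_summable hsw, mul_assoc]
        refine congrArg _ ?_
        rw [← tsum_mul_left]
        refine tsum_congr fun k => ?_
        rw [tsum_mul_left, tsum_gaussian_char, mul_left_comm, ← tsum_mul_left, one_div]
        exact congrArg _ (tsum_congr (h3 k))

/-! ### The exponential and the splitting of double sums by residues -/

/-- `z ↦ exp (2 π i z)`. -/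
noncomputable def expTwoPiI (z : ℂ) : ℂ := cexp (2 * π * I * z)

local notation "𝐞" => expTwoPiI

lemma expTwoPiI_add (z w : ℂ) : 𝐞 (z + w) = 𝐞 z * 𝐞 w := by
  rw [expTwoPiI, expTwoPiI, expTwoPiI, ← Complex.exp_add]; ring_nf

lemma expTwoPiI_int_div_two (n : ℤ) : 𝐞 (n / 2) = (-1) ^ n := by
  rw [expTwoPiI, show (2 * π * I * (n / 2) : ℂ) = n * (π * I) by ring, Complex.exp_int_mul,
    Complex.exp_pi_mul_I]

lemma expTwoPiI_of_eq_add {z w : ℂ} (n : ℤ) (h : z = w + n / 2) : 𝐞 z = (-1) ^ n * 𝐞 w := by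
  rw [h, expTwoPiI_add, expTwoPiI_int_div_two, mul_comm]

lemma expTwoPiI_zero : 𝐞 0 = 1 := by simp [expTwoPiI]

lemma neg_one_zpow_congr {m n : ℤ} (h : Even (m - n)) : (-1 : ℂ) ^ m = (-1) ^ n := by
  obtain ⟨k, hk⟩ := h
  rw [show m = n + 2 * k by linarith, zpow_add₀ (by norm_num), zpow_mul]
  simp

lemma norm_expTwoPiI (z : ℂ) : ‖𝐞 z‖ = rexp (-(2 * π * z.im)) := by
  rw [expTwoPiI, Complex.norm_exp]; congr 1; simp

/-- Residues are represented by `s, …, s + N - 1`; the free offset is needed to match half-integral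
characteristics when `N = 7`. -/
lemma tsum_int_mod (N : ℕ) [NeZero N] (s : ℤ) {f : ℤ × ℤ → ℂ} (hf : Summable f) :
    ∑' p, f p = ∑ t : Fin N, ∑' p : ℤ × ℤ, f (N * p.1 + s + (t : ℕ), p.2) := by
  let E : Fin N × (ℤ × ℤ) ≃ ℤ × ℤ :=
    (Equiv.prodAssoc _ _ _).symm.trans (Equiv.prodCongr
      (((Equiv.prodComm _ _).trans (Int.divModEquiv N).symm).trans (Equiv.addRight s))
      (Equiv.refl ℤ))
  have hE : ∀ x, E x = (N * x.2.1 + s + (x.1 : ℕ), x.2.2) := by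
    rintro ⟨t, k, m⟩
    simp [E, Int.divModEquiv]
    ring
  have h := Summable.tsum_prod (E.summable_iff.2 hf)
  simp only [Function.comp_def, hE, tsum_fintype] at h
  rw [← E.tsum_eq, ← h]
  simp only [hE]

lemma tsum_int_mod_snd (N : ℕ) [NeZero N] {f : ℤ × ℤ → ℂ} (hf : Summable f) :
    ∑' p, f p = ∑ t : Fin N, ∑' p : ℤ × ℤ, f (p.1, N * p.2 + (t : ℕ)) := by
  have h := tsum_int_mod N 0 (hf.comp_injective (Equiv.prodComm ℤ ℤ).injective)
  simp only [Function.comp_def, Equiv.prodComm_apply, Prod.swap_prod_mk, add_zero] at h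
  rw [← (Equiv.prodComm ℤ ℤ).tsum_eq]
  simp only [Equiv.prodComm_apply]
  rw [h]
  refine Finset.sum_congr rfl fun t _ => ?_
  rw [← (Equiv.prodComm ℤ ℤ).tsum_eq]
  simp

lemma tsum_int_parity {f : ℤ × ℤ → ℂ} (hf : Summable f) :
    ∑' p, f p = ∑' p : ℤ × ℤ, f (2 * p.1, 2 * p.2) + ∑' p : ℤ × ℤ, f (2 * p.1 + 1, 2 * p.2) +
      ∑' p : ℤ × ℤ, f (2 * p.1, 2 * p.2 + 1) + ∑' p : ℤ × ℤ, f (2 * p.1 + 1, 2 * p.2 + 1) := by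
  have h := tsum_int_mod 2 0 hf
  have hs : ∀ t : ℤ, Summable fun p : ℤ × ℤ => f (2 * p.1 + t, p.2) := fun t =>
    hf.comp_injective (i := fun p : ℤ × ℤ => (2 * p.1 + t, p.2)) (by
      rintro ⟨x, y⟩ ⟨x', y'⟩ h; simp at h ⊢; omega)
  have h0 := tsum_int_mod_snd 2 (hs 0)
  have h1 := tsum_int_mod_snd 2 (hs 1)
  simp [Fin.sum_univ_two] at h h0 h1
  rw [h, h0, h1]
  ring

/-! ### Coset theta series and their inversion -/

/-- The theta series of the form `a x² + b x y + c y²` over the coset `(i/2, j/2) + ℤ²`. -/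
noncomputable def halfTheta (a b c i j : ℤ) (τ : ℂ) : ℂ :=
  ∑' p : ℤ × ℤ, 𝐞 (τ / 4 * (a * (2 * p.1 + i) ^ 2 + b * (2 * p.1 + i) * (2 * p.2 + j) +
    c * (2 * p.2 + j) ^ 2))

lemma binTheta_eq_tsum (a b c α β lam mu : ℝ) (τ : ℂ) : binTheta a b c α β lam mu τ =
    ∑' p : ℤ × ℤ, 𝐞 (τ * (a * (p.1 + α) ^ 2 + b * (p.1 + α) * (p.2 + β) +
    c * (p.2 + β) ^ 2) + lam * p.1 + mu * p.2) := rfl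

lemma summable_halfTheta {a b c : ℤ} (ha : 0 < a) (hd : 4 * a * c - b ^ 2 = 56) (i j : ℤ)
    {τ : ℂ} (hτ : 0 < τ.im) : Summable fun p : ℤ × ℤ => 𝐞 (τ / 4 * (a * (2 * p.1 + i) ^ 2 +
      b * (2 * p.1 + i) * (2 * p.2 + j) + c * (2 * p.2 + j) ^ 2)) := by
  have hd' : 4 * (a : ℝ) * c - b ^ 2 = 56 := by exact_mod_cast hd
  refine (summable_binTheta (a := a) (b := b) (c := c) (by exact_mod_cast ha)
    (by rw [hd']; norm_num) (i / 2) (j / 2) 0 0 hτ).congr fun p => ?_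
  rw [expTwoPiI]; push_cast; ring_nf

/-- Inversion formula for theta series of binary forms of discriminant `-56`. -/
lemma binTheta_inversion {a b c : ℤ} (ha : 0 < a) (hd : 4 * a * c - b ^ 2 = 56)
    (α β lam : ℝ) {σ : ℂ} (hσ : 0 < σ.im) :
    binTheta a b c α β lam 0 (-1 / (56 * σ)) = √56 * (-I * σ) *
      ∑' p : ℤ × ℤ, 𝐞 (σ * (c * (p.1 - lam) ^ 2 - b * (p.1 - lam) * p.2 + a * p.2 ^ 2) +
        (p.1 - lam) * α + p.2 * β) := by
  have hd' : 4 * (a : ℝ) * c - b ^ 2 = 56 := by exact_mod_cast hd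
  have hσ0 : σ ≠ 0 := by rintro rfl; simp at hσ
  rw [binTheta_eq (by exact_mod_cast ha) hd' (by norm_num) α β lam 0
    (im_neg_one_div_pos (by simpa using hσ))]
  congr 1
  · have h : ((√56 : ℝ) : ℂ) * (√56 : ℝ) = 56 := by
      rw [← Complex.ofReal_mul, Real.mul_self_sqrt (by norm_num)]; norm_num
    have h0 : ((√56 : ℝ) : ℂ) ≠ 0 := by
      intro h'; rw [h'] at h; norm_num at h
    field_simp
    linear_combination (-1 : ℂ) * h + (√56 : ℂ) ^ 2 * I_sq
  · refine tsum_congr fun p => ?_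
    rw [expTwoPiI]
    congr 2
    push_cast
    field_simp
    ring

lemma summable_dual {a b c : ℤ} (ha : 0 < a) (hd : 4 * a * c - b ^ 2 = 56)
    (α β lam : ℝ) {σ : ℂ} (hσ : 0 < σ.im) : Summable fun p : ℤ × ℤ =>
      𝐞 (σ * (c * (p.1 - lam) ^ 2 - b * (p.1 - lam) * p.2 + a * p.2 ^ 2) +
        (p.1 - lam) * α + p.2 * β) := by
  have hd' : 4 * (a : ℝ) * c - b ^ 2 = 56 := by exact_mod_cast hd
  have hc : 0 < c := by nlinarith [sq_nonneg b]
  refine ((summable_binTheta (a := c) (b := -b) (c := a) (by exact_mod_cast hc)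
    (by linarith) (-lam) 0 α β hσ).mul_left (𝐞 (-lam * α))).congr fun p => ?_
  rw [← expTwoPiI, ← expTwoPiI_add]
  congr 1; push_cast; ring

lemma halfTheta_eq_binTheta (a b c i j : ℤ) (τ : ℂ) :
    halfTheta a b c i j τ = binTheta a b c (i / 2) (j / 2) 0 0 τ := by
  rw [binTheta_eq_tsum, halfTheta]
  refine tsum_congr fun p => ?_
  congr 1; push_cast; ring

lemma sqrt_56_div_four : ((√56 : ℝ) : ℂ) / 4 = (√14 : ℝ) / 2 := by
  rw [show (56 : ℝ) = 2 ^ 2 * 14 by norm_num, Real.sqrt_mul (by norm_num),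
    Real.sqrt_sq (by norm_num)]
  push_cast; ring

/-- Inversion at `σ = τ / 4` turns the characteristic `(i/2, j/2)` into a sign character on the dual
lattice. Splitting that lattice by parity gives the four coset series of the adjoint form. -/
lemma halfTheta_fricke {a b c : ℤ} (ha : 0 < a) (hd : 4 * a * c - b ^ 2 = 56) (i j : ℤ)
    {τ : ℂ} (hτ : 0 < τ.im) : halfTheta a b c i j (-1 / (14 * τ)) = √14 / 2 * (-I * τ) *
      (halfTheta c (-b) a 0 0 τ + (-1) ^ i * halfTheta c (-b) a 1 0 τ +
        (-1) ^ j * halfTheta c (-b) a 0 1 τ + (-1) ^ (i + j) * halfTheta c (-b) a 1 1 τ) := by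
  have hσ : 0 < (τ / 4).im := by simpa using hτ
  rw [halfTheta_eq_binTheta, show -1 / (14 * τ) = -1 / (56 * (τ / 4)) by ring_nf,
    binTheta_inversion ha hd _ _ _ hσ, tsum_int_parity (summable_dual ha hd _ _ _ hσ),
    ← sqrt_56_div_four, show (√56 : ℂ) * (-I * (τ / 4)) = √56 / 4 * (-I * τ) by ring]
  congr 1
  simp only [halfTheta, ← tsum_mul_left]
  congr 1
  · congr 1
    · congr 1
      · refine tsum_congr fun p => ?_
        rw [expTwoPiI_of_eq_add (2 * (p.1 * i + p.2 * j)), Even.neg_one_zpow (by simp), one_mul]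
        push_cast; ring
      · refine tsum_congr fun p => ?_
        rw [← neg_one_zpow_congr (m := (2 * p.1 + 1) * i + 2 * p.2 * j)
          ⟨p.1 * i + p.2 * j, by ring⟩]
        refine expTwoPiI_of_eq_add _ ?_
        push_cast; ring
    · refine tsum_congr fun p => ?_
      rw [← neg_one_zpow_congr (m := 2 * p.1 * i + (2 * p.2 + 1) * j)
        ⟨p.1 * i + p.2 * j, by ring⟩]
      refine expTwoPiI_of_eq_add _ ?_
      push_cast; ring
  · refine tsum_congr fun p => ?_
    rw [← neg_one_zpow_congr (m := (2 * p.1 + 1) * i + (2 * p.2 + 1) * j)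
      ⟨p.1 * i + p.2 * j, by ring⟩]
    refine expTwoPiI_of_eq_add _ ?_
    push_cast; ring

/-! ### Quadratic Gauss sums modulo 7 -/

/-- The quadratic Gauss sum `∑ exp (2 π i (-2 a t²) / 7)` modulo `7`. -/
noncomputable def gaussSumSeven (a : ℤ) : ℂ := ∑ t : ZMod 7, ZMod.stdAddChar (-2 * (a : ZMod 7) * t ^ 2)

lemma stdAddChar_seven_eq (n : ℤ) : (ZMod.stdAddChar (n : ZMod 7) : ℂ) = 𝐞 (n / 7) := by
  rw [ZMod.stdAddChar_coe, expTwoPiI]; congr 1; push_cast; ring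

lemma sum_zmod_seven (f : ZMod 7 → ℂ) :
    ∑ t, f t = f 0 + f 1 + f 2 + f 3 + f 4 + f 5 + f 6 :=
  Fin.sum_univ_seven f

/-- Complete the square modulo 7: since `h` inverts `4a`, the sum is centred at `h w`, and a
translation of the residues recovers the pure Gauss sum. -/
lemma sum_gauss_seven {a h : ℤ} (hh : 4 * (a : ZMod 7) * h = 1) (w : ℤ) :
    ∑ t : Fin 7, 𝐞 (-2 * a * ((t : ℕ) : ℂ) ^ 2 / 7 + w * ((t : ℕ) : ℂ) / 7) =
      𝐞 (2 * a * h ^ 2 * w ^ 2 / 7) * gaussSumSeven a := by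
  have h1 : ∀ t : ZMod 7, 𝐞 (-2 * a * (t.val : ℂ) ^ 2 / 7 + w * (t.val : ℂ) / 7) =
      𝐞 (2 * a * h ^ 2 * w ^ 2 / 7) *
        ZMod.stdAddChar (-2 * (a : ZMod 7) * (t - (h : ZMod 7) * (w : ZMod 7)) ^ 2) := by
    intro t
    have e1 : (-2 * a * (t.val : ℂ) ^ 2 / 7 + w * (t.val : ℂ) / 7) =
      ((-2 * a * (t.val : ℤ) ^ 2 + w * (t.val : ℤ) : ℤ) : ℂ) / 7 := by push_cast; ring
    have e2 : (2 * a * h ^ 2 * w ^ 2 / 7 : ℂ) = ((2 * a * h ^ 2 * w ^ 2 : ℤ) : ℂ) / 7 := by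
      push_cast; ring
    rw [e1, e2, ← stdAddChar_seven_eq, ← stdAddChar_seven_eq, ← AddChar.map_add_eq_mul]
    congr 1
    push_cast
    rw [ZMod.natCast_zmod_val]
    linear_combination (-(w : ZMod 7) * t) * hh
  have h2 : ∑ t : ZMod 7, 𝐞 (-2 * a * (t.val : ℂ) ^ 2 / 7 + w * (t.val : ℂ) / 7) =
      𝐞 (2 * a * h ^ 2 * w ^ 2 / 7) * gaussSumSeven a := by
    rw [Finset.sum_congr rfl fun t _ => h1 t, ← Finset.mul_sum, gaussSumSeven]
    congr 1
    exact Equiv.sum_comp (Equiv.subRight ((h : ZMod 7) * (w : ZMod 7)))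
      (fun t : ZMod 7 => (ZMod.stdAddChar (-2 * (a : ZMod 7) * t ^ 2) : ℂ))
  exact h2

lemma sum_stdAddChar_seven : ∑ t : ZMod 7, (ZMod.stdAddChar t : ℂ) = 0 :=
  AddChar.sum_eq_zero_of_ne_one (ψ := (ZMod.stdAddChar (N := 7))) (by
    intro h
    have := ZMod.injective_stdAddChar (N := 7) (a₁ := 0) (a₂ := 1) (by rw [h]; rfl)
    exact absurd this (by decide))

/-- The nonzero squares modulo 7 are 1, 4 and 2, each hit twice. -/
lemma gaussSumSeven_eq {a : ℤ} {x y z : ZMod 7} (hx : -2 * (a : ZMod 7) = x)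
    (hy : -2 * (a : ZMod 7) * 4 = y) (hz : -2 * (a : ZMod 7) * 2 = z) :
    gaussSumSeven a = 1 + 2 * (ZMod.stdAddChar x + ZMod.stdAddChar y + ZMod.stdAddChar z) := by
  rw [gaussSumSeven, sum_zmod_seven, show (0 : ZMod 7) ^ 2 = 0 by decide,
    show (1 : ZMod 7) ^ 2 = 1 by decide, show (2 : ZMod 7) ^ 2 = 4 by decide,
    show (3 : ZMod 7) ^ 2 = 2 by decide, show (4 : ZMod 7) ^ 2 = 2 by decide,
    show (5 : ZMod 7) ^ 2 = 4 by decide, show (6 : ZMod 7) ^ 2 = 1 by decide,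
    mul_zero, mul_one, hy, hz, hx, AddChar.map_zero_eq_one]
  ring

lemma gaussSumSeven_one : gaussSumSeven 1 = 1 + 2 * (ZMod.stdAddChar (5 : ZMod 7) +
    ZMod.stdAddChar (6 : ZMod 7) + ZMod.stdAddChar (3 : ZMod 7)) :=
  gaussSumSeven_eq (by decide) (by decide) (by decide)

lemma gaussSumSeven_two : gaussSumSeven 2 = gaussSumSeven 1 := by
  rw [gaussSumSeven_one, gaussSumSeven_eq (x := 3) (y := 5) (z := 6) (by decide) (by decide)
    (by decide)]
  ring

/-- Here -6 = 1 is a square modulo 7 and -2 = 5 is not, so the two sums run over complementary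
classes, and all characters add up to 0. This sign separates T from P and S under the transformation
at 2. -/
lemma gaussSumSeven_three : gaussSumSeven 3 = -gaussSumSeven 1 := by
  have h := sum_stdAddChar_seven
  rw [sum_zmod_seven] at h
  rw [gaussSumSeven_one, gaussSumSeven_eq (x := 1) (y := 4) (z := 2) (by decide) (by decide)
    (by decide)]
  have h0 : (ZMod.stdAddChar (0 : ZMod 7) : ℂ) = 1 := AddChar.map_zero_eq_one _
  rw [h0] at h
  linear_combination 2 * h

lemma normSq_gaussSumSeven_one : Complex.normSq (gaussSumSeven 1) = 7 := by
  have hc : ∀ x : ZMod 7, (starRingEnd ℂ) (ZMod.stdAddChar x) = ZMod.stdAddChar (-x) := fun x => by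
    rw [AddChar.map_neg_eq_conj]
  have hp : ∀ x y : ZMod 7, (ZMod.stdAddChar x * ZMod.stdAddChar y : ℂ) = ZMod.stdAddChar (x + y) :=
    fun x y => (AddChar.map_add_eq_mul _ x y).symm
  have h := sum_stdAddChar_seven
  rw [sum_zmod_seven] at h
  have h0 : (ZMod.stdAddChar (0 : ZMod 7) : ℂ) = 1 := AddChar.map_zero_eq_one _
  rw [h0] at h
  have h1 : ((Complex.normSq (gaussSumSeven 1) : ℝ) : ℂ) = 7 := by
    rw [Complex.normSq_eq_conj_mul_self, gaussSumSeven_one]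
    simp only [map_add, map_mul, map_one, hc, Complex.conj_ofNat]
    rw [show -(5 : ZMod 7) = 2 by decide, show -(6 : ZMod 7) = 1 by decide,
      show -(3 : ZMod 7) = 4 by decide]
    have p1 := hp 2 5
    have p2 := hp 2 6
    have p3 := hp 2 3
    have p4 := hp 1 5
    have p5 := hp 1 6
    have p6 := hp 1 3
    have p7 := hp 4 5
    have p8 := hp 4 6
    have p9 := hp 4 3
    rw [show (2 + 5 : ZMod 7) = 0 by decide, AddChar.map_zero_eq_one] at p1
    rw [show (2 + 6 : ZMod 7) = 1 by decide] at p2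
    rw [show (2 + 3 : ZMod 7) = 5 by decide] at p3
    rw [show (1 + 5 : ZMod 7) = 6 by decide] at p4
    rw [show (1 + 6 : ZMod 7) = 0 by decide, AddChar.map_zero_eq_one] at p5
    rw [show (1 + 3 : ZMod 7) = 4 by decide] at p6
    rw [show (4 + 5 : ZMod 7) = 2 by decide] at p7
    rw [show (4 + 6 : ZMod 7) = 3 by decide] at p8
    rw [show (4 + 3 : ZMod 7) = 0 by decide, AddChar.map_zero_eq_one] at p9
    -- Of the nine products, three are 1 and the others run once through the nontrivial characters,
    -- whose sum is -1. Hence 1 - 2 + 4 (3 - 1) = 7.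
    linear_combination 6 * h + 4 * (p1 + p2 + p3 + p4 + p5 + p6 + p7 + p8 + p9)
  exact_mod_cast h1

/-! ### Transformations of Atkin-Lehner type at 2 and 7 -/

lemma summable_expTwoPiI_of_im_eq {ι : Type*} {f g : ι → ℂ} (h : Summable fun p => 𝐞 (f p))
    (hfg : ∀ p, (g p).im = (f p).im) : Summable fun p => 𝐞 (g p) :=
  Summable.of_norm (h.norm.congr fun p => by rw [norm_expTwoPiI, norm_expTwoPiI, hfg])

lemma summable_expTwoPiI_add_ofReal {ι : Type*} {f : ι → ℂ} (g : ι → ℝ)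
    (h : Summable fun p => 𝐞 (f p)) : Summable fun p => 𝐞 (f p + g p) :=
  summable_expTwoPiI_of_im_eq h fun p => by simp

set_option maxHeartbeats 800000 in
/-- Transformation of the coset theta series under `τ ↦ -2/7 - 1/(98 (τ - 2/7))`. -/
lemma halfTheta_atkinLehner_two {a b c h g : ℤ} (ha : 0 < a) (hd : a * c - 7 * b ^ 2 = 2)
    (hh : 4 * (a : ZMod 7) * h = 1) (hg : 4 * a * h ^ 2 - c = 7 * g) (i j : ℤ) {τ u : ℂ}
    (hτ : 0 < u.im) (hu : u = τ - 2 / 7) :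
    halfTheta a (14 * b) (7 * c) i j (-2 / 7 - 1 / (98 * u)) =
      √14 / 2 * (-I * u) * gaussSumSeven a * (-1) ^ (a * i + c * j) *
      (halfTheta c (-(14 * b)) (7 * a) 0 0 τ + (-1) ^ (i + c) *
        halfTheta c (-(14 * b)) (7 * a) 1 0 τ +
        (-1) ^ (j + a) * halfTheta c (-(14 * b)) (7 * a) 0 1 τ +
        (-1) ^ (i + j + c + a) * halfTheta c (-(14 * b)) (7 * a) 1 1 τ) := by
  have hσ : 0 < (u / 4).im := by simpa using hτ
  have hu0 : u ≠ 0 := by rintro rfl; simp at hτ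
  have hW : 0 < (-2 / 7 - 1 / (98 * u)).im := by
    have := im_neg_one_div_pos (z := 98 * u) (by simpa using hτ)
    rw [sub_eq_add_neg, ← neg_div, Complex.add_im]
    have h2 : (-2 / 7 : ℂ).im = 0 := by
      rw [show (-2 / 7 : ℂ) = ((-2 / 7 : ℝ) : ℂ) by push_cast; rfl, Complex.ofReal_im]
    rw [h2, zero_add]; exact this
  have hd1 : 4 * a * (7 * c) - (14 * b) ^ 2 = 56 := by linear_combination 28 * hd
  have hd2 : 4 * (7 * a) * c - (14 * b) ^ 2 = 56 := by linear_combination 28 * hd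
  have hgc : Even (g - c) := ⟨2 * a * h ^ 2 - c - 3 * g - c + c, by linarith⟩
  -- unfold the left-hand side along the residues of the first variable modulo 7
  have hA : halfTheta a (14 * b) (7 * c) i j (-2 / 7 - 1 / (98 * u)) =
      ∑ t : Fin 7, (-1) ^ (a * i + c * j) * 𝐞 (-2 * a * ((t : ℕ) : ℂ) ^ 2 / 7) *
        binTheta (7 * a : ℤ) (14 * b : ℤ) c (i / 2 + (t : ℕ) / 7) (j / 2) 0 0
          (-1 / (56 * (u / 4))) := by
    -- With `n = 7k + 3i + t` one has `2n + i = 7(2k + i) + 2t`, so the characteristic stays `i/2`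
    -- up to the shift `t/7`.
    rw [halfTheta, tsum_int_mod 7 (3 * i) (summable_halfTheta ha hd1 i j hW)]
    refine Finset.sum_congr rfl fun t _ => ?_
    rw [binTheta_eq_tsum, ← tsum_mul_left]
    refine tsum_congr fun p => ?_
    rw [mul_assoc ((-1 : ℂ) ^ (a * i + c * j)), ← expTwoPiI_add]
    -- Apart from the Gauss phase in `t`, the translation by -2/7 contributes `n / 2` to the
    -- exponent, and `n` has the parity of `a i + c j`.
    set n : ℤ := -(7 * a * (2 * p.1 + i) ^ 2 + 4 * a * (2 * p.1 + i) * (t : ℕ) +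
      14 * b * (2 * p.1 + i) * (2 * p.2 + j) + 4 * b * (t : ℕ) * (2 * p.2 + j) +
      c * (2 * p.2 + j) ^ 2) with hn
    rw [← neg_one_zpow_congr (m := n)]
    · refine expTwoPiI_of_eq_add n ?_
      rw [hn]
      push_cast
      field_simp
      ring
    · have e1 := Int.even_mul_succ_self i
      have e2 := Int.even_mul_succ_self j
      obtain ⟨k1, hk1⟩ := e1
      obtain ⟨k2, hk2⟩ := e2
      refine ⟨-(14 * a * p.1 ^ 2 + 14 * a * p.1 * i + 3 * a * i ^ 2 + a * k1 +
        2 * a * (2 * p.1 + i) * (t : ℕ) +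
        7 * b * (2 * p.1 + i) * (2 * p.2 + j) + 2 * b * (t : ℕ) * (2 * p.2 + j) +
        2 * c * p.2 ^ 2 + 2 * c * p.2 * j + c * k2), ?_⟩
      rw [hn]
      linear_combination (-a) * hk1 - c * hk2
  have hB : ∀ t : Fin 7, binTheta (7 * a : ℤ) (14 * b : ℤ) c (i / 2 + (t : ℕ) / 7) (j / 2) 0 0
      (-1 / (56 * (u / 4))) = √14 / 2 * (-I * u) * ∑' p : ℤ × ℤ,
        𝐞 (u / 4 * (c * p.1 ^ 2 - 14 * b * p.1 * p.2 + 7 * a * p.2 ^ 2) +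
          p.1 * (i / 2 + (t : ℕ) / 7) + p.2 * (j / 2)) := by
    intro t
    rw [binTheta_inversion (by omega) hd2 _ _ _ hσ, ← sqrt_56_div_four,
      show (√56 : ℂ) * (-I * (u / 4)) = √56 / 4 * (-I * u) by ring]
    congr 1
    refine tsum_congr fun p => ?_
    congr 1; push_cast; ring
  have hS : ∀ t : ℂ, ∀ r : ℝ, t = r → Summable fun p : ℤ × ℤ =>
      𝐞 (u / 4 * (c * p.1 ^ 2 - 14 * b * p.1 * p.2 + 7 * a * p.2 ^ 2) +
          p.1 * (i / 2 + t) + p.2 * (j / 2)) := by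
    rintro t r rfl
    refine (summable_dual (by omega) hd2 (i / 2 + r) (j / 2) 0 hσ).congr fun p => ?_
    congr 1; push_cast; ring
  -- For a fixed dual vector, the residues `t` enter only through a Gauss sum with linear term
  -- `p.1`.
  have hC : ∑' p : ℤ × ℤ, ∑ t : Fin 7, 𝐞 (-2 * a * ((t : ℕ) : ℂ) ^ 2 / 7) *
        𝐞 (u / 4 * (c * p.1 ^ 2 - 14 * b * p.1 * p.2 + 7 * a * p.2 ^ 2) +
          p.1 * (i / 2 + (t : ℕ) / 7) + p.2 * (j / 2)) =
      gaussSumSeven a * ∑' p : ℤ × ℤ, 𝐞 (u / 4 * (c * p.1 ^ 2 - 14 * b * p.1 * p.2 +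
        7 * a * p.2 ^ 2) + p.1 * (i / 2) + p.2 * (j / 2) + 2 * a * h ^ 2 * p.1 ^ 2 / 7) := by
    rw [← tsum_mul_left]
    refine tsum_congr fun p => ?_
    rw [expTwoPiI_add _ (2 * a * h ^ 2 * p.1 ^ 2 / 7), mul_left_comm, mul_comm (gaussSumSeven a),
      ← sum_gauss_seven hh, Finset.mul_sum]
    refine Finset.sum_congr rfl fun t _ => ?_
    rw [← expTwoPiI_add, ← expTwoPiI_add]
    congr 1; ring
  -- The quadratic phase left by the Gauss sum is absorbed by passing from `u` to `τ = u + 2/7`,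
  -- because `4 a h² ≡ c` modulo 7; only signs remain.
  have hD : ∑' p : ℤ × ℤ, 𝐞 (u / 4 * (c * p.1 ^ 2 - 14 * b * p.1 * p.2 +
        7 * a * p.2 ^ 2) + p.1 * (i / 2) + p.2 * (j / 2) + 2 * a * h ^ 2 * p.1 ^ 2 / 7) =
      (halfTheta c (-(14 * b)) (7 * a) 0 0 τ + (-1) ^ (i + c) *
        halfTheta c (-(14 * b)) (7 * a) 1 0 τ +
        (-1) ^ (j + a) * halfTheta c (-(14 * b)) (7 * a) 0 1 τ +
        (-1) ^ (i + j + c + a) * halfTheta c (-(14 * b)) (7 * a) 1 1 τ) := by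
    have key : ∀ w₁ w₂ n : ℤ, Even (i * w₁ + j * w₂ + c * w₁ + a * w₂ - n) →
        𝐞 (u / 4 * (c * w₁ ^ 2 - 14 * b * w₁ * w₂ + 7 * a * w₂ ^ 2) + w₁ * (i / 2) +
          w₂ * (j / 2) + 2 * a * h ^ 2 * w₁ ^ 2 / 7) =
        (-1) ^ n * 𝐞 (τ / 4 * (c * w₁ ^ 2 + (-(14 * b) : ℤ) * w₁ * w₂ +
          (7 * a : ℤ) * w₂ ^ 2)) := by
      intro w₁ w₂ n hn
      rw [← neg_one_zpow_congr (m := g * w₁ ^ 2 + 2 * b * w₁ * w₂ - a * w₂ ^ 2 + i * w₁ + j * w₂)]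
      · refine expTwoPiI_of_eq_add _ ?_
        have hg' : (g : ℂ) = (4 * a * h ^ 2 - c) / 7 := by
          rw [eq_div_iff (by norm_num)]; exact_mod_cast (by linarith : g * 7 = 4 * a * h ^ 2 - c)
        rw [hu]
        push_cast
        rw [hg']
        ring
      · obtain ⟨k, hk⟩ := hn
        obtain ⟨k1, hk1⟩ := Int.even_mul_succ_self w₁
        obtain ⟨k2, hk2⟩ := Int.even_mul_succ_self w₂
        obtain ⟨k3, hk3⟩ := hgc
        refine ⟨k + k3 * w₁ + g * k1 - g * w₁ + b * w₁ * w₂ - a * k2, ?_⟩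
        linear_combination hk + w₁ * hk3 + g * hk1 - a * hk2
    rw [tsum_int_parity]
    · simp only [halfTheta, ← tsum_mul_left]
      congr 1
      · congr 1
        · congr 1
          · refine tsum_congr fun p => ?_
            rw [key _ _ 0 ⟨i * p.1 + j * p.2 + c * p.1 + a * p.2, by ring⟩, zpow_zero, one_mul]
            push_cast; simp only [add_zero]
          · refine tsum_congr fun p => ?_
            rw [key _ _ (i + c) ⟨i * p.1 + j * p.2 + c * p.1 + a * p.2, by ring⟩]
            push_cast; simp only [add_zero]
        · refine tsum_congr fun p => ?_
          rw [key _ _ (j + a) ⟨i * p.1 + j * p.2 + c * p.1 + a * p.2, by ring⟩]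
          push_cast; simp only [add_zero]
      · refine tsum_congr fun p => ?_
        rw [key _ _ (i + j + c + a) ⟨i * p.1 + j * p.2 + c * p.1 + a * p.2, by ring⟩]
        push_cast; rfl
    · refine (summable_expTwoPiI_add_ofReal (fun p : ℤ × ℤ => 2 * a * h ^ 2 * p.1 ^ 2 / 7)
        (hS 0 0 (by simp))).congr fun p => ?_
      congr 1; push_cast; ring
  have hS' : ∀ t ∈ (Finset.univ : Finset (Fin 7)), Summable fun p : ℤ × ℤ =>
      𝐞 (-2 * a * ((t : ℕ) : ℂ) ^ 2 / 7) *
        𝐞 (u / 4 * (c * p.1 ^ 2 - 14 * b * p.1 * p.2 + 7 * a * p.2 ^ 2) +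
          p.1 * (i / 2 + (t : ℕ) / 7) + p.2 * (j / 2)) :=
    fun t _ => (hS _ ((t : ℕ) / 7 : ℝ) (by push_cast; rfl)).mul_left _
  rw [Summable.tsum_finsetSum hS'] at hC
  simp only [tsum_mul_left] at hC
  rw [hA, ← hD, mul_assoc (√14 / 2 * (-I * u)), mul_comm (gaussSumSeven a), ← mul_assoc,
    mul_assoc _ (gaussSumSeven a), ← hC, Finset.mul_sum]
  refine Finset.sum_congr rfl fun t _ => ?_
  rw [hB]
  ring

lemma tsum_int_parity_snd {f : ℤ × ℤ → ℂ} (hf : Summable f) :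
    ∑' p, f p = ∑' p : ℤ × ℤ, f (p.1, 2 * p.2) + ∑' p : ℤ × ℤ, f (p.1, 2 * p.2 + 1) := by
  have h := tsum_int_mod_snd 2 hf
  simpa [Fin.sum_univ_two] using h

lemma im_half_sub_inv_pos {u : ℂ} (hu : 0 < u.im) : 0 < (1 / 2 - 1 / (28 * u)).im := by
  have := im_neg_one_div_pos (z := 28 * u) (by simpa using hu)
  rw [sub_eq_add_neg, ← neg_div, Complex.add_im]
  have h2 : (1 / 2 : ℂ).im = 0 := by
    rw [show (1 / 2 : ℂ) = ((1 / 2 : ℝ) : ℂ) by push_cast; rfl, Complex.ofReal_im]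
  rw [h2, zero_add]; exact this

set_option maxHeartbeats 800000 in
/-- Transformation under `τ ↦ 1/2 - 1/(28 (τ - 1/2))`, for odd first characteristic. -/
lemma halfTheta_atkinLehner_seven_one {a b c : ℤ} (ha : 0 < a) (hd : a * c - 2 * b ^ 2 = 7)
    (hc : Odd c) (j : ℤ) {τ u : ℂ} (hτ : 0 < u.im) (hu : u = τ - 1 / 2) :
    halfTheta a (4 * b) (2 * c) 1 j (1 / 2 - 1 / (28 * u)) =
      √14 * (-I * u) * 𝐞 (a / 8 + b * j / 2 + c * j ^ 2 / 4) *
      (halfTheta c (-(4 * b)) (2 * a) 0 0 τ + (-1) ^ j * 𝐞 (-a / 4) *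
        halfTheta c (-(4 * b)) (2 * a) 0 1 τ) := by
  have hσ : 0 < (u / 2).im := by simpa using hτ
  have hu0 : u ≠ 0 := by rintro rfl; simp at hτ
  have hW := im_half_sub_inv_pos hτ
  have hd1 : 4 * a * (2 * c) - (4 * b) ^ 2 = 56 := by linear_combination 8 * hd
  have hA : halfTheta a (4 * b) (2 * c) 1 j (1 / 2 - 1 / (28 * u)) =
      𝐞 (a / 8 + b * j / 2 + c * j ^ 2 / 4) *
        binTheta a (4 * b : ℤ) (2 * c : ℤ) (1 / 2) (j / 2) 0 0 (-1 / (56 * (u / 2))) := by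
    rw [halfTheta, binTheta_eq_tsum, ← tsum_mul_left]
    refine tsum_congr fun p => ?_
    rw [← expTwoPiI_add]
    -- On an odd first coset the phase caused by the translation by 1/2 is constant: the variable
    -- part is `n / 2` with `n` even.
    set n : ℤ := a * (p.1 ^ 2 + p.1) + 2 * b * (2 * p.1 * p.2 + p.1 * j + p.2) +
      2 * c * (p.2 ^ 2 + p.2 * j) with hn
    have hev : Even n := by
      obtain ⟨k, hk⟩ := Int.even_mul_succ_self p.1
      refine ⟨a * k + b * (2 * p.1 * p.2 + p.1 * j + p.2) + c * (p.2 ^ 2 + p.2 * j), ?_⟩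
      rw [hn]; linear_combination a * hk
    have h := expTwoPiI_of_eq_add (z := (1 / 2 - 1 / (28 * u)) / 4 * (a * (2 * p.1 + (1 : ℤ)) ^ 2 +
      (4 * b : ℤ) * (2 * p.1 + (1 : ℤ)) * (2 * p.2 + j) + (2 * c : ℤ) * (2 * p.2 + j) ^ 2))
      (w := a / 8 + b * j / 2 + c * j ^ 2 / 4 + (-1 / (56 * (u / 2)) *
        (((a : ℝ) : ℂ) * (p.1 + ((1 / 2 : ℝ) : ℂ)) ^ 2 + (((4 * b : ℤ) : ℝ) : ℂ) *
          (p.1 + ((1 / 2 : ℝ) : ℂ)) * (p.2 + ((j / 2 : ℝ) : ℂ)) +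
        (((2 * c : ℤ) : ℝ) : ℂ) * (p.2 + ((j / 2 : ℝ) : ℂ)) ^ 2) + ((0 : ℝ) : ℂ) * p.1 +
          ((0 : ℝ) : ℂ) * p.2)) n
      (by rw [hn]; push_cast; field_simp; ring)
    rw [h, hev.neg_one_zpow, one_mul]
  -- At `σ = u / 2` the first dual coordinate already enters doubled, so only the second is split by
  -- parity; `t ∈ {0, 1}` is that parity.
  have key : ∀ w₁ w₂ k t : ℤ, w₂ = 2 * k + t → t ^ 2 = t → 𝐞 (u / 2 * ((2 * c : ℤ) *
      (w₁ - (0 : ℝ)) ^ 2 - (4 * b : ℤ) * (w₁ - (0 : ℝ)) * w₂ + a * w₂ ^ 2) +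
      (w₁ - (0 : ℝ)) * (1 / 2 : ℝ) + w₂ * (j / 2 : ℝ)) = (-1) ^ (t * j) * 𝐞 (-a * t / 4) *
      𝐞 (τ / 4 * (c * (2 * w₁) ^ 2 + (-(4 * b) : ℤ) * (2 * w₁) * w₂ + (2 * a : ℤ) * w₂ ^ 2)) := by
    intro w₁ w₂ k t hk ht
    rw [← neg_one_zpow_congr (m := -c * w₁ ^ 2 + 2 * b * w₁ * w₂ - 2 * a * (k ^ 2 + k * t)
      + w₁ + w₂ * j), mul_assoc ((-1 : ℂ) ^ _), ← expTwoPiI_add]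
    · refine expTwoPiI_of_eq_add _ ?_
      have ht' : (t : ℂ) ^ 2 = t := by exact_mod_cast ht
      rw [hu, hk]
      push_cast
      linear_combination (-a / 4 : ℂ) * ht'
    · obtain ⟨m, hm⟩ := Int.even_mul_succ_self w₁
      obtain ⟨m', hm'⟩ := hc
      refine ⟨-m * c + m' * w₁ + w₁ + b * w₁ * w₂ - a * (k ^ 2 + k * t) + k * j, ?_⟩
      rw [hm', hk] at *
      linear_combination (-(2 * m' + 1)) * hm
  rw [hA, binTheta_inversion ha hd1 _ _ _ hσ, tsum_int_parity_snd (summable_dual ha hd1 _ _ _ hσ)]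
  have e0 : ∑' p : ℤ × ℤ, 𝐞 (u / 2 * ((2 * c : ℤ) *
      (p.1 - (0 : ℝ)) ^ 2 - (4 * b : ℤ) * (p.1 - (0 : ℝ)) * (2 * p.2 : ℤ) + a * (2 * p.2 : ℤ) ^ 2) +
      (p.1 - (0 : ℝ)) * (1 / 2 : ℝ) + (2 * p.2 : ℤ) * (j / 2 : ℝ)) =
      halfTheta c (-(4 * b)) (2 * a) 0 0 τ := by
    refine tsum_congr fun p => ?_
    rw [key p.1 _ p.2 0 (by ring) (by norm_num)]
    simp [expTwoPiI_zero]
  have e1 : ∑' p : ℤ × ℤ, 𝐞 (u / 2 * ((2 * c : ℤ) *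
      (p.1 - (0 : ℝ)) ^ 2 - (4 * b : ℤ) * (p.1 - (0 : ℝ)) * (2 * p.2 + 1 : ℤ) +
      a * (2 * p.2 + 1 : ℤ) ^ 2) + (p.1 - (0 : ℝ)) * (1 / 2 : ℝ) + (2 * p.2 + 1 : ℤ) * (j / 2 : ℝ)) =
      (-1) ^ j * 𝐞 (-a / 4) * halfTheta c (-(4 * b)) (2 * a) 0 1 τ := by
    rw [halfTheta, ← tsum_mul_left]
    refine tsum_congr fun p => ?_
    rw [key p.1 _ p.2 1 (by ring) (by norm_num)]
    simp
  rw [e0, e1, show (√56 : ℂ) * (-I * (u / 2)) = √56 / 4 * (-I * u) * 2 by ring, sqrt_56_div_four]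
  ring

set_option maxHeartbeats 800000 in
/-- Transformation under `τ ↦ 1/2 - 1/(28 (τ - 1/2))`, for even first characteristic. -/
lemma halfTheta_atkinLehner_seven_zero {a b c : ℤ} (ha : 0 < a) (hd : a * c - 2 * b ^ 2 = 7)
    (ha' : Odd a) (j : ℤ) {τ u : ℂ} (hτ : 0 < u.im) (hu : u = τ - 1 / 2) :
    halfTheta a (4 * b) (2 * c) 0 j (1 / 2 - 1 / (28 * u)) =
      √14 * (-I * u) * 𝐞 (c * j ^ 2 / 4 - c / 8) *
      (halfTheta c (-(4 * b)) (2 * a) 1 0 τ + (-1) ^ (j + b) * 𝐞 (-a / 4) *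
        halfTheta c (-(4 * b)) (2 * a) 1 1 τ) := by
  have hσ : 0 < (u / 2).im := by simpa using hτ
  have hu0 : u ≠ 0 := by rintro rfl; simp at hτ
  have hW := im_half_sub_inv_pos hτ
  have hd1 : 4 * a * (2 * c) - (4 * b) ^ 2 = 56 := by linear_combination 8 * hd
  -- On the even coset the translation produces the sign `(-1) ^ p.1`, since `a` is odd. Recorded as
  -- the character -1/2, it becomes under inversion a half-integral shift of the first dual
  -- coordinate, hence odd cosets on the right.
  have hA : halfTheta a (4 * b) (2 * c) 0 j (1 / 2 - 1 / (28 * u)) =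
      𝐞 (c * j ^ 2 / 4) *
        binTheta a (4 * b : ℤ) (2 * c : ℤ) 0 (j / 2) (-1 / 2) 0 (-1 / (56 * (u / 2))) := by
    rw [halfTheta, binTheta_eq_tsum, ← tsum_mul_left]
    refine tsum_congr fun p => ?_
    rw [← expTwoPiI_add]
    set n : ℤ := a * p.1 ^ 2 + p.1 + 2 * b * (2 * p.1 * p.2 + p.1 * j) +
      2 * c * (p.2 ^ 2 + p.2 * j) with hn
    have hev : Even n := by
      obtain ⟨k, hk⟩ := Int.even_mul_succ_self p.1
      obtain ⟨m, hm⟩ := ha'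
      refine ⟨a * k - m * p.1 + b * (2 * p.1 * p.2 + p.1 * j) + c * (p.2 ^ 2 + p.2 * j), ?_⟩
      rw [hn]; linear_combination a * hk - p.1 * hm
    have h := expTwoPiI_of_eq_add (z := (1 / 2 - 1 / (28 * u)) / 4 * (a * (2 * p.1 + (0 : ℤ)) ^ 2 +
      (4 * b : ℤ) * (2 * p.1 + (0 : ℤ)) * (2 * p.2 + j) + (2 * c : ℤ) * (2 * p.2 + j) ^ 2))
      (w := c * j ^ 2 / 4 + (-1 / (56 * (u / 2)) *
        (((a : ℝ) : ℂ) * (p.1 + ((0 : ℝ) : ℂ)) ^ 2 + (((4 * b : ℤ) : ℝ) : ℂ) *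
          (p.1 + ((0 : ℝ) : ℂ)) * (p.2 + ((j / 2 : ℝ) : ℂ)) +
        (((2 * c : ℤ) : ℝ) : ℂ) * (p.2 + ((j / 2 : ℝ) : ℂ)) ^ 2) + ((-1 / 2 : ℝ) : ℂ) * p.1 +
          ((0 : ℝ) : ℂ) * p.2)) n
      (by rw [hn]; push_cast; field_simp; ring)
    rw [h, hev.neg_one_zpow, one_mul]
  have key : ∀ w₁ w₂ k t : ℤ, w₂ = 2 * k + t → t ^ 2 = t → 𝐞 (u / 2 * ((2 * c : ℤ) *
      (w₁ - (-1 / 2 : ℝ)) ^ 2 - (4 * b : ℤ) * (w₁ - (-1 / 2 : ℝ)) * w₂ + a * w₂ ^ 2) +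
      (w₁ - (-1 / 2 : ℝ)) * (0 : ℝ) + w₂ * (j / 2 : ℝ)) = (-1) ^ (t * (j + b)) *
      (𝐞 (- c / 8) * 𝐞 (-a * t / 4)) *
      𝐞 (τ / 4 * (c * (2 * w₁ + 1) ^ 2 + (-(4 * b) : ℤ) * (2 * w₁ + 1) * w₂ +
        (2 * a : ℤ) * w₂ ^ 2)) := by
    intro w₁ w₂ k t hk ht
    rw [← neg_one_zpow_congr (m := -c * (w₁ ^ 2 + w₁) + b * (2 * w₁ + 1) * w₂ -
      2 * a * (k ^ 2 + k * t) + w₂ * j), mul_assoc ((-1 : ℂ) ^ _), ← expTwoPiI_add,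
      ← expTwoPiI_add]
    · refine expTwoPiI_of_eq_add _ ?_
      have ht' : (t : ℂ) ^ 2 = t := by exact_mod_cast ht
      rw [hu, hk]
      push_cast
      linear_combination (-a / 4 : ℂ) * ht'
    · obtain ⟨m, hm⟩ := Int.even_mul_succ_self w₁
      refine ⟨-m * c + b * w₁ * w₂ + b * k - a * (k ^ 2 + k * t) + k * j, ?_⟩
      rw [hk] at *
      linear_combination (-c) * hm
  rw [hA, binTheta_inversion ha hd1 _ _ _ hσ, tsum_int_parity_snd (summable_dual ha hd1 _ _ _ hσ)]
  have e0 : ∑' p : ℤ × ℤ, 𝐞 (u / 2 * ((2 * c : ℤ) *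
      (p.1 - (-1 / 2 : ℝ)) ^ 2 - (4 * b : ℤ) * (p.1 - (-1 / 2 : ℝ)) * (2 * p.2 : ℤ) +
      a * (2 * p.2 : ℤ) ^ 2) + (p.1 - (-1 / 2 : ℝ)) * (0 : ℝ) + (2 * p.2 : ℤ) * (j / 2 : ℝ)) =
      𝐞 (-c / 8) * halfTheta c (-(4 * b)) (2 * a) 1 0 τ := by
    rw [halfTheta, ← tsum_mul_left]
    refine tsum_congr fun p => ?_
    rw [key p.1 _ p.2 0 (by ring) (by norm_num)]
    simp [expTwoPiI_zero]
  have e1 : ∑' p : ℤ × ℤ, 𝐞 (u / 2 * ((2 * c : ℤ) *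
      (p.1 - (-1 / 2 : ℝ)) ^ 2 - (4 * b : ℤ) * (p.1 - (-1 / 2 : ℝ)) * (2 * p.2 + 1 : ℤ) +
      a * (2 * p.2 + 1 : ℤ) ^ 2) + (p.1 - (-1 / 2 : ℝ)) * (0 : ℝ) +
      (2 * p.2 + 1 : ℤ) * (j / 2 : ℝ)) =
      𝐞 (-c / 8) * ((-1) ^ (j + b) * 𝐞 (-a / 4) * halfTheta c (-(4 * b)) (2 * a) 1 1 τ) := by
    rw [halfTheta, ← tsum_mul_left, ← tsum_mul_left]
    refine tsum_congr fun p => ?_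
    rw [key p.1 _ p.2 1 (by ring) (by norm_num)]
    simp
    ring
  rw [e0, e1, show (√56 : ℂ) * (-I * (u / 2)) = √56 / 4 * (-I * u) * 2 by ring, sqrt_56_div_four,
    sub_eq_add_neg, ← neg_div, expTwoPiI_add]
  ring

/-! ### Equivalences of forms -/

lemma halfTheta_congr {a b c i j a' b' c' i' j' : ℤ} (e : ℤ × ℤ ≃ ℤ × ℤ)
    (h : ∀ n m : ℤ, a * (2 * n + i) ^ 2 + b * (2 * n + i) * (2 * m + j) + c * (2 * m + j) ^ 2 =
      a' * (2 * (e (n, m)).1 + i') ^ 2 + b' * (2 * (e (n, m)).1 + i') * (2 * (e (n, m)).2 + j') +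
      c' * (2 * (e (n, m)).2 + j') ^ 2) (τ : ℂ) :
    halfTheta a b c i j τ = halfTheta a' b' c' i' j' τ := by
  refine Eq.trans ?_ (e.tsum_eq _)
  refine tsum_congr fun p => ?_
  congr 2
  exact_mod_cast h p.1 p.2

/-- A quarter turn of the lattice carries the adjoint form back to the original one and swaps the
characteristics. -/
lemma halfTheta_dual (a b c i j : ℤ) (τ : ℂ) :
    halfTheta c (-b) a i j τ = halfTheta a b c j i τ :=
  halfTheta_congr (Equiv.mk (fun p => (p.2, -p.1 - i)) (fun p => (-p.2 - i, p.1))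
    (fun p => by simp) (fun p => by simp)) (fun n m => by simp; ring) τ

lemma halfTheta_neg (a b c i j : ℤ) (τ : ℂ) :
    halfTheta a (-b) c i j τ = halfTheta a b c i j τ :=
  halfTheta_congr (Equiv.mk (fun p => (p.1, -p.2 - j)) (fun p => (p.1, -p.2 - j))
    (fun p => by simp) (fun p => by simp)) (fun n m => by simp; ring) τ

lemma halfTheta_shear {a b c i j a' b' c' i' s z : ℤ} (ha : a' = a) (hb : b' = b + 2 * a * s)
    (hc : c' = a * s ^ 2 + b * s + c) (hi : i + s * j = i' + 2 * z) (τ : ℂ) :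
    halfTheta a' b' c' i j τ = halfTheta a b c i' j τ :=
  halfTheta_congr (Equiv.mk (fun p => (p.1 + s * p.2 + z, p.2)) (fun p => (p.1 - s * p.2 - z, p.2))
    (fun p => Prod.ext (by ring) rfl)
    (fun p => Prod.ext (by ring) rfl))
    (fun n m => by
      simp only [Equiv.coe_fn_mk]
      rw [ha, hb, hc, show 2 * (n + s * m + z) + i' = 2 * n + i + s * (2 * m + j) by
        linear_combination -hi]
      ring) τ

/-! ### The theta vectors of discriminant -56 and their transformation matrices -/

/-- The coset theta series of `x² + 14 y²`, indexed by the residue modulo `4` of the exponents. -/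
noncomputable def thetaP (τ : ℂ) : Fin 4 → ℂ := ![halfTheta 1 0 14 0 0 τ, halfTheta 1 0 14 1 0 τ,
  halfTheta 1 0 14 0 1 τ, halfTheta 1 0 14 1 1 τ]

/-- The coset theta series of `2 x² + 7 y²`, indexed by the residue modulo `4` of the exponents. -/
noncomputable def thetaS (τ : ℂ) : Fin 4 → ℂ := ![halfTheta 2 0 7 0 0 τ, halfTheta 2 0 7 1 1 τ,
  halfTheta 2 0 7 1 0 τ, halfTheta 2 0 7 0 1 τ]

/-- The coset theta series of `3 x² + 2 x y + 5 y²`, indexed by the residue modulo `4` of the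
exponents. -/
noncomputable def thetaT (τ : ℂ) : Fin 4 → ℂ := ![halfTheta 3 2 5 0 0 τ, halfTheta 3 2 5 0 1 τ,
  halfTheta 3 2 5 1 1 τ, halfTheta 3 2 5 1 0 τ]

/-- The matrix of `τ ↦ -1/(14 τ)`. -/
def opFricke (v : Fin 4 → ℂ) : Fin 4 → ℂ := ![v 0 + v 1 + v 2 + v 3, v 0 + v 1 - v 2 - v 3,
  v 0 - v 1 + v 2 - v 3, v 0 - v 1 - v 2 + v 3]

/-- The matrix of `τ ↦ -2/7 - 1/(98 (τ - 2/7))`. -/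
def opTwo (v : Fin 4 → ℂ) : Fin 4 → ℂ := ![v 0 - v 1 + v 2 - v 3, -v 0 - v 1 + v 2 + v 3,
  v 0 + v 1 + v 2 + v 3, -v 0 + v 1 + v 2 - v 3]

/-- The matrix of `τ ↦ 1/2 - 1/(28 (τ - 1/2))`. -/
noncomputable def opSeven (v : Fin 4 → ℂ) : Fin 4 → ℂ := ![v 3 - I * v 1, v 0 - I * v 2,
  v 1 - I * v 3, v 2 - I * v 0]

lemma theta_fricke_aux {a b c : ℤ} (ha : 0 < a) (hd : 4 * a * c - b ^ 2 = 56) (i j : ℤ)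
    {τ : ℂ} (hτ : 0 < τ.im) : halfTheta a b c i j (-1 / (14 * τ)) = √14 / 2 * (-I * τ) *
      (halfTheta a b c 0 0 τ + (-1) ^ i * halfTheta a b c 0 1 τ +
        (-1) ^ j * halfTheta a b c 1 0 τ + (-1) ^ (i + j) * halfTheta a b c 1 1 τ) := by
  rw [halfTheta_fricke ha hd i j hτ]
  simp only [halfTheta_dual]

lemma thetaP_fricke {τ : ℂ} (hτ : 0 < τ.im) :
    thetaP (-1 / (14 * τ)) = (√14 / 2 * (-I * τ)) • opFricke (thetaP τ) := by
  have h := fun i j => theta_fricke_aux (a := 1) (b := 0) (c := 14) (by norm_num)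
    (by norm_num) i j hτ
  ext k
  fin_cases k <;> simp [thetaP, opFricke, h, -mul_eq_mul_left_iff, -mul_eq_mul_right_iff] <;>
    ring

lemma thetaS_fricke {τ : ℂ} (hτ : 0 < τ.im) :
    thetaS (-1 / (14 * τ)) = (√14 / 2 * (-I * τ)) • opFricke (thetaS τ) := by
  have h := fun i j => theta_fricke_aux (a := 2) (b := 0) (c := 7) (by norm_num)
    (by norm_num) i j hτ
  ext k
  fin_cases k <;> simp [thetaS, opFricke, h, -mul_eq_mul_left_iff, -mul_eq_mul_right_iff] <;>
    ring

lemma thetaT_fricke {τ : ℂ} (hτ : 0 < τ.im) :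
    thetaT (-1 / (14 * τ)) = (√14 / 2 * (-I * τ)) • opFricke (thetaT τ) := by
  have h := fun i j => theta_fricke_aux (a := 3) (b := 2) (c := 5) (by norm_num)
    (by norm_num) i j hτ
  ext k
  fin_cases k <;> simp [thetaT, opFricke, h, -mul_eq_mul_left_iff, -mul_eq_mul_right_iff] <;>
    ring

lemma thetaP_two {τ w : ℂ} (hτ : 0 < (τ - 2 / 7).im)
    (hw : w = -2 / 7 - 1 / (98 * (τ - 2 / 7))) : thetaP w =
    (√14 / 2 * (-I * (τ - 2 / 7)) * gaussSumSeven 1) • opTwo (thetaS τ) := by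
  have h := fun i j => halfTheta_atkinLehner_two (a := 1) (b := 0) (c := 2) (h := 2) (g := 2)
    (by norm_num) (by norm_num) (by decide) (by norm_num) i j hτ rfl
  simp only [← hw] at h
  norm_num at h
  ext k
  fin_cases k <;> simp [thetaP, thetaS, opTwo, h, -mul_eq_mul_left_iff, -mul_eq_mul_right_iff] <;>
    ring

lemma thetaS_two {τ w : ℂ} (hτ : 0 < (τ - 2 / 7).im)
    (hw : w = -2 / 7 - 1 / (98 * (τ - 2 / 7))) : thetaS w =
    (√14 / 2 * (-I * (τ - 2 / 7)) * gaussSumSeven 1) • opTwo (thetaP τ) := by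
  have h := fun i j => halfTheta_atkinLehner_two (a := 2) (b := 0) (c := 1) (h := 1) (g := 1)
    (by norm_num) (by norm_num) (by decide) (by norm_num) i j hτ rfl
  simp only [← hw] at h
  norm_num [gaussSumSeven_two] at h
  ext k
  fin_cases k <;> simp [thetaP, thetaS, opTwo, h, -mul_eq_mul_left_iff, -mul_eq_mul_right_iff] <;>
    ring

/-- The form (3, 14, 21) is (3, 2, 5) sheared by 2. The minus sign is that of the Gauss sum for 3,
and it makes the map exchange P - T with S + T. -/
lemma thetaT_two {τ w : ℂ} (hτ : 0 < (τ - 2 / 7).im)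
    (hw : w = -2 / 7 - 1 / (98 * (τ - 2 / 7))) : thetaT w =
    -((√14 / 2 * (-I * (τ - 2 / 7)) * gaussSumSeven 1) • opTwo (thetaT τ)) := by
  have h := fun i j => halfTheta_atkinLehner_two (a := 3) (b := 1) (c := 3) (h := 3) (g := 15)
    (by norm_num) (by norm_num) (by decide) (by norm_num) i j hτ rfl
  simp only [← hw] at h
  have h1 : ∀ i j τ, halfTheta 3 14 21 i j τ = halfTheta 3 2 5 i j τ := fun i j τ =>
    halfTheta_shear (s := 2) (z := j) (by norm_num) (by norm_num) (by norm_num) (by ring) τ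
  norm_num [gaussSumSeven_three, halfTheta_neg, h1] at h
  ext k
  fin_cases k <;> simp [thetaT, opTwo, h, -mul_eq_mul_left_iff, -mul_eq_mul_right_iff] <;>
    ring

lemma expTwoPiI_eighth (n : ℤ) {z : ℂ} (h : z = 1 / 8 + n / 4) : 𝐞 z = I ^ n * 𝐞 (1 / 8) := by
  rw [h, expTwoPiI_add, mul_comm]
  congr 1
  rw [expTwoPiI, show (2 * π * I * (n / 4) : ℂ) = n * (π / 2 * I) by ring, Complex.exp_int_mul,
    Complex.exp_pi_div_two_mul_I]

lemma expTwoPiI_quarter (n : ℤ) {z : ℂ} (h : z = n / 4) : 𝐞 z = I ^ n := by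
  rw [h, expTwoPiI, show (2 * π * I * (n / 4) : ℂ) = n * (π / 2 * I) by ring, Complex.exp_int_mul,
    Complex.exp_pi_div_two_mul_I]

lemma I_pow_seven : I ^ 7 = -I := by
  rw [show 7 = 4 + 3 from rfl, pow_add, I_pow_four, I_pow_three, one_mul]

lemma I_zpow_three : I ^ (3 : ℤ) = -I := by
  exact_mod_cast I_pow_three

lemma thetaP_seven {τ w : ℂ} (hτ : 0 < (τ - 1 / 2).im)
    (hw : w = 1 / 2 - 1 / (28 * (τ - 1 / 2))) : thetaP w =
    ((√14 * (-I * (τ - 1 / 2)) * 𝐞 (1 / 8)) • opSeven (thetaS τ)) := by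
  have h00 := halfTheta_atkinLehner_seven_zero (a := 1) (b := 0) (c := 7)
    (by norm_num) (by norm_num) (by decide) 0 hτ rfl
  rw [← hw, expTwoPiI_quarter (z := -(1 : ℤ) / 4) (-1) (by push_cast; ring),
    expTwoPiI_eighth (-4) (by norm_num)] at h00
  have h01 := halfTheta_atkinLehner_seven_zero (a := 1) (b := 0) (c := 7)
    (by norm_num) (by norm_num) (by decide) 1 hτ rfl
  rw [← hw, expTwoPiI_quarter (z := -(1 : ℤ) / 4) (-1) (by push_cast; ring),
    expTwoPiI_eighth (3) (by norm_num)] at h01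
  have h10 := halfTheta_atkinLehner_seven_one (a := 1) (b := 0) (c := 7)
    (by norm_num) (by norm_num) (by decide) 0 hτ rfl
  rw [← hw, expTwoPiI_quarter (z := -(1 : ℤ) / 4) (-1) (by push_cast; ring),
    expTwoPiI_eighth (0) (by norm_num)] at h10
  have h11 := halfTheta_atkinLehner_seven_one (a := 1) (b := 0) (c := 7)
    (by norm_num) (by norm_num) (by decide) 1 hτ rfl
  rw [← hw, expTwoPiI_quarter (z := -(1 : ℤ) / 4) (-1) (by push_cast; ring),
    expTwoPiI_eighth (7) (by norm_num)] at h11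
  have hs : ∀ i j τ, halfTheta 7 0 2 i j τ = halfTheta 2 0 7 j i τ := fun i j τ => by
    simpa using halfTheta_dual 2 0 7 i j τ
  norm_num [hs, I_zpow_three, I_pow_seven] at h00 h01 h10 h11
  ext k
  fin_cases k <;> simp [thetaP, thetaS, opSeven, h00, h01, h10, h11,
    -mul_eq_mul_left_iff, -mul_eq_mul_right_iff] <;>
    first | ring1 | (ring_nf; simp only [I_sq, I_pow_three]; ring_nf)

lemma thetaS_seven {τ w : ℂ} (hτ : 0 < (τ - 1 / 2).im)
    (hw : w = 1 / 2 - 1 / (28 * (τ - 1 / 2))) : thetaS w =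
    ((√14 * (-I * (τ - 1 / 2)) * 𝐞 (1 / 8)) • opSeven (thetaP τ)) := by
  have h00 := halfTheta_atkinLehner_seven_zero (a := 7) (b := 0) (c := 1)
    (by norm_num) (by norm_num) (by decide) 0 hτ rfl
  rw [← hw, expTwoPiI_quarter (z := -(7 : ℤ) / 4) (-7) (by push_cast; ring),
    expTwoPiI_eighth (-1) (by norm_num)] at h00
  have h01 := halfTheta_atkinLehner_seven_zero (a := 7) (b := 0) (c := 1)
    (by norm_num) (by norm_num) (by decide) 1 hτ rfl
  rw [← hw, expTwoPiI_quarter (z := -(7 : ℤ) / 4) (-7) (by push_cast; ring),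
    expTwoPiI_eighth (0) (by norm_num)] at h01
  have h10 := halfTheta_atkinLehner_seven_one (a := 7) (b := 0) (c := 1)
    (by norm_num) (by norm_num) (by decide) 0 hτ rfl
  rw [← hw, expTwoPiI_quarter (z := -(7 : ℤ) / 4) (-7) (by push_cast; ring),
    expTwoPiI_eighth (3) (by norm_num)] at h10
  have h11 := halfTheta_atkinLehner_seven_one (a := 7) (b := 0) (c := 1)
    (by norm_num) (by norm_num) (by decide) 1 hτ rfl
  rw [← hw, expTwoPiI_quarter (z := -(7 : ℤ) / 4) (-7) (by push_cast; ring),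
    expTwoPiI_eighth (4) (by norm_num)] at h11
  have hs : ∀ i j τ, halfTheta 7 0 2 i j τ = halfTheta 2 0 7 j i τ := fun i j τ => by
    simpa using halfTheta_dual 2 0 7 i j τ
  norm_num [hs, I_zpow_three, I_pow_seven] at h00 h01 h10 h11
  ext k
  fin_cases k <;> simp [thetaP, thetaS, opSeven, h00, h01, h10, h11,
    -mul_eq_mul_left_iff, -mul_eq_mul_right_iff] <;>
    first | ring1 | (ring_nf; simp only [I_sq, I_pow_three]; ring_nf)

/-- The form (3, -4, 6) is (3, 2, 5) sheared by -1, which permutes the characteristics with odd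
second entry. Here the minus sign comes from the eighth roots of unity. -/
lemma thetaT_seven {τ w : ℂ} (hτ : 0 < (τ - 1 / 2).im)
    (hw : w = 1 / 2 - 1 / (28 * (τ - 1 / 2))) : thetaT w =
    -((√14 * (-I * (τ - 1 / 2)) * 𝐞 (1 / 8)) • opSeven (thetaT τ)) := by
  have h00 := halfTheta_atkinLehner_seven_zero (a := 3) (b := -1) (c := 3)
    (by norm_num) (by norm_num) (by decide) 0 hτ rfl
  rw [← hw, expTwoPiI_quarter (z := -(3 : ℤ) / 4) (-3) (by push_cast; ring),
    expTwoPiI_eighth (-2) (by norm_num)] at h00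
  have h01 := halfTheta_atkinLehner_seven_zero (a := 3) (b := -1) (c := 3)
    (by norm_num) (by norm_num) (by decide) 1 hτ rfl
  rw [← hw, expTwoPiI_quarter (z := -(3 : ℤ) / 4) (-3) (by push_cast; ring),
    expTwoPiI_eighth (1) (by norm_num)] at h01
  have h10 := halfTheta_atkinLehner_seven_one (a := 3) (b := -1) (c := 3)
    (by norm_num) (by norm_num) (by decide) 0 hτ rfl
  rw [← hw, expTwoPiI_quarter (z := -(3 : ℤ) / 4) (-3) (by push_cast; ring),
    expTwoPiI_eighth (1) (by norm_num)] at h10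
  have h11 := halfTheta_atkinLehner_seven_one (a := 3) (b := -1) (c := 3)
    (by norm_num) (by norm_num) (by decide) 1 hτ rfl
  rw [← hw, expTwoPiI_quarter (z := -(3 : ℤ) / 4) (-3) (by push_cast; ring),
    expTwoPiI_eighth (2) (by norm_num)] at h11
  have hs : ∀ i j τ, halfTheta 3 4 6 i j τ = halfTheta 3 (-4) 6 i j τ := fun i j τ =>
    (halfTheta_neg 3 4 6 i j τ).symm
  have h1 : ∀ i j i' z τ, i - j = i' + 2 * z →
      halfTheta 3 (-4) 6 i j τ = halfTheta 3 2 5 i' j τ := fun i j i' z τ h =>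
    halfTheta_shear (s := -1) (z := z) (by norm_num) (by norm_num) (by norm_num)
      (by linarith) τ
  have t00 : ∀ τ, halfTheta 3 (-4) 6 0 0 τ = halfTheta 3 2 5 0 0 τ :=
    fun τ => h1 0 0 0 0 τ (by norm_num)
  have t01 : ∀ τ, halfTheta 3 (-4) 6 0 1 τ = halfTheta 3 2 5 1 1 τ :=
    fun τ => h1 0 1 1 (-1) τ (by norm_num)
  have t10 : ∀ τ, halfTheta 3 (-4) 6 1 0 τ = halfTheta 3 2 5 1 0 τ :=
    fun τ => h1 1 0 1 0 τ (by norm_num)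
  have t11 : ∀ τ, halfTheta 3 (-4) 6 1 1 τ = halfTheta 3 2 5 0 1 τ :=
    fun τ => h1 1 1 0 0 τ (by norm_num)
  norm_num [hs, t00, t01, t10, t11, I_zpow_three, I_pow_seven] at h00 h01 h10 h11
  ext k
  fin_cases k <;> simp [thetaT, opSeven, h00, h01, h10, h11,
    -mul_eq_mul_left_iff, -mul_eq_mul_right_iff] <;>
    first | ring1 | (ring_nf; simp only [I_sq, I_pow_three]; ring_nf)

/-! ### The defect vector under the transformation matrices -/

/-- The four functions whose vanishing expresses the theta series of `x² + 14 y²` minus those of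
`3 x² + 2 x y + 5 y²` through those of `2 x² + 7 y²` plus those of `3 x² + 2 x y + 5 y²`. -/
def thetaDefect (r : ℂ) (a d : Fin 4 → ℂ) : Fin 4 → ℂ :=
  ![a 0 - r * d 3, a 1 - r * d 0, a 2 + r * d 1, a 3 + r * d 2]

/-- The permutation part of the transformation of `thetaDefect`. -/
def signedShift (v : Fin 4 → ℂ) : Fin 4 → ℂ := ![-v 3, -v 0, v 1, v 2]

/-- The squared Hermitian norm. -/
noncomputable def sumNormSq (v : Fin 4 → ℂ) : ℝ :=
  normSq (v 0) + normSq (v 1) + normSq (v 2) + normSq (v 3)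

lemma sumNormSq_smul (C : ℂ) (v : Fin 4 → ℂ) : sumNormSq (C • v) = normSq C * sumNormSq v := by
  simp [sumNormSq]; ring

lemma sumNormSq_signedShift (v : Fin 4 → ℂ) : sumNormSq (signedShift v) = sumNormSq v := by
  simp [sumNormSq, signedShift]; ring

lemma sumNormSq_opFricke (v : Fin 4 → ℂ) : sumNormSq (opFricke v) = 4 * sumNormSq v := by
  simp [sumNormSq, opFricke, normSq_apply]; ring

lemma sumNormSq_opTwo (v : Fin 4 → ℂ) : sumNormSq (opTwo v) = 4 * sumNormSq v := by
  simp [sumNormSq, opTwo, normSq_apply]; ring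

lemma sumNormSq_opSeven (v : Fin 4 → ℂ) : sumNormSq (opSeven v) = 2 * sumNormSq v := by
  simp [sumNormSq, opSeven, normSq_apply]; ring

lemma thetaDefect_opFricke (C r : ℂ) (a d : Fin 4 → ℂ) :
    thetaDefect r (C • opFricke a) (C • opFricke d) = C • opFricke (thetaDefect r a d) := by
  ext k
  fin_cases k <;> simp [thetaDefect, opFricke, -mul_eq_mul_left_iff] <;> ring

/-- Exchanging the two vectors and inverting `r` rewrites each relation `a = ± r d` as itself up to
the factor `r⁻¹`. The signs in `thetaDefect` are those for which the four relations are permuted up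
to sign after mixing by the matrix. -/
lemma thetaDefect_opTwo (C : ℂ) {r : ℂ} (hr : r ≠ 0) (a d : Fin 4 → ℂ) :
    thetaDefect r⁻¹ (C • opTwo d) (C • opTwo a) =
      (C * r⁻¹) • signedShift (opTwo (thetaDefect r a d)) := by
  ext k
  fin_cases k <;> simp [thetaDefect, opTwo, signedShift, -mul_eq_mul_left_iff] <;>
    field_simp <;> ring

lemma thetaDefect_opSeven (C : ℂ) {r : ℂ} (hr : r ≠ 0) (a d : Fin 4 → ℂ) :
    thetaDefect (I * r⁻¹) (C • opSeven d) (C • opSeven a) =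
      (C * (I * r⁻¹)) • signedShift (opSeven (thetaDefect r a d)) := by
  ext k
  fin_cases k <;> simp [thetaDefect, opSeven, signedShift, -mul_eq_mul_left_iff] <;>
    field_simp <;> ring_nf <;> simp only [I_sq] <;> ring_nf

/-- The exponents of a coset series are constant modulo 4, which is why the theta vectors are
indexed by residues modulo 4. -/
lemma halfTheta_add_one {a b c i j : ℤ} (k : ℤ) (h : ∀ n m : ℤ, ∃ z, a * (2 * n + i) ^ 2 +
    b * (2 * n + i) * (2 * m + j) + c * (2 * m + j) ^ 2 = 4 * z + k) (τ : ℂ) :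
    halfTheta a b c i j (τ + 1) = I ^ k * halfTheta a b c i j τ := by
  rw [halfTheta, halfTheta, ← tsum_mul_left]
  refine tsum_congr fun p => ?_
  obtain ⟨z, hz⟩ := h p.1 p.2
  rw [← expTwoPiI_quarter k rfl, ← expTwoPiI_add]
  have h4 : (a * (2 * p.1 + i) ^ 2 + b * (2 * p.1 + i) * (2 * p.2 + j) + c * (2 * p.2 + j) ^ 2 : ℂ)
      = 4 * z + k := by exact_mod_cast hz
  rw [h4, expTwoPiI_of_eq_add (w := k / 4 + τ / 4 * (4 * z + k)) (2 * z) (by push_cast; ring),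
    Even.neg_one_zpow (by simp), one_mul]

/-- The matrix of `τ ↦ τ + 1`. -/
noncomputable def opShift (v : Fin 4 → ℂ) : Fin 4 → ℂ := ![v 0, I * v 1, -v 2, -I * v 3]

lemma sumNormSq_opShift (v : Fin 4 → ℂ) : sumNormSq (opShift v) = sumNormSq v := by
  simp [sumNormSq, opShift]

lemma thetaP_add_one (τ : ℂ) : thetaP (τ + 1) = opShift (thetaP τ) := by
  have h0 := halfTheta_add_one (a := 1) (b := 0) (c := 14) (i := 0) (j := 0) 0
    (fun n m => ⟨n ^ 2 + 14 * m ^ 2, by ring⟩) τ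
  have h1 := halfTheta_add_one (a := 1) (b := 0) (c := 14) (i := 1) (j := 0) 1
    (fun n m => ⟨n ^ 2 + n + 14 * m ^ 2, by ring⟩) τ
  have h2 := halfTheta_add_one (a := 1) (b := 0) (c := 14) (i := 0) (j := 1) 2
    (fun n m => ⟨n ^ 2 + 14 * m ^ 2 + 14 * m + 3, by ring⟩) τ
  have h3 := halfTheta_add_one (a := 1) (b := 0) (c := 14) (i := 1) (j := 1) 3
    (fun n m => ⟨n ^ 2 + n + 14 * m ^ 2 + 14 * m + 3, by ring⟩) τ
  have e2 : (I : ℂ) ^ (2 : ℤ) = -1 := by exact_mod_cast I_sq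
  ext k
  fin_cases k <;> simp [thetaP, opShift, h0, h1, h2, h3, e2]

lemma thetaS_add_one (τ : ℂ) : thetaS (τ + 1) = opShift (thetaS τ) := by
  have h0 := halfTheta_add_one (a := 2) (b := 0) (c := 7) (i := 0) (j := 0) 0
    (fun n m => ⟨2 * n ^ 2 + 7 * m ^ 2, by ring⟩) τ
  have h1 := halfTheta_add_one (a := 2) (b := 0) (c := 7) (i := 1) (j := 1) 1
    (fun n m => ⟨2 * n ^ 2 + 2 * n + 7 * m ^ 2 + 7 * m + 2, by ring⟩) τ
  have h2 := halfTheta_add_one (a := 2) (b := 0) (c := 7) (i := 1) (j := 0) 2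
    (fun n m => ⟨2 * n ^ 2 + 2 * n + 7 * m ^ 2, by ring⟩) τ
  have h3 := halfTheta_add_one (a := 2) (b := 0) (c := 7) (i := 0) (j := 1) 3
    (fun n m => ⟨2 * n ^ 2 + 7 * m ^ 2 + 7 * m + 1, by ring⟩) τ
  have e2 : (I : ℂ) ^ (2 : ℤ) = -1 := by exact_mod_cast I_sq
  ext k
  fin_cases k <;> simp [thetaS, opShift, h0, h1, h2, h3, e2]

lemma thetaT_add_one (τ : ℂ) : thetaT (τ + 1) = opShift (thetaT τ) := by
  have h0 := halfTheta_add_one (a := 3) (b := 2) (c := 5) (i := 0) (j := 0) 0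
    (fun n m => ⟨3 * n ^ 2 + 2 * n * m + 5 * m ^ 2, by ring⟩) τ
  have h1 := halfTheta_add_one (a := 3) (b := 2) (c := 5) (i := 0) (j := 1) 1
    (fun n m => ⟨3 * n ^ 2 + 2 * n * m + n + 5 * m ^ 2 + 5 * m + 1, by ring⟩) τ
  have h2 := halfTheta_add_one (a := 3) (b := 2) (c := 5) (i := 1) (j := 1) 2
    (fun n m => ⟨3 * n ^ 2 + 3 * n + 2 * n * m + n + m + 5 * m ^ 2 + 5 * m + 2, by ring⟩) τ
  have h3 := halfTheta_add_one (a := 3) (b := 2) (c := 5) (i := 1) (j := 0) 3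
    (fun n m => ⟨3 * n ^ 2 + 3 * n + 2 * n * m + m + 5 * m ^ 2, by ring⟩) τ
  have e2 : (I : ℂ) ^ (2 : ℤ) = -1 := by exact_mod_cast I_sq
  ext k
  fin_cases k <;> simp [thetaT, opShift, h0, h1, h2, h3, e2]

lemma thetaDefect_opShift (r : ℂ) (a d : Fin 4 → ℂ) :
    thetaDefect (I * r) (opShift a) (opShift d) = opShift (thetaDefect r a d) := by
  ext k
  fin_cases k <;> simp [thetaDefect, opShift] <;> ring_nf <;> simp only [I_sq] <;> ring_nf

/-! ### Transformation of the eta quotient -/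

open ModularForm hiding eta
open scoped ModularForm

-- Take absolute values in the weight 12 modularity of Δ = η²⁴ and extract a twelfth root. Working
-- with absolute values avoids the multiplier system of η.
open UpperHalfPlane in
lemma norm_eta_moebius {a b c d : ℤ} (h : a * d - b * c = 1) {z w : ℂ} (hz : 0 < z.im)
    (hw : w = (a * z + b) / (c * z + d)) : ‖η w‖ ^ 2 = ‖c * z + d‖ * ‖η z‖ ^ 2 := by
  let γ : Matrix.SpecialLinearGroup (Fin 2) ℤ := ⟨!![a, b; c, d], by simp [Matrix.det_fin_two, h]⟩
  have h1 := SlashInvariantForm.slash_action_eqn'' CuspForm.discriminant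
    (γ := Matrix.SpecialLinearGroup.mapGL ℝ γ) (MonoidHom.mem_range.2 ⟨γ, rfl⟩) ⟨z, hz⟩
  have h2 : ((γ • (⟨z, hz⟩ : ℍ) : ℍ) : ℂ) = w := by
    rw [coe_specialLinearGroup_apply, hw]; simp [γ]
  have h3 : ‖η w‖ ^ 24 = ‖c * z + d‖ ^ 12 * ‖η z‖ ^ 24 := by
    rw [← norm_pow, ← norm_pow, ← norm_pow, ← norm_mul]
    simp only [CuspForm.coe_discriminant, ModularForm.discriminant] at h1
    rw [← h2]
    refine congrArg _ (h1.trans ?_)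
    rw [mul_eq_mul_right_iff]
    left
    have e0 : (Matrix.SpecialLinearGroup.mapGL ℝ γ).val 1 0 = c := rfl
    have e1 : (Matrix.SpecialLinearGroup.mapGL ℝ γ).val 1 1 = d := rfl
    rw [denom, e0, e1]
    norm_cast
  refine (pow_left_inj₀ (n := 12) (by positivity) (by positivity) (by norm_num)).1 ?_
  rw [mul_pow, ← pow_mul, ← pow_mul]; exact h3


/-- The product for η has real coefficients. The symmetry fixes the unimodular constants in
`etaQuot_two` and `etaQuot_seven`. -/
lemma eta_conj {z : ℂ} (hz : 0 < z.im) : η (-(starRingEnd ℂ z)) = starRingEnd ℂ (η z) := by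
  have h : ∀ n, eta_q n (-(starRingEnd ℂ z)) = starRingEnd ℂ (eta_q n z) := fun n => by
    rw [eta_q_eq_cexp, eta_q_eq_cexp, ← Complex.exp_conj]
    simp [map_ofNat]
  have hm : Multipliable fun n => 1 - eta_q n z := multipliableLocallyUniformlyOn_eta.multipliable hz
  rw [ModularForm.eta, ModularForm.eta, map_mul, hm.map_tprod (starRingEnd ℂ) continuous_conj]
  congr 1
  · rw [Function.Periodic.qParam, Function.Periodic.qParam, ← Complex.exp_conj]
    simp [map_ofNat]
  · exact tprod_congr fun n => by rw [h]; simp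

lemma eqOn_const_of_norm_eq_one {f : ℂ → ℂ} (hf : DifferentiableOn ℂ f {z | 0 < z.im})
    (h1 : ∀ z : ℂ, 0 < z.im → ‖f z‖ = 1) {z w : ℂ} (hz : 0 < z.im) (hw : 0 < w.im) :
    f z = f w := by
  refine Complex.eqOn_of_isPreconnected_of_isMaxOn_norm (U := {z : ℂ | 0 < z.im})
    (convex_halfSpace_im_gt 0).isPreconnected (isOpen_lt continuous_const continuous_im) hf
    (by exact hw) (fun x hx => ?_) (by exact hz)
  simp [h1 x hx, h1 w hw]

lemma eta_add_one (z : ℂ) : η (z + 1) = cexp (2 * π * I / 24) * η z := by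
  have h : ∀ n, eta_q n (z + 1) = eta_q n z := fun n => by
    rw [eta_q_eq_pow, eta_q_eq_pow, mul_add, Complex.exp_add, mul_one, Complex.exp_two_pi_mul_I, mul_one]
  simp only [ModularForm.eta, h, Function.Periodic.qParam]
  rw [mul_add, add_div, Complex.exp_add]
  simp; ring

lemma eta_add_nat (n : ℕ) (z : ℂ) : η (z + n) = cexp (2 * π * I / 24) ^ n * η z := by
  induction n with
  | zero => simp
  | succ n ih => rw [Nat.cast_succ, ← add_assoc, eta_add_one, ih]; ring

/-- The eta quotient `η(τ) η(14 τ) / (η(2 τ) η(7 τ))`. -/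
noncomputable def etaQuot (τ : ℂ) : ℂ := η τ * η (14 * τ) / (η (2 * τ) * η (7 * τ))

/-- The eta product `η(τ) η(14 τ)`. -/
noncomputable def etaPair (τ : ℂ) : ℂ := η τ * η (14 * τ)

lemma etaPair_ne_zero {τ : ℂ} (hτ : 0 < τ.im) : etaPair τ ≠ 0 :=
  mul_ne_zero (eta_ne_zero hτ) (eta_ne_zero (by simpa using hτ))

lemma etaQuot_ne_zero {τ : ℂ} (hτ : 0 < τ.im) : etaQuot τ ≠ 0 :=
  div_ne_zero (etaPair_ne_zero hτ) (mul_ne_zero (eta_ne_zero (by simpa using hτ))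
    (eta_ne_zero (by simpa using hτ)))

lemma differentiableAt_eta_mul {n : ℝ} (hn : 0 < n) {τ : ℂ} (hτ : 0 < τ.im) :
    DifferentiableAt ℂ (fun z => η (n * z)) τ :=
  (differentiableAt_eta_of_mem_upperHalfPlaneSet (z := n * τ) (by simp; positivity)).comp τ
    (by fun_prop)

lemma differentiableAt_etaPair {τ : ℂ} (hτ : 0 < τ.im) : DifferentiableAt ℂ etaPair τ := by
  have h := differentiableAt_eta_mul (n := 14) (by norm_num) hτ
  push_cast at h
  exact (differentiableAt_eta_of_mem_upperHalfPlaneSet hτ).mul h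

lemma differentiableAt_etaQuot {τ : ℂ} (hτ : 0 < τ.im) : DifferentiableAt ℂ etaQuot τ := by
  have h2 := differentiableAt_eta_mul (n := 2) (by norm_num) hτ
  have h7 := differentiableAt_eta_mul (n := 7) (by norm_num) hτ
  push_cast at h2 h7
  exact (differentiableAt_etaPair hτ).div (h2.mul h7)
    (mul_ne_zero (eta_ne_zero (by simpa using hτ)) (eta_ne_zero (by simpa using hτ)))

lemma etaQuot_conj {τ : ℂ} (hτ : 0 < τ.im) :
    etaQuot (-(starRingEnd ℂ τ)) = starRingEnd ℂ (etaQuot τ) := by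
  have h : ∀ n : ℝ, 0 < n → η (n * -(starRingEnd ℂ τ)) = starRingEnd ℂ (η (n * τ)) :=
    fun n hn => by rw [← eta_conj (by simp; positivity)]; simp
  have h2 := h 2 (by norm_num)
  have h7 := h 7 (by norm_num)
  have h14 := h 14 (by norm_num)
  push_cast at h2 h7 h14
  rw [etaQuot, h2, h7, h14, eta_conj hτ, etaQuot]
  simp

/-- The factor is exp(2πi (1 + 14 - 2 - 7) / 24) = exp(2πi / 4). -/
lemma etaQuot_add_one (τ : ℂ) : etaQuot (τ + 1) = I * etaQuot τ := by
  have h2 := eta_add_nat 2 (2 * τ)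
  have h7 := eta_add_nat 7 (7 * τ)
  have h14 := eta_add_nat 14 (14 * τ)
  have hI : cexp (2 * π * I / 24) ^ 6 = I := by
    refine Eq.trans ?_ Complex.exp_pi_div_two_mul_I
    rw [← Complex.exp_nat_mul]; congr 1; push_cast; ring
  push_cast at h2 h7 h14
  rw [etaQuot, etaQuot, mul_add, mul_add, mul_add, mul_one, mul_one, mul_one, h2, h7, h14,
    eta_add_one]
  have h0 := Complex.exp_ne_zero (2 * π * I / 24)
  generalize cexp (2 * π * I / 24) = z at *
  rw [← hI, ← mul_div_mul_left _ (η (2 * τ) * η (7 * τ)) (pow_ne_zero 9 h0), mul_div_assoc']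
  congr 1 <;> ring

lemma normSq_etaQuot (τ : ℂ) : normSq (etaQuot τ) =
    ‖η τ‖ ^ 2 * ‖η (14 * τ)‖ ^ 2 / (‖η (2 * τ)‖ ^ 2 * ‖η (7 * τ)‖ ^ 2) := by
  simp [etaQuot, normSq_eq_norm_sq, mul_pow]

lemma normSq_etaPair (τ : ℂ) : normSq (etaPair τ) = ‖η τ‖ ^ 2 * ‖η (14 * τ)‖ ^ 2 := by
  simp [etaPair, normSq_eq_norm_sq, mul_pow]

lemma eta_fricke {τ w : ℂ} (hτ : 0 < τ.im) (hw : w = -1 / (14 * τ)) :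
    ‖η w‖ ^ 2 = 14 * ‖τ‖ * ‖η (14 * τ)‖ ^ 2 ∧ ‖η (14 * w)‖ ^ 2 = ‖τ‖ * ‖η τ‖ ^ 2 ∧
    ‖η (2 * w)‖ ^ 2 = 7 * ‖τ‖ * ‖η (7 * τ)‖ ^ 2 ∧
    ‖η (7 * w)‖ ^ 2 = 2 * ‖τ‖ * ‖η (2 * τ)‖ ^ 2 := by
  have h0 : τ ≠ 0 := by rintro rfl; simp at hτ
  refine ⟨?_, ?_, ?_, ?_⟩
  · rw [norm_eta_moebius (a := 0) (b := -1) (c := 1) (d := 0) (by norm_num) (z := 14 * τ)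
      (by simpa using hτ) (by rw [hw]; simp)]; simp
  · rw [norm_eta_moebius (a := 0) (b := -1) (c := 1) (d := 0) (by norm_num) (z := τ)
      (by simpa using hτ) (by rw [hw]; simp; field_simp)]; simp
  · rw [norm_eta_moebius (a := 0) (b := -1) (c := 1) (d := 0) (by norm_num) (z := 7 * τ)
      (by simpa using hτ) (by rw [hw]; simp; field_simp; norm_num)]; simp
  · rw [norm_eta_moebius (a := 0) (b := -1) (c := 1) (d := 0) (by norm_num) (z := 2 * τ)
      (by simpa using hτ) (by rw [hw]; simp; field_simp; norm_num)]; simp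

/-- For each divisor `n` of 14, scaling by `n` after the map equals a matrix of SL₂(ℤ) after scaling
by another divisor. The divisors are paired as 1 with 2 and 7 with 14; for `eta_seven` as 1 with 7
and 2 with 14. -/
lemma eta_two {τ w : ℂ} (hτ : 0 < τ.im) (hw : w = -2 / 7 - 1 / (98 * (τ - 2 / 7))) :
    ‖η w‖ ^ 2 = 14 * ‖τ - 2 / 7‖ * ‖η (2 * τ)‖ ^ 2 ∧
    ‖η (14 * w)‖ ^ 2 = 7 * ‖τ - 2 / 7‖ * ‖η (7 * τ)‖ ^ 2 ∧
    ‖η (2 * w)‖ ^ 2 = 7 * ‖τ - 2 / 7‖ * ‖η τ‖ ^ 2 ∧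
    ‖η (7 * w)‖ ^ 2 = 14 * ‖τ - 2 / 7‖ * ‖η (14 * τ)‖ ^ 2 := by
  obtain ⟨u, rfl⟩ : ∃ u, τ = u + 2 / 7 := ⟨τ - 2 / 7, by ring⟩
  have h0 : u ≠ 0 := by rintro rfl; norm_num at hτ
  have hn : ∀ n : ℝ, 0 < n → n * ‖u‖ = ‖(n : ℂ) * u‖ := fun n hn => by simp [abs_of_pos hn]
  rw [add_sub_cancel_right] at *
  refine ⟨?_, ?_, ?_, ?_⟩
  · rw [norm_eta_moebius (a := -2) (b := 1) (c := 7) (d := -4) (by norm_num)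
      (z := 2 * (u + 2 / 7)) (by simpa using hτ), hn 14 (by norm_num)]
    · congr 2; push_cast; ring
    · rw [hw]; push_cast; rw [show (7 * (2 * (u + 2 / 7)) + -4 : ℂ) = 14 * u by ring]
      field_simp; ring
  · rw [norm_eta_moebius (a := -4) (b := 7) (c := 1) (d := -2) (by norm_num)
      (z := 7 * (u + 2 / 7)) (by simpa using hτ), hn 7 (by norm_num)]
    · congr 2; push_cast; ring
    · rw [hw]; push_cast; rw [show (1 * (7 * (u + 2 / 7)) + -2 : ℂ) = 7 * u by ring]
      field_simp; ring
  · rw [norm_eta_moebius (a := -4) (b := 1) (c := 7) (d := -2) (by norm_num)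
      (z := (u + 2 / 7)) (by simpa using hτ), hn 7 (by norm_num)]
    · congr 2; push_cast; ring
    · rw [hw]; push_cast; rw [show (7 * (u + 2 / 7) + -2 : ℂ) = 7 * u by ring]
      field_simp; ring
  · rw [norm_eta_moebius (a := -2) (b := 7) (c := 1) (d := -4) (by norm_num)
      (z := 14 * (u + 2 / 7)) (by simpa using hτ), hn 14 (by norm_num)]
    · congr 2; push_cast; ring
    · rw [hw]; push_cast; rw [show (1 * (14 * (u + 2 / 7)) + -4 : ℂ) = 14 * u by ring]
      field_simp; ring

lemma eta_seven {τ w : ℂ} (hτ : 0 < τ.im) (hw : w = 1 / 2 - 1 / (28 * (τ - 1 / 2))) :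
    ‖η w‖ ^ 2 = 14 * ‖τ - 1 / 2‖ * ‖η (7 * τ)‖ ^ 2 ∧
    ‖η (14 * w)‖ ^ 2 = 2 * ‖τ - 1 / 2‖ * ‖η (2 * τ)‖ ^ 2 ∧
    ‖η (2 * w)‖ ^ 2 = 14 * ‖τ - 1 / 2‖ * ‖η (14 * τ)‖ ^ 2 ∧
    ‖η (7 * w)‖ ^ 2 = 2 * ‖τ - 1 / 2‖ * ‖η τ‖ ^ 2 := by
  obtain ⟨u, rfl⟩ : ∃ u, τ = u + 1 / 2 := ⟨τ - 1 / 2, by ring⟩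
  have h0 : u ≠ 0 := by rintro rfl; norm_num at hτ
  have hn : ∀ n : ℝ, 0 < n → n * ‖u‖ = ‖(n : ℂ) * u‖ := fun n hn => by simp [abs_of_pos hn]
  rw [add_sub_cancel_right] at *
  refine ⟨?_, ?_, ?_, ?_⟩
  · rw [norm_eta_moebius (a := 1) (b := -4) (c := 2) (d := -7) (by norm_num)
      (z := 7 * (u + 1 / 2)) (by simpa using hτ), hn 14 (by norm_num)]
    · congr 2; push_cast; ring
    · rw [hw]; push_cast; rw [show (2 * (7 * (u + 1 / 2)) + -7 : ℂ) = 14 * u by ring]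
      field_simp; ring
  · rw [norm_eta_moebius (a := 7) (b := -8) (c := 1) (d := -1) (by norm_num)
      (z := 2 * (u + 1 / 2)) (by simpa using hτ), hn 2 (by norm_num)]
    · congr 2; push_cast; ring
    · rw [hw]; push_cast; rw [show (1 * (2 * (u + 1 / 2)) + -1 : ℂ) = 2 * u by ring]
      field_simp; ring
  · rw [norm_eta_moebius (a := 1) (b := -8) (c := 1) (d := -7) (by norm_num)
      (z := 14 * (u + 1 / 2)) (by simpa using hτ), hn 14 (by norm_num)]
    · congr 2; push_cast; ring
    · rw [hw]; push_cast; rw [show (1 * (14 * (u + 1 / 2)) + -7 : ℂ) = 14 * u by ring]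
      field_simp; ring
  · rw [norm_eta_moebius (a := 7) (b := -4) (c := 2) (d := -1) (by norm_num)
      (z := (u + 1 / 2)) (by simpa using hτ), hn 2 (by norm_num)]
    · congr 2; push_cast; ring
    · rw [hw]; push_cast; rw [show (2 * (u + 1 / 2) + -1 : ℂ) = 2 * u by ring]
      field_simp; ring

lemma im_sub_inv_pos {u : ℂ} (hu : 0 < u.im) (x : ℝ) {n : ℝ} (hn : 0 < n) :
    0 < (x - 1 / (n * u)).im := by
  have h := im_neg_one_div_pos (z := n * u) (by simp; positivity)
  rw [neg_div, neg_im] at h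
  rw [sub_im, ofReal_im]; linarith

lemma im_two_pos {τ : ℂ} (hτ : 0 < τ.im) : 0 < (-2 / 7 - 1 / (98 * (τ - 2 / 7))).im := by
  have h : (τ - 2 / 7).im = τ.im := by norm_num
  have := im_sub_inv_pos (h ▸ hτ) (-2 / 7) (n := 98) (by norm_num)
  push_cast at this; exact this

lemma im_seven_pos {τ : ℂ} (hτ : 0 < τ.im) : 0 < (1 / 2 - 1 / (28 * (τ - 1 / 2))).im := by
  have h : (τ - 1 / 2).im = τ.im := by norm_num
  have := im_sub_inv_pos (h ▸ hτ) (1 / 2) (n := 28) (by norm_num)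
  push_cast at this; exact this

lemma im_fricke_pos {τ : ℂ} (hτ : 0 < τ.im) : 0 < (-1 / (14 * τ)).im :=
  im_neg_one_div_pos (by simpa using hτ)

lemma norm_eq_one_of_normSq {z : ℂ} (h : normSq z = 1) : ‖z‖ = 1 := by
  rw [normSq_eq_norm_sq] at h
  nlinarith [norm_nonneg z]

lemma norm_eta_sq_ne_zero {τ : ℂ} (hτ : 0 < τ.im) : ‖η τ‖ ^ 2 ≠ 0 :=
  pow_ne_zero 2 (norm_ne_zero_iff.2 (eta_ne_zero hτ))

lemma etaQuot_fricke {τ w : ℂ} (hτ : 0 < τ.im) (hw : w = -1 / (14 * τ)) :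
    etaQuot w = etaQuot τ := by
  have hd : DifferentiableOn ℂ (fun τ => etaQuot (-1 / (14 * τ)) / etaQuot τ) {z | 0 < z.im} := by
    intro z hz
    have hz0 : z ≠ 0 := by rintro rfl; simp at hz
    refine (DifferentiableAt.div ?_ (differentiableAt_etaQuot hz)
      (etaQuot_ne_zero hz)).differentiableWithinAt
    have hg : DifferentiableAt ℂ (fun z => -1 / (14 * z)) z :=
      DifferentiableAt.div (by fun_prop) (by fun_prop) (by simpa using hz0)
    exact (differentiableAt_etaQuot (im_fricke_pos hz)).comp z hg
  have hn : ∀ z : ℂ, 0 < z.im → ‖etaQuot (-1 / (14 * z)) / etaQuot z‖ = 1 := by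
    intro z hz
    obtain ⟨h1, h14, h2, h7⟩ := eta_fricke hz rfl
    have hz0 : ‖z‖ ≠ 0 := by rw [norm_ne_zero_iff]; rintro rfl; simp at hz
    have e1 := norm_eta_sq_ne_zero hz
    have e2 := norm_eta_sq_ne_zero (τ := 2 * z) (by simpa using hz)
    have e7 := norm_eta_sq_ne_zero (τ := 7 * z) (by simpa using hz)
    have e14 := norm_eta_sq_ne_zero (τ := 14 * z) (by simpa using hz)
    apply norm_eq_one_of_normSq
    rw [map_div₀, normSq_etaQuot, normSq_etaQuot, h1, h2, h7, h14]
    generalize ‖η z‖ ^ 2 = x at *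
    generalize ‖η (2 * z)‖ ^ 2 = y at *
    generalize ‖η (7 * z)‖ ^ 2 = v at *
    generalize ‖η (14 * z)‖ ^ 2 = u at *
    field_simp; norm_num
  -- The quotient has modulus one, hence is constant; its value is read off at the fixed point `i /
  -- √14`.
  have hs : √(1 / 14) * √(1 / 14) = 1 / 14 := Real.mul_self_sqrt (by norm_num)
  have hs' : ((√(1 / 14) : ℝ) : ℂ) * (√(1 / 14) : ℝ) = 1 / 14 := by
    rw [← ofReal_mul, hs]; norm_num
  have hs0 : 0 < √(1 / 14) := by positivity
  generalize √(1 / 14) = s at *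
  have hf := eqOn_const_of_norm_eq_one hd hn hτ (w := s * I) (by simpa using hs0)
  have h0 : (s : ℂ) ≠ 0 := by exact_mod_cast hs0.ne'
  rw [show (-1 / (14 * (s * I)) : ℂ) = s * I by
    field_simp; linear_combination (-14 * I ^ 2) * hs' - I_sq, div_self
    (etaQuot_ne_zero (by simpa using hs0)), div_eq_one_iff_eq (etaQuot_ne_zero hτ), ← hw] at hf
  exact hf

lemma etaQuot_two {τ w : ℂ} (hτ : 0 < τ.im) (hw : w = -2 / 7 - 1 / (98 * (τ - 2 / 7))) :
    etaQuot w = (etaQuot τ)⁻¹ := by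
  have hd : DifferentiableOn ℂ (fun τ => etaQuot (-2 / 7 - 1 / (98 * (τ - 2 / 7))) * etaQuot τ)
      {z | 0 < z.im} := by
    intro z hz
    have hz0 : z - 2 / 7 ≠ 0 := by
      intro h; rw [sub_eq_zero.1 h] at hz; norm_num at hz
    refine (DifferentiableAt.mul ?_ (differentiableAt_etaQuot hz)).differentiableWithinAt
    have hg : DifferentiableAt ℂ (fun z => -2 / 7 - 1 / (98 * (z - 2 / 7))) z :=
      (differentiableAt_const _).sub (DifferentiableAt.div (by fun_prop) (by fun_prop)
        (mul_ne_zero (by norm_num) hz0))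
    exact (differentiableAt_etaQuot (im_two_pos hz)).comp z hg
  have hn : ∀ z : ℂ, 0 < z.im →
      ‖etaQuot (-2 / 7 - 1 / (98 * (z - 2 / 7))) * etaQuot z‖ = 1 := by
    intro z hz
    obtain ⟨h1, h14, h2, h7⟩ := eta_two hz rfl
    have hz0 : ‖z - 2 / 7‖ ≠ 0 := by
      rw [norm_ne_zero_iff]; intro h; rw [sub_eq_zero.1 h] at hz; norm_num at hz
    have e1 := norm_eta_sq_ne_zero hz
    have e2 := norm_eta_sq_ne_zero (τ := 2 * z) (by simpa using hz)
    have e7 := norm_eta_sq_ne_zero (τ := 7 * z) (by simpa using hz)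
    have e14 := norm_eta_sq_ne_zero (τ := 14 * z) (by simpa using hz)
    apply norm_eq_one_of_normSq
    rw [map_mul, normSq_etaQuot, normSq_etaQuot, h1, h2, h7, h14]
    generalize ‖η z‖ ^ 2 = x at *
    generalize ‖η (2 * z)‖ ^ 2 = y at *
    generalize ‖η (7 * z)‖ ^ 2 = v at *
    generalize ‖η (14 * z)‖ ^ 2 = u at *
    generalize ‖z - 2 / 7‖ = t at *
    field_simp
  -- The point `2/7 + i/√98` goes to its mirror image in the imaginary axis, so the constant equals
  -- |r|² there; being positive of modulus one, it is 1.
  have hs : √(1 / 98) * √(1 / 98) = 1 / 98 := Real.mul_self_sqrt (by norm_num)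
  have hs' : ((√(1 / 98) : ℝ) : ℂ) * (√(1 / 98) : ℝ) = 1 / 98 := by
    rw [← ofReal_mul, hs]; norm_num
  have hs0 : 0 < √(1 / 98) := by positivity
  generalize √(1 / 98) = s at *
  have hi : 0 < ((2 / 7 : ℂ) + s * I).im := by norm_num; exact hs0
  have hf := eqOn_const_of_norm_eq_one hd hn hτ hi
  have hn0 := hn _ hi
  have h0 : (s : ℂ) ≠ 0 := by exact_mod_cast hs0.ne'
  have hw0 : (-2 / 7 - 1 / (98 * (2 / 7 + s * I - 2 / 7)) : ℂ) =
      -(starRingEnd ℂ (2 / 7 + s * I)) := by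
    simp only [add_sub_cancel_left, map_add, map_mul, map_div₀, map_ofNat, conj_ofReal, conj_I]
    field_simp
    linear_combination (-686 * I ^ 2) * hs' - 7 * I_sq
  rw [hw0, etaQuot_conj hi, ← normSq_eq_conj_mul_self] at hf hn0
  rw [norm_real, Real.norm_of_nonneg (normSq_nonneg _)] at hn0
  rw [hn0, ← hw, ofReal_one] at hf
  exact eq_inv_of_mul_eq_one_left hf

lemma etaQuot_seven {τ w : ℂ} (hτ : 0 < τ.im) (hw : w = 1 / 2 - 1 / (28 * (τ - 1 / 2))) :
    etaQuot w = I * (etaQuot τ)⁻¹ := by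
  have hd : DifferentiableOn ℂ (fun τ => etaQuot (1 / 2 - 1 / (28 * (τ - 1 / 2))) * etaQuot τ)
      {z | 0 < z.im} := by
    intro z hz
    have hz0 : z - 1 / 2 ≠ 0 := by
      intro h; rw [sub_eq_zero.1 h] at hz; norm_num at hz
    refine (DifferentiableAt.mul ?_ (differentiableAt_etaQuot hz)).differentiableWithinAt
    have hg : DifferentiableAt ℂ (fun z => 1 / 2 - 1 / (28 * (z - 1 / 2))) z :=
      (differentiableAt_const _).sub (DifferentiableAt.div (by fun_prop) (by fun_prop)
        (mul_ne_zero (by norm_num) hz0))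
    exact (differentiableAt_etaQuot (im_seven_pos hz)).comp z hg
  have hn : ∀ z : ℂ, 0 < z.im →
      ‖etaQuot (1 / 2 - 1 / (28 * (z - 1 / 2))) * etaQuot z‖ = 1 := by
    intro z hz
    obtain ⟨h1, h14, h2, h7⟩ := eta_seven hz rfl
    have hz0 : ‖z - 1 / 2‖ ≠ 0 := by
      rw [norm_ne_zero_iff]; intro h; rw [sub_eq_zero.1 h] at hz; norm_num at hz
    have e1 := norm_eta_sq_ne_zero hz
    have e2 := norm_eta_sq_ne_zero (τ := 2 * z) (by simpa using hz)
    have e7 := norm_eta_sq_ne_zero (τ := 7 * z) (by simpa using hz)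
    have e14 := norm_eta_sq_ne_zero (τ := 14 * z) (by simpa using hz)
    apply norm_eq_one_of_normSq
    rw [map_mul, normSq_etaQuot, normSq_etaQuot, h1, h2, h7, h14]
    generalize ‖η z‖ ^ 2 = x at *
    generalize ‖η (2 * z)‖ ^ 2 = y at *
    generalize ‖η (7 * z)‖ ^ 2 = v at *
    generalize ‖η (14 * z)‖ ^ 2 = u at *
    generalize ‖z - 1 / 2‖ = t at *
    field_simp
  -- The point `1/2 + i/√28` is fixed and equals its mirror image plus 1. The constant is therefore
  -- `I` times |r|² there, and its modulus is one.
  have hs : √(1 / 28) * √(1 / 28) = 1 / 28 := Real.mul_self_sqrt (by norm_num)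
  have hs' : ((√(1 / 28) : ℝ) : ℂ) * (√(1 / 28) : ℝ) = 1 / 28 := by
    rw [← ofReal_mul, hs]; norm_num
  have hs0 : 0 < √(1 / 28) := by positivity
  generalize √(1 / 28) = s at *
  have hi : 0 < ((1 / 2 : ℂ) + s * I).im := by norm_num; exact hs0
  have hf := eqOn_const_of_norm_eq_one hd hn hτ hi
  have hn0 := hn _ hi
  have h0 : (s : ℂ) ≠ 0 := by exact_mod_cast hs0.ne'
  have hw0 : (1 / 2 - 1 / (28 * (1 / 2 + s * I - 1 / 2)) : ℂ) =
      -(starRingEnd ℂ (1 / 2 + s * I)) + 1 := by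
    simp only [add_sub_cancel_left, map_add, map_mul, map_div₀, map_ofNat, conj_ofReal, conj_I,
      map_one]
    field_simp
    linear_combination (-56 * I ^ 2) * hs' - 2 * I_sq
  rw [hw0, etaQuot_add_one, etaQuot_conj hi, mul_assoc, ← normSq_eq_conj_mul_self] at hf hn0
  rw [norm_mul, norm_I, one_mul, norm_real, Real.norm_of_nonneg (normSq_nonneg _)] at hn0
  rw [hn0, ← hw, ofReal_one, mul_one] at hf
  exact (eq_mul_inv_iff_mul_eq₀ (etaQuot_ne_zero hτ)).2 hf

/-! ### Invariance of the normalised defect -/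

/-- The vector of functions to be shown to vanish. -/
noncomputable def defect (τ : ℂ) : Fin 4 → ℂ :=
  thetaDefect (etaQuot τ) (thetaP τ - thetaT τ) (thetaS τ + thetaT τ)

/-- The invariant attached to `defect`. -/
noncomputable def defectNorm (τ : ℂ) : ℝ := sumNormSq (defect τ) / normSq (etaPair τ)

lemma opFricke_add (v w : Fin 4 → ℂ) : opFricke (v + w) = opFricke v + opFricke w := by
  ext k; fin_cases k <;> simp [opFricke] <;> ring

lemma opFricke_sub (v w : Fin 4 → ℂ) : opFricke (v - w) = opFricke v - opFricke w := by
  ext k; fin_cases k <;> simp [opFricke] <;> ring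

lemma opTwo_add (v w : Fin 4 → ℂ) : opTwo (v + w) = opTwo v + opTwo w := by
  ext k; fin_cases k <;> simp [opTwo] <;> ring

lemma opTwo_sub (v w : Fin 4 → ℂ) : opTwo (v - w) = opTwo v - opTwo w := by
  ext k; fin_cases k <;> simp [opTwo] <;> ring

lemma opSeven_add (v w : Fin 4 → ℂ) : opSeven (v + w) = opSeven v + opSeven w := by
  ext k; fin_cases k <;> simp [opSeven] <;> ring

lemma opSeven_sub (v w : Fin 4 → ℂ) : opSeven (v - w) = opSeven v - opSeven w := by
  ext k; fin_cases k <;> simp [opSeven] <;> ring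

lemma opShift_add (v w : Fin 4 → ℂ) : opShift (v + w) = opShift v + opShift w := by
  ext k; fin_cases k <;> simp [opShift] <;> ring

lemma opShift_sub (v w : Fin 4 → ℂ) : opShift (v - w) = opShift v - opShift w := by
  ext k; fin_cases k <;> simp [opShift] <;> ring

lemma normSq_etaPair_add_one (τ : ℂ) : normSq (etaPair (τ + 1)) = normSq (etaPair τ) := by
  have h14 := eta_add_nat 14 (14 * τ)
  have h : ‖cexp (2 * π * I / 24)‖ = 1 := by
    rw [show (2 * π * I / 24 : ℂ) = ((2 * π / 24 : ℝ) : ℂ) * I by push_cast; ring,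
      norm_exp_ofReal_mul_I]
  push_cast at h14
  rw [normSq_etaPair, mul_add, mul_one, h14, eta_add_one, normSq_etaPair, norm_mul, norm_mul,
    norm_pow, h, one_pow, one_mul, one_mul]

lemma defectNorm_add_one (τ : ℂ) : defectNorm (τ + 1) = defectNorm τ := by
  rw [defectNorm, defect, thetaP_add_one, thetaS_add_one, thetaT_add_one, etaQuot_add_one,
    ← opShift_add, ← opShift_sub, thetaDefect_opShift, sumNormSq_opShift, normSq_etaPair_add_one,
    defectNorm, defect]

lemma defectNorm_sub_one (τ : ℂ) : defectNorm (τ - 1) = defectNorm τ := by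
  rw [← defectNorm_add_one, sub_add_cancel]

lemma defectNorm_add_int (τ : ℂ) (n : ℤ) : defectNorm (τ + n) = defectNorm τ := by
  induction n with
  | zero => simp
  | succ n ih =>
    rw [← ih, ← defectNorm_add_one (τ + (n : ℤ))]; push_cast; ring_nf
  | pred n ih =>
    rw [← ih, ← defectNorm_sub_one (τ + (-n : ℤ))]; push_cast; ring_nf

lemma normSq_sqrt (x : ℝ) (hx : 0 ≤ x) : normSq ((√x : ℝ) : ℂ) = x := by
  rw [normSq_ofReal, Real.mul_self_sqrt hx]

lemma defectNorm_fricke {τ : ℂ} (hτ : 0 < τ.im) : defectNorm (-1 / (14 * τ)) = defectNorm τ := by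
  have h0 : normSq τ ≠ 0 := by rw [normSq_eq_zero.ne]; rintro rfl; simp at hτ
  obtain ⟨h1, h14, -, -⟩ := eta_fricke hτ rfl
  rw [defectNorm, defect, thetaP_fricke hτ, thetaS_fricke hτ, thetaT_fricke hτ,
    etaQuot_fricke hτ rfl, ← smul_add, ← smul_sub, ← opFricke_add, ← opFricke_sub,
    thetaDefect_opFricke, sumNormSq_smul, sumNormSq_opFricke, normSq_etaPair, h1, h14,
    defectNorm, defect, normSq_etaPair]
  generalize sumNormSq _ = x
  have e1 := norm_eta_sq_ne_zero hτ
  have e14 := norm_eta_sq_ne_zero (τ := 14 * τ) (by simpa using hτ)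
  simp only [map_mul, map_div₀, normSq_neg, normSq_I, normSq_ofNat]
  rw [normSq_sqrt 14 (by norm_num)]
  rw [normSq_eq_norm_sq] at h0 ⊢
  generalize ‖η τ‖ ^ 2 = a at *
  generalize ‖η (14 * τ)‖ ^ 2 = b at *
  have : ‖τ‖ ≠ 0 := by simpa using h0
  field_simp; norm_num

/-- The factor |r|⁻² of the defect is compensated by |η(2τ)η(7τ)|² replacing |η(τ)η(14τ)|². The
scalars agree: 4 · (14/4) · 7 = 98 = 14 · 7. -/
lemma defectNorm_two {τ : ℂ} (hτ : 0 < τ.im) :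
    defectNorm (-2 / 7 - 1 / (98 * (τ - 2 / 7))) = defectNorm τ := by
  have hu : 0 < (τ - 2 / 7).im := by norm_num; exact hτ
  have h0 : ‖τ - 2 / 7‖ ≠ 0 := by rw [norm_ne_zero_iff]; intro h; rw [h] at hu; simp at hu
  obtain ⟨h1, h14, -, -⟩ := eta_two hτ rfl
  rw [defectNorm, defect, thetaP_two hu rfl, thetaS_two hu rfl, thetaT_two hu rfl,
    etaQuot_two hτ rfl, sub_neg_eq_add, ← sub_eq_add_neg, ← smul_add, ← smul_sub, ← opTwo_add,
    ← opTwo_sub, thetaDefect_opTwo _ (etaQuot_ne_zero hτ), sumNormSq_smul, sumNormSq_signedShift,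
    sumNormSq_opTwo, normSq_etaPair, h1, h14, defectNorm, defect, normSq_etaPair]
  generalize sumNormSq _ = x
  have e1 := norm_eta_sq_ne_zero hτ
  have e2 := norm_eta_sq_ne_zero (τ := 2 * τ) (by simpa using hτ)
  have e7 := norm_eta_sq_ne_zero (τ := 7 * τ) (by simpa using hτ)
  have e14 := norm_eta_sq_ne_zero (τ := 14 * τ) (by simpa using hτ)
  simp only [map_mul, map_div₀, map_inv₀, normSq_etaQuot, normSq_neg, normSq_I, normSq_ofNat,
    normSq_gaussSumSeven_one]
  rw [normSq_sqrt 14 (by norm_num), normSq_eq_norm_sq]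
  generalize ‖τ - 2 / 7‖ = t at *
  generalize ‖η τ‖ ^ 2 = a at *
  generalize ‖η (14 * τ)‖ ^ 2 = b at *
  generalize ‖η (2 * τ)‖ ^ 2 = c at *
  generalize ‖η (7 * τ)‖ ^ 2 = d at *
  field_simp; norm_num

/-- The cancellation of |r|⁻² is as for the map at 2; the scalars agree because 14 · 2 = 28. -/
lemma defectNorm_seven {τ : ℂ} (hτ : 0 < τ.im) :
    defectNorm (1 / 2 - 1 / (28 * (τ - 1 / 2))) = defectNorm τ := by
  have hu : 0 < (τ - 1 / 2).im := by norm_num; exact hτ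
  have h0 : ‖τ - 1 / 2‖ ≠ 0 := by rw [norm_ne_zero_iff]; intro h; rw [h] at hu; simp at hu
  obtain ⟨h1, h14, -, -⟩ := eta_seven hτ rfl
  rw [defectNorm, defect, thetaP_seven hu rfl, thetaS_seven hu rfl, thetaT_seven hu rfl,
    etaQuot_seven hτ rfl, sub_neg_eq_add, ← sub_eq_add_neg, ← smul_add, ← smul_sub, ← opSeven_add,
    ← opSeven_sub, thetaDefect_opSeven _ (etaQuot_ne_zero hτ), sumNormSq_smul,
    sumNormSq_signedShift, sumNormSq_opSeven, normSq_etaPair, h1, h14, defectNorm, defect,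
    normSq_etaPair]
  generalize sumNormSq _ = x
  have e1 := norm_eta_sq_ne_zero hτ
  have e2 := norm_eta_sq_ne_zero (τ := 2 * τ) (by simpa using hτ)
  have e7 := norm_eta_sq_ne_zero (τ := 7 * τ) (by simpa using hτ)
  have e14 := norm_eta_sq_ne_zero (τ := 14 * τ) (by simpa using hτ)
  have he : normSq (𝐞 (1 / 8)) = 1 := by
    rw [normSq_eq_norm_sq, norm_expTwoPiI]; norm_num
  simp only [map_mul, map_inv₀, normSq_etaQuot, normSq_neg, normSq_I, he]
  rw [normSq_sqrt 14 (by norm_num), normSq_eq_norm_sq]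
  generalize ‖τ - 1 / 2‖ = t at *
  generalize ‖η τ‖ ^ 2 = a at *
  generalize ‖η (14 * τ)‖ ^ 2 = b at *
  generalize ‖η (2 * τ)‖ ^ 2 = c at *
  generalize ‖η (7 * τ)‖ ^ 2 = d at *
  field_simp

lemma defectNorm_two_inv {τ : ℂ} (hτ : 0 < τ.im) :
    defectNorm (2 / 7 - 1 / (98 * (τ + 2 / 7))) = defectNorm τ := by
  have hu : 0 < (τ + 2 / 7).im := by norm_num; exact hτ
  have h0 : τ + 2 / 7 ≠ 0 := by intro h; rw [h] at hu; simp at hu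
  have hi := im_sub_inv_pos hu (2 / 7) (n := 98) (by norm_num)
  push_cast at hi
  rw [← defectNorm_two hi]
  congr 1
  rw [sub_sub_cancel_left, mul_neg, div_neg, sub_neg_eq_add]
  field_simp
  ring

/-! ### Behaviour at i∞ -/

open Filter Asymptotics Topology

lemma binForm_nonneg {a b c : ℤ} (ha : 0 < a) (hd : 4 * a * c - b ^ 2 = 56) (n m : ℤ) :
    0 ≤ a * n ^ 2 + b * n * m + c * m ^ 2 := by
  have h : 0 ≤ 4 * a * (a * n ^ 2 + b * n * m + c * m ^ 2) := by
    have : 4 * a * (a * n ^ 2 + b * n * m + c * m ^ 2) = (2 * a * n + b * m) ^ 2 + 56 * m ^ 2 := by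
      linear_combination m ^ 2 * hd
    rw [this]; positivity
  exact nonneg_of_mul_nonneg_right h (by positivity)

lemma norm_expTwoPiI_quarter_mul (τ : ℂ) (N : ℤ) :
    ‖𝐞 (τ / 4 * N)‖ = rexp (-(π / 2 * τ.im * N)) := by
  rw [norm_expTwoPiI]
  congr 1
  have : (τ / 4 * N).im = τ.im / 4 * N := by
    rw [show τ / 4 * N = ((N / 4 : ℝ) : ℂ) * τ by push_cast; ring, im_ofReal_mul]; ring
  rw [this]; ring

lemma summable_norm_halfTheta {a b c : ℤ} (ha : 0 < a) (hd : 4 * a * c - b ^ 2 = 56) (i j : ℤ)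
    {y : ℝ} (hy : 0 < y) : Summable fun p : ℤ × ℤ => rexp (-(π / 2 * y *
      ((a * (2 * p.1 + i) ^ 2 + b * (2 * p.1 + i) * (2 * p.2 + j) + c * (2 * p.2 + j) ^ 2 : ℤ)))) := by
  have h := (summable_halfTheta ha hd i j (τ := y * I) (by simpa using hy)).norm
  refine h.congr fun p => ?_
  have := norm_expTwoPiI_quarter_mul (y * I)
    (a * (2 * p.1 + i) ^ 2 + b * (2 * p.1 + i) * (2 * p.2 + j) + c * (2 * p.2 + j) ^ 2)
  rw [show (↑y * I).im = y by simp] at this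
  rw [← this]
  push_cast; rfl

lemma differentiableAt_halfTheta {a b c : ℤ} (ha : 0 < a) (hd : 4 * a * c - b ^ 2 = 56) (i j : ℤ)
    {τ : ℂ} (hτ : 0 < τ.im) : DifferentiableAt ℂ (halfTheta a b c i j) τ := by
  have hU : IsOpen {z : ℂ | τ.im / 2 < z.im} := isOpen_lt continuous_const continuous_im
  refine DifferentiableOn.differentiableAt (s := {z : ℂ | τ.im / 2 < z.im}) ?_
    (hU.mem_nhds (by simpa using hτ))
  refine differentiableOn_tsum_of_summable_norm
    (summable_norm_halfTheta ha hd i j (half_pos hτ)) (fun p => ?_) hU (fun p z hz => ?_)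
  · unfold expTwoPiI; fun_prop
  · have := norm_expTwoPiI_quarter_mul z
      (a * (2 * p.1 + i) ^ 2 + b * (2 * p.1 + i) * (2 * p.2 + j) + c * (2 * p.2 + j) ^ 2)
    push_cast at this ⊢
    rw [this]
    have h0 := binForm_nonneg ha hd (2 * p.1 + i) (2 * p.2 + j)
    have h0' : (0 : ℝ) ≤ a * (2 * p.1 + i) ^ 2 + b * (2 * p.1 + i) * (2 * p.2 + j) +
      c * (2 * p.2 + j) ^ 2 := by exact_mod_cast h0
    have hz' : τ.im / 2 ≤ z.im := le_of_lt hz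
    gcongr

/-- The neighbourhoods of `i ∞`. -/
def imInfty : Filter ℂ := comap im atTop

lemma eventually_im_ge (y : ℝ) : ∀ᶠ τ in imInfty, y ≤ τ.im :=
  tendsto_comap.eventually (eventually_ge_atTop y)

lemma norm_expTwoPiI_div_four_pow (τ : ℂ) (e : ℕ) :
    ‖𝐞 (τ / 4) ^ e‖ = rexp (-(π / 2 * τ.im * e)) := by
  have h := norm_expTwoPiI_quarter_mul τ 1
  simp only [Int.cast_one, mul_one] at h
  rw [norm_pow, h, ← Real.exp_nat_mul]; ring_nf

/-- Outside `s` every exponent is at least `e`. After `𝐞 (τ / 4) ^ e` is factored out, the tail for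
`Im τ ≥ 1` is dominated by its value at height 1. -/
lemma halfTheta_isBigO {a b c : ℤ} (ha : 0 < a) (hd : 4 * a * c - b ^ 2 = 56) (i j : ℤ)
    (s : Finset (ℤ × ℤ)) (e : ℕ) (hs : ∀ p ∉ s, (e : ℤ) ≤ a * (2 * p.1 + i) ^ 2 +
      b * (2 * p.1 + i) * (2 * p.2 + j) + c * (2 * p.2 + j) ^ 2) :
    (fun τ => halfTheta a b c i j τ - ∑ p ∈ s, 𝐞 (τ / 4 * (a * (2 * p.1 + i) ^ 2 +
      b * (2 * p.1 + i) * (2 * p.2 + j) + c * (2 * p.2 + j) ^ 2))) =O[imInfty]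
      fun τ => 𝐞 (τ / 4) ^ e := by
  have hsum := summable_norm_halfTheta ha hd i j one_pos
  refine IsBigO.of_bound (∑' p : {p : ℤ × ℤ // p ∉ s}, rexp (π / 2 * e) * rexp (-(π / 2 * 1 *
      ((a * (2 * p.1.1 + i) ^ 2 + b * (2 * p.1.1 + i) * (2 * p.1.2 + j) +
        c * (2 * p.1.2 + j) ^ 2 : ℤ))))) ?_
  filter_upwards [eventually_im_ge 1] with τ hτ
  have h := (summable_halfTheta ha hd i j (τ := τ) (by linarith)).sum_add_tsum_subtype_compl s
  rw [halfTheta, ← h, add_sub_cancel_left, norm_expTwoPiI_div_four_pow, ← tsum_mul_right]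
  have hs1 := ((hsum.mul_left (rexp (π / 2 * e))).mul_right
    (rexp (-(π / 2 * τ.im * e)))).subtype (fun p => p ∉ s)
  refine tsum_of_norm_bounded hs1.hasSum fun p => ?_
  have := norm_expTwoPiI_quarter_mul τ (a * (2 * p.1.1 + i) ^ 2 +
    b * (2 * p.1.1 + i) * (2 * p.1.2 + j) + c * (2 * p.1.2 + j) ^ 2)
  push_cast at this
  rw [this, Function.comp_apply, ← Real.exp_add, ← Real.exp_add]
  have h0 : (e : ℝ) ≤ a * (2 * p.1.1 + i) ^ 2 + b * (2 * p.1.1 + i) * (2 * p.1.2 + j) +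
      c * (2 * p.1.2 + j) ^ 2 := by exact_mod_cast hs p.1 p.2
  push_cast
  rw [Real.exp_le_exp]
  nlinarith [mul_nonneg (mul_nonneg pi_pos.le (sub_nonneg.2 h0)) (sub_nonneg.2 hτ)]

lemma halfTheta_isBigO_pow {a b c : ℤ} (ha : 0 < a) (hd : 4 * a * c - b ^ 2 = 56) (i j : ℤ)
    (e : ℕ) (hs : ∀ n m : ℤ, (e : ℤ) ≤ a * (2 * n + i) ^ 2 +
      b * (2 * n + i) * (2 * m + j) + c * (2 * m + j) ^ 2) :
    halfTheta a b c i j =O[imInfty] fun τ => 𝐞 (τ / 4) ^ e := by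
  simpa using halfTheta_isBigO ha hd i j ∅ e fun p _ => hs p.1 p.2

lemma expTwoPiI_nat_mul (n : ℕ) (z : ℂ) : 𝐞 (n * z) = 𝐞 z ^ n := by
  rw [expTwoPiI, expTwoPiI, ← Complex.exp_nat_mul]; ring_nf

lemma tendsto_expTwoPiI : Tendsto 𝐞 imInfty (𝓝 0) := by
  rw [tendsto_zero_iff_norm_tendsto_zero]
  simp only [norm_expTwoPiI]
  refine Real.tendsto_exp_neg_atTop_nhds_zero.comp ?_
  exact tendsto_comap.const_mul_atTop (by positivity)

lemma isBigO_expTwoPiI_pow {m n : ℕ} (h : m ≤ n) :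
    (fun τ => 𝐞 (τ / 4) ^ n) =O[imInfty] fun τ => 𝐞 (τ / 4) ^ m := by
  refine IsBigO.of_bound 1 ?_
  filter_upwards [eventually_im_ge 0] with τ hτ
  rw [norm_expTwoPiI_div_four_pow, norm_expTwoPiI_div_four_pow, one_mul, Real.exp_le_exp]
  have : (m : ℝ) ≤ n := by exact_mod_cast h
  have h0 : 0 ≤ π / 2 * τ.im := by positivity
  nlinarith

/-- Euler's product `∏ (1 - x ^ n)`. -/
noncomputable def eulerProd (x : ℂ) : ℂ := ∏' n : ℕ, (1 - x ^ (n + 1))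

lemma eta_eq (z : ℂ) : η z = 𝐞 (z / 24) * eulerProd (𝐞 z) := by
  rw [ModularForm.eta, eulerProd]
  congr 1
  · rw [Function.Periodic.qParam, expTwoPiI]; push_cast; ring_nf
  · exact tprod_congr fun n => by rw [eta_q_eq_pow, expTwoPiI]

lemma eulerProd_zero : eulerProd 0 = 1 := by simp [eulerProd]

lemma differentiableAt_eulerProd {x : ℂ} (hx : ‖x‖ < 1) : DifferentiableAt ℂ eulerProd x :=
  differentiableOn_tprod_one_sub_pow.differentiableAt (Metric.isOpen_ball.mem_nhds (by simpa using hx))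

lemma eulerProd_ne_zero {x : ℂ} (hx : ‖x‖ < 1) : eulerProd x ≠ 0 := by
  simp only [eulerProd, sub_eq_add_neg]
  refine tprod_one_add_ne_zero_of_summable (f := fun n => -x ^ (n + 1)) (fun i => ?_) ?_
  · rw [← sub_eq_add_neg, sub_ne_zero]
    intro h
    have := pow_lt_one₀ (norm_nonneg x) hx i.succ_ne_zero
    rw [← norm_pow, ← h, norm_one] at this
    exact lt_irrefl _ this
  · simpa using (summable_nat_add_iff 1).mpr (summable_geometric_of_lt_one (norm_nonneg _) hx)

lemma etaQuot_eq (τ : ℂ) : etaQuot τ = 𝐞 (τ / 4) * (eulerProd (𝐞 τ) * eulerProd (𝐞 τ ^ 14) /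
    (eulerProd (𝐞 τ ^ 2) * eulerProd (𝐞 τ ^ 7))) := by
  have h : ∀ n : ℕ, η (n * τ) = 𝐞 (n * τ / 24) * eulerProd (𝐞 τ ^ n) := fun n => by
    rw [eta_eq, expTwoPiI_nat_mul]
  have h2 := h 2
  have h7 := h 7
  have h14 := h 14
  push_cast at h2 h7 h14
  have he : 𝐞 (τ / 4) * (𝐞 (2 * τ / 24) * 𝐞 (7 * τ / 24)) = 𝐞 (τ / 24) * 𝐞 (14 * τ / 24) := by
    rw [← expTwoPiI_add, ← expTwoPiI_add, ← expTwoPiI_add]; ring_nf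
  rw [etaQuot, h2, h7, h14, eta_eq, mul_mul_mul_comm, ← he, mul_mul_mul_comm (𝐞 (2 * τ / 24)),
    mul_assoc, mul_assoc, mul_div_assoc, ← mul_assoc (𝐞 (2 * τ / 24)), mul_div_mul_left]
  exact mul_ne_zero (Complex.exp_ne_zero _) (Complex.exp_ne_zero _)

lemma etaPair_eq (τ : ℂ) : etaPair τ =
    𝐞 (15 * τ / 24) * (eulerProd (𝐞 τ) * eulerProd (𝐞 τ ^ 14)) := by
  have h14 := expTwoPiI_nat_mul 14 τ
  push_cast at h14
  rw [etaPair, eta_eq, eta_eq, ← h14, mul_mul_mul_comm, ← expTwoPiI_add]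
  ring_nf

lemma etaQuot_sub_isBigO :
    (fun τ => etaQuot τ - 𝐞 (τ / 4)) =O[imInfty] fun τ => 𝐞 (τ / 4) ^ 3 := by
  have hd : ∀ n : ℕ, n ≠ 0 → DifferentiableAt ℂ (fun x => eulerProd (x ^ n)) 0 := fun n hn =>
    DifferentiableAt.comp 0 (differentiableAt_eulerProd (by simp [hn])) (by fun_prop)
  have h0 : ∀ n : ℕ, n ≠ 0 → eulerProd ((0 : ℂ) ^ n) = 1 := fun n hn => by
    rw [zero_pow hn, eulerProd_zero]
  have hψ : DifferentiableAt ℂ (fun x => eulerProd x * eulerProd (x ^ 14) /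
      (eulerProd (x ^ 2) * eulerProd (x ^ 7))) 0 :=
    ((differentiableAt_eulerProd (by simp)).mul (hd 14 (by norm_num))).div
      ((hd 2 (by norm_num)).mul (hd 7 (by norm_num)))
      (by rw [h0 2 (by norm_num), h0 7 (by norm_num)]; simp)
  have hO := (hψ.isBigO_sub).comp_tendsto tendsto_expTwoPiI
  have h1 : (fun τ => 𝐞 (τ / 4)) =O[imInfty] fun τ => 𝐞 (τ / 4) ^ 1 := by
    simpa using isBigO_refl _ _
  -- The quotient of Euler products is `1 + O(𝐞 τ)`, so the error is of order 5 in `𝐞 (τ / 4)`;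
  -- order 3 suffices below.
  refine ((h1.mul hO).congr (fun τ => ?_) (fun τ => ?_)).trans
    (isBigO_expTwoPiI_pow (show 3 ≤ 5 by norm_num))
  · simp only [Function.comp_apply, h0 14 (by norm_num), h0 2 (by norm_num), h0 7 (by norm_num),
      eulerProd_zero]
    rw [etaQuot_eq]; ring
  · have : 𝐞 τ = 𝐞 (τ / 4) ^ 4 := by rw [← expTwoPiI_nat_mul]; congr 1; push_cast; ring
    simp only [Function.comp_apply, sub_zero, this]; ring

lemma etaQuot_isBigO : etaQuot =O[imInfty] fun τ => 𝐞 (τ / 4) ^ 1 := by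
  have h1 : (fun τ => 𝐞 (τ / 4)) =O[imInfty] fun τ => 𝐞 (τ / 4) ^ 1 := by
    simpa using isBigO_refl _ _
  refine ((etaQuot_sub_isBigO.trans (isBigO_expTwoPiI_pow (show 1 ≤ 3 by norm_num))).add
    h1).congr_left fun τ => by ring

/-- The eta product has leading exponent 15/24, so exponent 3/4 leaves a spare factor `𝐞 (τ / 8)`
tending to 0. -/
lemma isLittleO_etaPair : (fun τ => 𝐞 (τ / 4) ^ 3) =o[imInfty] etaPair := by
  have h8 : Tendsto (fun τ => 𝐞 (τ / 8)) imInfty (𝓝 0) := by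
    refine tendsto_expTwoPiI.comp (tendsto_comap_iff.2 ?_)
    refine (tendsto_comap.const_mul_atTop (r := 1 / 8) (by norm_num)).congr fun τ => ?_
    rw [Function.comp_apply, show τ / 8 = ((1 / 8 : ℝ) : ℂ) * τ by push_cast; ring, im_ofReal_mul]
  have hc : ∀ n : ℕ, n ≠ 0 → Tendsto (fun τ => eulerProd (𝐞 τ ^ n)) imInfty (𝓝 1) := fun n hn => by
    have := (differentiableAt_eulerProd (x := 0) (by simp)).continuousAt.tendsto
    rw [eulerProd_zero] at this
    exact this.comp (by simpa [hn] using tendsto_expTwoPiI.pow n)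
  have h1 : Tendsto (fun τ => eulerProd (𝐞 τ) * eulerProd (𝐞 τ ^ 14)) imInfty (𝓝 1) := by
    simpa using (hc 1 (by norm_num)).mul (hc 14 (by norm_num))
  have h := h8.div h1 one_ne_zero
  rw [zero_div] at h
  refine (isLittleO_iff_tendsto' ?_).2 (h.congr fun τ => ?_)
  · filter_upwards [eventually_im_ge 1] with τ hτ h0
    exact absurd h0 (etaPair_ne_zero (by linarith))
  · have he : 𝐞 (τ / 4) ^ 3 = 𝐞 (15 * τ / 24) * 𝐞 (τ / 8) := by
      rw [← expTwoPiI_nat_mul, ← expTwoPiI_add]; congr 1; push_cast; ring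
    rw [Pi.div_apply, etaPair_eq, he, mul_div_mul_left]
    exact Complex.exp_ne_zero _

lemma one_le_odd_sq (n : ℤ) : 1 ≤ (2 * n + 1) ^ 2 := by
  have : 2 * n + 1 ≠ 0 := by omega
  have : 0 < (2 * n + 1) ^ 2 := by positivity
  omega

lemma one_le_sq_add_sq {p : ℤ × ℤ} (h : p ∉ ({(0, 0)} : Finset (ℤ × ℤ))) :
    1 ≤ p.1 ^ 2 + p.2 ^ 2 := by
  obtain ⟨n, m⟩ := p
  by_contra! hc
  refine h ?_
  have h1 : n ^ 2 = 0 := by nlinarith [sq_nonneg n, sq_nonneg m]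
  have h2 : m ^ 2 = 0 := by nlinarith [sq_nonneg n, sq_nonneg m]
  simp [pow_eq_zero_iff] at h1 h2
  simp [h1, h2]

lemma thetaP_zero_isBigO : (fun τ => thetaP τ 0 - 1) =O[imInfty] fun τ => 𝐞 (τ / 4) ^ 3 := by
  have h := halfTheta_isBigO (a := 1) (b := 0) (c := 14) (by norm_num)
    (by norm_num) 0 0 {(0, 0)} 3 fun p hp => by
      push_cast; nlinarith [one_le_sq_add_sq hp, sq_nonneg p.2]
  exact h.congr_left fun τ => by simp [thetaP, expTwoPiI_zero]

lemma thetaS_zero_isBigO : (fun τ => thetaS τ 0 - 1) =O[imInfty] fun τ => 𝐞 (τ / 4) ^ 3 := by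
  have h := halfTheta_isBigO (a := 2) (b := 0) (c := 7) (by norm_num)
    (by norm_num) 0 0 {(0, 0)} 3 fun p hp => by
      push_cast; nlinarith [one_le_sq_add_sq hp, sq_nonneg p.2, sq_nonneg p.1]
  exact h.congr_left fun τ => by simp [thetaS, expTwoPiI_zero]

lemma thetaT_zero_isBigO : (fun τ => thetaT τ 0 - 1) =O[imInfty] fun τ => 𝐞 (τ / 4) ^ 3 := by
  have h := halfTheta_isBigO (a := 3) (b := 2) (c := 5) (by norm_num)
    (by norm_num) 0 0 {(0, 0)} 3 fun p hp => by
      push_cast; nlinarith [one_le_sq_add_sq hp, sq_nonneg p.2, sq_nonneg p.1, sq_nonneg (p.1 + p.2)]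
  exact h.congr_left fun τ => by simp [thetaT, expTwoPiI_zero]

/-- The coefficient 2 comes from the vectors (±1/2, 0), that is `n = 0` and `n = -1`. -/
lemma thetaP_one_isBigO :
    (fun τ => thetaP τ 1 - 2 * 𝐞 (τ / 4)) =O[imInfty] fun τ => 𝐞 (τ / 4) ^ 3 := by
  have h := halfTheta_isBigO (a := 1) (b := 0) (c := 14) (by norm_num)
    (by norm_num) 1 0 {(0, 0), (-1, 0)} 3 fun p hp => by
      obtain ⟨n, m⟩ := p
      simp only [Finset.mem_insert, Finset.mem_singleton, Prod.mk.injEq, not_or, not_and] at hp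
      push_cast
      by_cases hm : m = 0
      · have h0 : n ≠ 0 := fun h => hp.1 h hm
        have h1 : n ≠ -1 := fun h => hp.2 h hm
        rcases lt_or_gt_of_ne h0 with h | h
        · have : n ≤ -2 := by omega
          nlinarith [sq_nonneg m]
        · nlinarith [sq_nonneg m]
      · have : 0 < m ^ 2 := by positivity
        nlinarith [sq_nonneg (2 * n + 1)]
  refine h.congr_left fun τ => ?_
  rw [Finset.sum_pair (by decide)]
  norm_num [thetaP]
  ring

lemma thetaT_one_isBigO : (fun τ => thetaT τ 1) =O[imInfty] fun τ => 𝐞 (τ / 4) ^ 3 :=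
  halfTheta_isBigO_pow (by norm_num) (by norm_num) 0 1 3 fun n m => by
    push_cast
    nlinarith [one_le_odd_sq m, sq_nonneg (2 * n + 2 * m + 1), sq_nonneg (2 * n)]

lemma thetaS_one_isBigO : (fun τ => thetaS τ 1) =O[imInfty] fun τ => 𝐞 (τ / 4) ^ 3 :=
  halfTheta_isBigO_pow (by norm_num) (by norm_num) 1 1 3 fun n m => by
    push_cast
    nlinarith [one_le_odd_sq m, one_le_odd_sq n]

lemma thetaP_two_isBigO : (fun τ => thetaP τ 2) =O[imInfty] fun τ => 𝐞 (τ / 4) ^ 3 :=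
  halfTheta_isBigO_pow (by norm_num) (by norm_num) 0 1 3 fun n m => by
    push_cast
    nlinarith [one_le_odd_sq m, sq_nonneg n]

lemma thetaT_two_isBigO : (fun τ => thetaT τ 2) =O[imInfty] fun τ => 𝐞 (τ / 4) ^ 3 :=
  halfTheta_isBigO_pow (by norm_num) (by norm_num) 1 1 3 fun n m => by
    push_cast
    nlinarith [one_le_odd_sq m, one_le_odd_sq n, sq_nonneg (2 * n + 2 * m + 2)]

lemma thetaS_two_isBigO : (fun τ => thetaS τ 2) =O[imInfty] fun τ => 𝐞 (τ / 4) ^ 2 :=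
  halfTheta_isBigO_pow (by norm_num) (by norm_num) 1 0 2 fun n m => by
    push_cast
    nlinarith [one_le_odd_sq n, sq_nonneg m]

lemma thetaP_three_isBigO : (fun τ => thetaP τ 3) =O[imInfty] fun τ => 𝐞 (τ / 4) ^ 3 :=
  halfTheta_isBigO_pow (by norm_num) (by norm_num) 1 1 3 fun n m => by
    push_cast
    nlinarith [one_le_odd_sq m, one_le_odd_sq n]

lemma thetaT_three_isBigO : (fun τ => thetaT τ 3) =O[imInfty] fun τ => 𝐞 (τ / 4) ^ 3 :=
  halfTheta_isBigO_pow (by norm_num) (by norm_num) 1 0 3 fun n m => by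
    push_cast
    nlinarith [one_le_odd_sq n, one_le_odd_sq (n + m), sq_nonneg m]

lemma thetaS_three_isBigO : (fun τ => thetaS τ 3) =O[imInfty] fun τ => 𝐞 (τ / 4) ^ 3 :=
  halfTheta_isBigO_pow (by norm_num) (by norm_num) 0 1 3 fun n m => by
    push_cast
    nlinarith [one_le_odd_sq m, sq_nonneg n]

lemma defect_isBigO (k : Fin 4) : (fun τ => defect τ k) =O[imInfty] fun τ => 𝐞 (τ / 4) ^ 3 := by
  have hr : ∀ {f : ℂ → ℂ} {n : ℕ}, 2 ≤ n → (f =O[imInfty] fun τ => 𝐞 (τ / 4) ^ n) →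
      (fun τ => etaQuot τ * f τ) =O[imInfty] fun τ => 𝐞 (τ / 4) ^ 3 := fun {f n} hn hf =>
    ((etaQuot_isBigO.mul hf).congr_right fun τ => by rw [← pow_add]).trans
      (isBigO_expTwoPiI_pow (by omega))
  fin_cases k
  · refine ((thetaP_zero_isBigO.sub thetaT_zero_isBigO).sub
      (hr (by norm_num) (thetaS_three_isBigO.add thetaT_three_isBigO))).congr_left fun τ => ?_
    simp [defect, thetaDefect]
  -- The only component with a cancellation of order 1: the term `2 𝐞 (τ / 4)` of P meets `r` times
  -- the constant terms 1 + 1 of S and T.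
  · refine (((thetaP_one_isBigO.sub thetaT_one_isBigO).sub
      (hr (by norm_num) (thetaS_zero_isBigO.add thetaT_zero_isBigO))).sub
      (etaQuot_sub_isBigO.const_mul_left 2)).congr_left fun τ => ?_
    simp [defect, thetaDefect]; ring
  · refine ((thetaP_two_isBigO.sub thetaT_two_isBigO).add
      (hr (by norm_num) (thetaS_one_isBigO.add thetaT_one_isBigO))).congr_left fun τ => ?_
    simp [defect, thetaDefect]
  · refine ((thetaP_three_isBigO.sub thetaT_three_isBigO).add
      (hr le_rfl (thetaS_two_isBigO.add (thetaT_two_isBigO.trans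
        (isBigO_expTwoPiI_pow (by norm_num)))))).congr_left fun τ => ?_
    simp [defect, thetaDefect]

lemma tendsto_defectNorm : Tendsto defectNorm imInfty (𝓝 0) := by
  have h : ∀ k, Tendsto (fun τ => normSq (defect τ k / etaPair τ)) imInfty (𝓝 0) := fun k => by
    have h1 := ((defect_isBigO k).trans_isLittleO isLittleO_etaPair).tendsto_div_nhds_zero
    have h2 := (continuous_normSq.tendsto 0).comp h1
    rw [normSq_zero] at h2
    exact h2
  have := (((h 0).add (h 1)).add (h 2)).add (h 3)
  simp only [add_zero] at this
  refine this.congr fun τ => ?_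
  simp only [defectNorm, sumNormSq, map_div₀]
  ring

/-! ### Moving points to bounded height -/

lemma im_sub_inv (u : ℂ) (x n : ℝ) : (x - 1 / (n * u)).im = u.im / (n * normSq u) := by
  rw [sub_im, ofReal_im, one_div, inv_im, normSq_mul, normSq_ofReal, im_ofReal_mul]
  rcases eq_or_ne n 0 with rfl | hn
  · simp
  rcases eq_or_ne (normSq u) 0 with h | h
  · simp [h]
  field_simp
  ring

lemma im_sub_inv_ge {u : ℂ} (hu : 0 < u.im) (x : ℝ) {n : ℝ} (hn : 0 < n)
    (h : n * normSq u ≤ 9 / 10) : 10 / 9 * u.im ≤ (x - 1 / (n * u)).im := by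
  have h0 : 0 < normSq u := normSq_pos.2 (by rintro rfl; simp at hu)
  rw [im_sub_inv, le_div_iff₀ (by positivity)]
  nlinarith

lemma exists_abs_re_le (τ : ℂ) : ∃ σ : ℂ, |σ.re| ≤ 1 / 2 ∧ σ.im = τ.im ∧
    defectNorm σ = defectNorm τ := by
  refine ⟨τ + ((-round τ.re : ℤ) : ℂ), ?_, by simp, defectNorm_add_int _ _⟩
  have := abs_sub_round τ.re
  simpa [← sub_eq_add_neg] using this

/-- Three kinds of disks cover the strip near the real axis, centred at 0, ±2/7 and ±1/2. At the
ends of the ranges of the real part, 14/4² = 0.875, 98 (3/8 - 2/7)² < 0.79 and 28/8² < 0.44. All are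
below 9/10, with room for the imaginary part, so each map raises the height by a factor 10/9. -/
lemma exists_im_ge_of_im_lt {τ : ℂ} (hτ : 0 < τ.im) (h : τ.im < 1 / 100) : ∃ σ : ℂ,
    10 / 9 * τ.im ≤ σ.im ∧ defectNorm σ = defectNorm τ := by
  obtain ⟨σ, hre, him, hN⟩ := exists_abs_re_le τ
  rw [← him] at hτ h ⊢
  rw [← hN]
  clear hN him τ
  obtain ⟨h1, h2⟩ := abs_le.1 hre
  have hi : σ.im * σ.im ≤ 1 / 10000 := by nlinarith
  by_cases ha : |σ.re| ≤ 1 / 4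
  · obtain ⟨ha1, ha2⟩ := abs_le.1 ha
    refine ⟨_, ?_, defectNorm_fricke hτ⟩
    have := im_sub_inv_ge hτ 0 (n := 14) (by norm_num) (by rw [normSq_apply]; nlinarith)
    push_cast at this
    rwa [zero_sub, ← neg_div] at this
  by_cases hb : 3 / 8 ≤ |σ.re|
  · rcases le_abs.1 hb with hb | hb
    · refine ⟨_, ?_, defectNorm_seven hτ⟩
      have := im_sub_inv_ge (u := σ - 1 / 2) (by norm_num; exact hτ) (1 / 2) (n := 28)
        (by norm_num) (by rw [normSq_apply]; norm_num; nlinarith)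
      push_cast at this
      refine le_trans (by norm_num) this
    · refine ⟨_, ?_, (defectNorm_seven (τ := σ + 1) (by simpa using hτ)).trans
        (defectNorm_add_one σ)⟩
      have := im_sub_inv_ge (u := σ + 1 - 1 / 2) (by norm_num; exact hτ) (1 / 2) (n := 28)
        (by norm_num) (by rw [normSq_apply]; norm_num; nlinarith)
      push_cast at this
      refine le_trans (by norm_num) this
  push Not at ha hb
  rcases lt_abs.1 ha with ha | ha
  · have hb1 := (abs_lt.1 hb).2
    refine ⟨_, ?_, defectNorm_two hτ⟩
    have := im_sub_inv_ge (u := σ - 2 / 7) (by norm_num; exact hτ) (-2 / 7) (n := 98)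
      (by norm_num) (by rw [normSq_apply]; norm_num; nlinarith)
    push_cast at this
    refine le_trans (by norm_num) this
  · have hb1 := (abs_lt.1 hb).1
    refine ⟨_, ?_, defectNorm_two_inv hτ⟩
    have := im_sub_inv_ge (u := σ + 2 / 7) (by norm_num; exact hτ) (2 / 7) (n := 98)
      (by norm_num) (by rw [normSq_apply]; norm_num; nlinarith)
    push_cast at this
    refine le_trans (by norm_num) this

lemma exists_im_ge {τ : ℂ} (hτ : 0 < τ.im) : ∃ σ : ℂ, |σ.re| ≤ 1 / 2 ∧ 1 / 100 ≤ σ.im ∧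
    defectNorm σ = defectNorm τ := by
  have key : ∀ n : ℕ, ∀ τ : ℂ, 0 < τ.im → 1 / 100 ≤ (10 / 9 : ℝ) ^ n * τ.im → ∃ σ : ℂ,
      1 / 100 ≤ σ.im ∧ defectNorm σ = defectNorm τ := by
    intro n
    induction n with
    | zero => exact fun τ _ h => ⟨τ, by simpa using h, rfl⟩
    | succ n ih =>
      intro τ hτ h
      by_cases hlt : τ.im < 1 / 100
      · obtain ⟨σ, hσ, hN⟩ := exists_im_ge_of_im_lt hτ hlt
        obtain ⟨ρ, hρ, hN'⟩ := ih σ (by linarith) (h.trans (by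
          rw [pow_succ, mul_assoc]; gcongr))
        exact ⟨ρ, hρ, hN'.trans hN⟩
      · exact ⟨τ, not_lt.1 hlt, rfl⟩
  obtain ⟨n, hn⟩ := pow_unbounded_of_one_lt (1 / 100 / τ.im) (show (1 : ℝ) < 10 / 9 by norm_num)
  obtain ⟨σ, hσ, hN⟩ := key n τ hτ ((div_lt_iff₀ hτ).1 hn).le
  obtain ⟨ρ, hρ, hi, hN'⟩ := exists_abs_re_le σ
  exact ⟨ρ, hρ, hi ▸ hσ, hN'.trans hN⟩

/-! ### Vanishing of the defect by the maximum principle -/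

lemma differentiableAt_thetaP (k : Fin 4) {τ : ℂ} (hτ : 0 < τ.im) :
    DifferentiableAt ℂ (fun τ => thetaP τ k) τ := by
  fin_cases k <;> exact differentiableAt_halfTheta (by norm_num) (by norm_num) _ _ hτ

lemma differentiableAt_thetaS (k : Fin 4) {τ : ℂ} (hτ : 0 < τ.im) :
    DifferentiableAt ℂ (fun τ => thetaS τ k) τ := by
  fin_cases k <;> exact differentiableAt_halfTheta (by norm_num) (by norm_num) _ _ hτ

lemma differentiableAt_thetaT (k : Fin 4) {τ : ℂ} (hτ : 0 < τ.im) :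
    DifferentiableAt ℂ (fun τ => thetaT τ k) τ := by
  fin_cases k <;> exact differentiableAt_halfTheta (by norm_num) (by norm_num) _ _ hτ

lemma differentiableAt_defect (k : Fin 4) {τ : ℂ} (hτ : 0 < τ.im) :
    DifferentiableAt ℂ (fun τ => defect τ k) τ := by
  have hr := differentiableAt_etaQuot hτ
  have hP := fun k => differentiableAt_thetaP k hτ
  have hS := fun k => differentiableAt_thetaS k hτ
  have hT := fun k => differentiableAt_thetaT k hτ
  fin_cases k
  · exact ((hP 0).sub (hT 0)).sub (hr.mul ((hS 3).add (hT 3)))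
  · exact ((hP 1).sub (hT 1)).sub (hr.mul ((hS 0).add (hT 0)))
  · exact ((hP 2).sub (hT 2)).add (hr.mul ((hS 1).add (hT 1)))
  · exact ((hP 3).sub (hT 3)).add (hr.mul ((hS 2).add (hT 2)))

/-- The normalised vector `defect / (η(τ) η(14 τ))` in Hermitian space. -/
noncomputable def normalizedDefect (τ : ℂ) : EuclideanSpace ℂ (Fin 4) :=
  WithLp.toLp 2 fun k => defect τ k / etaPair τ

lemma norm_sq_normalizedDefect (τ : ℂ) : ‖normalizedDefect τ‖ ^ 2 = defectNorm τ := by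
  rw [EuclideanSpace.norm_sq_eq, Fin.sum_univ_four]
  simp only [normalizedDefect, ← normSq_eq_norm_sq, map_div₀, defectNorm, sumNormSq]
  ring

lemma differentiableOn_normalizedDefect :
    DifferentiableOn ℂ normalizedDefect {τ : ℂ | 0 < τ.im} := by
  refine differentiableOn_euclidean.2 fun k τ hτ => ?_
  exact ((differentiableAt_defect k hτ).div (differentiableAt_etaPair hτ)
    (etaPair_ne_zero hτ)).differentiableWithinAt

lemma continuousOn_defectNorm : ContinuousOn defectNorm {τ : ℂ | 0 < τ.im} :=
  (differentiableOn_normalizedDefect.continuousOn.norm.pow 2).congr fun τ _ =>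
    (norm_sq_normalizedDefect τ).symm

lemma defectNorm_eq_zero {τ : ℂ} (hτ : 0 < τ.im) : defectNorm τ = 0 := by
  by_contra hne
  have hpos : 0 < defectNorm τ :=
    lt_of_le_of_ne (by rw [← norm_sq_normalizedDefect]; positivity) (Ne.symm hne)
  obtain ⟨Y, hY⟩ : ∃ Y, ∀ σ : ℂ, Y ≤ σ.im → defectNorm σ < defectNorm τ := by
    have h := (tendsto_defectNorm.eventually (gt_mem_nhds hpos))
    obtain ⟨s, hs, hsub⟩ := mem_comap.1 h
    obtain ⟨Y, hY⟩ := mem_atTop_sets.1 hs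
    exact ⟨Y, fun σ hσ => hsub (hY _ hσ)⟩
  let K : Set ℂ := Set.Icc (-(1 / 2)) (1 / 2) ×ℂ Set.Icc (1 / 100) Y
  have hK : IsCompact K := isCompact_Icc.reProdIm isCompact_Icc
  have hKpos : K ⊆ {τ : ℂ | 0 < τ.im} := fun σ hσ => by
    have := hσ.2.1
    show 0 < σ.im
    linarith
  -- Only values at least `defectNorm τ` matter. They cannot occur above height `Y`, so their
  -- representatives lie in the compact rectangle `K`.
  have hmem : ∀ σ : ℂ, 0 < σ.im → defectNorm τ ≤ defectNorm σ → ∃ ρ ∈ K,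
      defectNorm ρ = defectNorm σ := by
    intro σ hσ hle
    obtain ⟨ρ, hre, him, hN⟩ := exists_im_ge hσ
    refine ⟨ρ, ⟨abs_le.1 hre, him, ?_⟩, hN⟩
    by_contra! hlt
    have := hY ρ hlt.le
    linarith
  obtain ⟨ρ₀, hρ₀, hN₀⟩ := hmem τ hτ le_rfl
  obtain ⟨ρ, hρ, hmax⟩ := hK.exists_isMaxOn ⟨ρ₀, hρ₀⟩ (continuousOn_defectNorm.mono hKpos)
  have hglob : ∀ σ : ℂ, 0 < σ.im → defectNorm σ ≤ defectNorm ρ := fun σ hσ => by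
    have hτρ : defectNorm τ ≤ defectNorm ρ := hN₀ ▸ hmax hρ₀
    rcases le_total (defectNorm σ) (defectNorm τ) with h | h
    · exact h.trans hτρ
    · obtain ⟨ρ', hρ', hN'⟩ := hmem σ hσ h
      exact hN' ▸ hmax hρ'
  -- The Hermitian norm is strictly convex, so the maximum principle makes the vector itself
  -- constant.
  have hconst := Complex.eqOn_of_isPreconnected_of_isMaxOn_norm (U := {z : ℂ | 0 < z.im})
    (convex_halfSpace_im_gt 0).isPreconnected (isOpen_lt continuous_const continuous_im)
    differentiableOn_normalizedDefect (hKpos hρ) (fun σ hσ => by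
      have := hglob σ hσ
      rw [← norm_sq_normalizedDefect, ← norm_sq_normalizedDefect] at this
      exact (pow_le_pow_iff_left₀ (norm_nonneg _) (norm_nonneg _) two_ne_zero).1 this)
  have hcN : ∀ σ : ℂ, 0 < σ.im → defectNorm σ = defectNorm ρ := fun σ hσ => by
    rw [← norm_sq_normalizedDefect, ← norm_sq_normalizedDefect, hconst hσ, Function.const]
  have h1 := hY ((max Y 1 : ℝ) * I) (by simp)
  rw [hcN _ (by simp), ← hcN τ hτ] at h1
  exact lt_irrefl _ h1

lemma defect_eq_zero {τ : ℂ} (hτ : 0 < τ.im) (k : Fin 4) : defect τ k = 0 := by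
  have h := norm_sq_normalizedDefect τ
  rw [defectNorm_eq_zero hτ, sq_eq_zero_iff, norm_eq_zero] at h
  have hk := congrArg (fun v : EuclideanSpace ℂ (Fin 4) => v k) h
  simpa [normalizedDefect, etaPair_ne_zero hτ] using hk

/-! ### Euler's pentagonal number theorem in the unit disk -/

lemma norm_prod_one_sub_pow_le {x : ℂ} (hx : ‖x‖ < 1) (k n : ℕ) :
    ‖∏ i ∈ Finset.range n, (1 - x ^ (k + i + 1))‖ ≤ rexp (1 - ‖x‖)⁻¹ := by
  rw [norm_prod]
  calc ∏ i ∈ Finset.range n, ‖1 - x ^ (k + i + 1)‖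
      ≤ ∏ i ∈ Finset.range n, rexp (‖x‖ ^ i) := by
        refine Finset.prod_le_prod (fun _ _ => norm_nonneg _) fun i _ => ?_
        refine (norm_sub_le _ _).trans ((?_ : _ ≤ ‖x‖ ^ i + 1).trans (Real.add_one_le_exp _))
        rw [norm_one, norm_pow, add_comm]
        refine add_le_add_left ?_ 1
        exact pow_le_pow_of_le_one (norm_nonneg _) hx.le (by omega)
    _ = rexp (∑ i ∈ Finset.range n, ‖x‖ ^ i) := (Real.exp_sum _ _).symm
    _ ≤ rexp (1 - ‖x‖)⁻¹ := by
        rw [Real.exp_le_exp, ← tsum_geometric_of_lt_one (norm_nonneg _) hx]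
        exact (summable_geometric_of_lt_one (norm_nonneg _) hx).sum_le_tsum _
          fun _ _ => by positivity

lemma norm_pentagonal_aux_le {x : ℂ} (hx : ‖x‖ < 1) (k n : ℕ) :
    ‖x ^ ((k + 1) * n) * ∏ i ∈ Finset.range (n + 1), (1 - x ^ (k + i + 1))‖ ≤
      ‖x‖ ^ n * rexp (1 - ‖x‖)⁻¹ := by
  rw [norm_mul, norm_pow]
  refine mul_le_mul ?_ (norm_prod_one_sub_pow_le hx k (n + 1)) (norm_nonneg _) (by positivity)
  exact pow_le_pow_of_le_one (norm_nonneg _) hx.le (by nlinarith)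

lemma summable_pow_natAbs {r : ℝ} (h0 : 0 ≤ r) (h1 : r < 1) :
    Summable fun n : ℤ => r ^ n.natAbs := by
  have h := summable_geometric_of_lt_one h0 h1
  exact Summable.of_nat_of_neg (by simpa using h) (by simpa using h)

lemma natAbs_le_pentagonal (n : ℤ) : n.natAbs ≤ pentagonal n := by
  have h := two_mul_natCast_pentagonal n
  have h2 : (n.natAbs : ℤ) = |n| := by simp
  have : (n.natAbs : ℤ) ≤ pentagonal n := by
    rw [h2]
    rcases le_or_gt n 0 with hn | hn
    · rw [abs_of_nonpos hn]; nlinarith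
    · rw [abs_of_pos hn]; nlinarith
  exact_mod_cast this

lemma summable_norm_eulerE {q : ℂ} (hq : ‖q‖ < 1) :
    Summable fun n : ℤ => ‖(-1 : ℂ) ^ n * q ^ (n * (3 * n - 1) / 2)‖ := by
  refine (summable_pow_natAbs (norm_nonneg q) hq).of_nonneg_of_le (fun _ => norm_nonneg _)
    fun n => ?_
  rw [norm_mul, norm_zpow, norm_neg, norm_one, one_zpow, one_mul, ← natCast_pentagonal,
    zpow_natCast, norm_pow]
  exact pow_le_pow_of_le_one (norm_nonneg _) hq.le (natAbs_le_pentagonal n)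

/-- Euler's pentagonal number theorem in the unit disk. -/
lemma eulerE_eq_eulerProd {q : ℂ} (hq : ‖q‖ < 1) : eulerE q = eulerProd q := by
  have hs := (summable_norm_eulerE hq).of_norm.hasSum
  -- Reversing the summation index and pairing `k` with `-(k + 1)` gives the terms at `-k` and `k +
  -- 1` of the original series, as in the pentagonal theorem over ℕ.
  rw [← eulerE, ← neg_injective.hasSum_iff (fun x hx => by absurd hx; exact ⟨-x, by simp⟩)] at hs
  have hs' : HasSum (fun k : ℕ => (-1) ^ k * (q ^ pentagonal (-k) - q ^ pentagonal (k + 1)))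
      (eulerE q) := by
    refine (congrArg (HasSum · (eulerE q)) (funext fun k : ℕ => ?_)).mp hs.nat_add_neg_add_one
    have h1 : ((-1 : ℂ) ^ (-(k : ℤ))) = (-1) ^ k := by
      rw [neg_one_zpow_congr (n := (k : ℤ)) ⟨-k, by ring⟩, zpow_natCast]
    have h2 : ((-1 : ℂ) ^ ((k : ℤ) + 1)) = -(-1) ^ k := by
      rw [zpow_add_one₀ (by norm_num), zpow_natCast]; ring
    simp only [Function.comp_apply, neg_neg, ← natCast_pentagonal, h1, h2, zpow_natCast]
    ring
  rw [eulerProd, Pentagonal.tprod_one_sub_pow (tendsto_pow_atTop_nhds_zero_of_norm_lt_one hq)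
    (fun k => Summable.of_norm_bounded ((summable_geometric_of_lt_one (norm_nonneg q) hq).mul_right _)
      (norm_pentagonal_aux_le hq k)) ?_ hs'.summable ?_, hs'.tsum_eq]
  · intro k
    refine multipliable_one_add_of_summable (f := fun n => -q ^ (n + k + 1)) ?_
    simpa [add_assoc] using (summable_nat_add_iff (k + 1)).mpr
      (summable_geometric_of_lt_one (norm_nonneg q) hq)
  · refine squeeze_zero_norm (a := fun k => ‖q‖ ^ k * ((1 - ‖q‖)⁻¹ * rexp (1 - ‖q‖)⁻¹))
      (fun k => ?_) ?_
    · rw [norm_mul, norm_mul, norm_pow, norm_neg, norm_one, one_pow, one_mul, norm_pow]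
      refine mul_le_mul ?_ ?_ (norm_nonneg _) (by positivity)
      · refine pow_le_pow_of_le_one (norm_nonneg _) hq.le ?_
        rw [Nat.le_div_iff_mul_le (by norm_num)]; nlinarith
      · exact tsum_of_norm_bounded ((hasSum_geometric_of_lt_one (norm_nonneg q) hq).mul_right _)
          (norm_pentagonal_aux_le hq k)
    · simpa using (tendsto_pow_atTop_nhds_zero_of_lt_one (norm_nonneg q) hq).mul_const
        ((1 - ‖q‖)⁻¹ * rexp (1 - ‖q‖)⁻¹)

lemma eulerE_ne_zero {q : ℂ} (hq : ‖q‖ < 1) : eulerE q ≠ 0 :=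
  eulerE_eq_eulerProd hq ▸ eulerProd_ne_zero hq

/-! ### The form series in the unit disk -/

lemma summable_norm_form {a b c : ℤ} (h : ∀ n m : ℤ, n ^ 2 + m ^ 2 ≤ a * n ^ 2 + b * n * m + c * m ^ 2)
    {r : ℝ} (h0 : 0 ≤ r) (h1 : r < 1) :
    Summable fun p : ℤ × ℤ => r ^ (a * p.1 ^ 2 + b * p.1 * p.2 + c * p.2 ^ 2) := by
  have hs := (summable_pow_natAbs h0 h1).mul_of_nonneg (summable_pow_natAbs h0 h1)
    (fun _ => by positivity) (fun _ => by positivity)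
  refine hs.of_nonneg_of_le (fun _ => by positivity) fun p => ?_
  have h2 := h p.1 p.2
  obtain ⟨N, hN⟩ := Int.eq_ofNat_of_zero_le ((by positivity : 0 ≤ p.1 ^ 2 + p.2 ^ 2).trans h2)
  rw [hN, zpow_natCast, ← pow_add]
  refine pow_le_pow_of_le_one h0 h1.le ?_
  have h3 : ∀ n : ℤ, (n.natAbs : ℤ) ≤ n ^ 2 := fun n => by
    rw [← Int.natAbs_sq]; exact_mod_cast Nat.le_self_pow two_ne_zero _
  have := h3 p.1
  have := h3 p.2
  rw [hN] at h2
  omega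

lemma summable_form {a b c : ℤ} (h : ∀ n m : ℤ, n ^ 2 + m ^ 2 ≤ a * n ^ 2 + b * n * m + c * m ^ 2)
    {q : ℂ} (hq : ‖q‖ < 1) :
    Summable fun p : ℤ × ℤ => ‖q ^ (a * p.1 ^ 2 + b * p.1 * p.2 + c * p.2 ^ 2)‖ := by
  simpa only [norm_zpow] using summable_norm_form h (norm_nonneg q) hq

lemma differentiableOn_formSeries {a b c : ℤ}
    (h : ∀ n m : ℤ, n ^ 2 + m ^ 2 ≤ a * n ^ 2 + b * n * m + c * m ^ 2) :
    DifferentiableOn ℂ (formSeries a b c) (Metric.ball 0 1) := by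
  intro z hz
  obtain ⟨r, hzr, hr1⟩ := exists_between (mem_ball_zero_iff.1 hz)
  have h0 : 0 ≤ r := (norm_nonneg z).trans hzr.le
  have hex : ∀ p : ℤ × ℤ, ∃ N : ℕ, a * p.1 ^ 2 + b * p.1 * p.2 + c * p.2 ^ 2 = N := fun p =>
    Int.eq_ofNat_of_zero_le ((by positivity : 0 ≤ p.1 ^ 2 + p.2 ^ 2).trans (h p.1 p.2))
  refine (DifferentiableOn.differentiableAt (s := Metric.ball 0 r) ?_
    (Metric.isOpen_ball.mem_nhds (mem_ball_zero_iff.2 hzr))).differentiableWithinAt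
  refine differentiableOn_tsum_of_summable_norm (summable_norm_form h h0 hr1) (fun p => ?_)
    Metric.isOpen_ball fun p w hw => ?_
  · obtain ⟨N, hN⟩ := hex p
    simp only [hN, zpow_natCast]
    fun_prop
  · obtain ⟨N, hN⟩ := hex p
    simp only [hN, zpow_natCast, norm_pow]
    exact pow_le_pow_left₀ (norm_nonneg _) (mem_ball_zero_iff.1 hw).le _

lemma formSeries_zero {a b c : ℤ}
    (h : ∀ n m : ℤ, n ^ 2 + m ^ 2 ≤ a * n ^ 2 + b * n * m + c * m ^ 2) :
    formSeries a b c 0 = 1 := by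
  rw [formSeries, tsum_eq_single (0, 0)]
  · simp
  · intro p hp
    refine zero_zpow _ fun h0 => hp ?_
    have h2 := h p.1 p.2
    rw [h0] at h2
    have h3 : p.1 ^ 2 = 0 := by nlinarith [sq_nonneg p.1, sq_nonneg p.2]
    have h4 : p.2 ^ 2 = 0 := by nlinarith [sq_nonneg p.1, sq_nonneg p.2]
    exact Prod.ext (pow_eq_zero_iff two_ne_zero |>.1 h3) (pow_eq_zero_iff two_ne_zero |>.1 h4)

/-! ### Back to the variable q -/

lemma exists_expTwoPiI_eq {q : ℂ} (h0 : q ≠ 0) (h1 : ‖q‖ < 1) :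
    ∃ τ : ℂ, 0 < τ.im ∧ 𝐞 (τ / 4) = q := by
  refine ⟨4 * (Complex.log q / (2 * π * I)), ?_, ?_⟩
  · have h : (4 * (Complex.log q / (2 * π * I)) : ℂ) = ((2 / π : ℝ) : ℂ) * (-I * Complex.log q) := by
      push_cast
      field_simp
      rw [I_sq]; ring
    rw [h, im_ofReal_mul]
    have : (-I * Complex.log q).im = -Real.log ‖q‖ := by simp [Complex.log_re]
    rw [this]
    have := Real.log_neg (norm_pos_iff.2 h0) h1
    have := pi_pos
    have h2 : 0 < -Real.log ‖q‖ := by linarith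
    positivity
  · rw [expTwoPiI, mul_div_cancel_left₀ _ (by norm_num), mul_div_cancel₀ _ (by simp [pi_ne_zero]),
      Complex.exp_log h0]

lemma norm_expTwoPiI_div_four_lt_one {τ : ℂ} (hτ : 0 < τ.im) : ‖𝐞 (τ / 4)‖ < 1 := by
  have h := norm_expTwoPiI_div_four_pow τ 1
  rw [pow_one] at h
  rw [h, Real.exp_lt_one_iff]
  simp; positivity

/-- A vector `(n, m)` for `(a, 2b, 4c)` is `(n, 2m)` for `(a, b, c)`, that is four times the value
at `(n/2, m)`. The parity of `n` selects the coset. -/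
lemma formSeries_eq_halfTheta {a b c : ℤ}
    (h : ∀ n m : ℤ, n ^ 2 + m ^ 2 ≤ a * n ^ 2 + 2 * b * n * m + 4 * c * m ^ 2) {τ : ℂ}
    (hτ : 0 < τ.im) : formSeries a (2 * b) (4 * c) (𝐞 (τ / 4)) =
      halfTheta a b c 0 0 τ + halfTheta a b c 1 0 τ := by
  have hs := (summable_form h (norm_expTwoPiI_div_four_lt_one hτ)).of_norm
  have he : ∀ N : ℤ, 𝐞 (τ / 4) ^ N = 𝐞 (τ / 4 * N) := fun N => by
    rw [expTwoPiI, expTwoPiI, ← Complex.exp_int_mul]; ring_nf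
  have h2 := tsum_int_mod 2 0 hs
  rw [formSeries, h2, Fin.sum_univ_two, halfTheta, halfTheta]
  congr 1 <;> refine tsum_congr fun p => ?_ <;> rw [he] <;> congr 1 <;> push_cast <;>
    simp [-mul_eq_mul_left_iff] <;> ring

/-- In (3, 2, 19) the last coefficient is not divisible by 4; in the equivalent form (3, -4, 20) it
is, so the parity splitting applies. -/
lemma formSeries_shear (τ : ℂ) : formSeries 3 2 19 τ = formSeries 3 (-4) 20 τ := by
  rw [formSeries, formSeries, ← (Equiv.mk (fun p : ℤ × ℤ => (p.1 - p.2, p.2))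
    (fun p => (p.1 + p.2, p.2)) (fun p => Prod.ext (by ring) rfl)
    (fun p => Prod.ext (by ring) rfl)).tsum_eq]
  refine tsum_congr fun p => ?_
  simp only [Equiv.coe_fn_mk]
  congr 1
  ring

lemma formSeries_sub_eq {τ : ℂ} (hτ : 0 < τ.im) :
    formSeries 1 0 56 (𝐞 (τ / 4)) - formSeries 5 4 12 (𝐞 (τ / 4)) =
      (thetaP τ 0 - thetaT τ 0) + (thetaP τ 1 - thetaT τ 1) := by
  have h1 := formSeries_eq_halfTheta (a := 1) (b := 0) (c := 14)
    (fun n m => by nlinarith [sq_nonneg m]) hτ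
  have h2 := formSeries_eq_halfTheta (a := 5) (b := 2) (c := 3)
    (fun n m => by nlinarith [sq_nonneg (n + m), sq_nonneg m, sq_nonneg n]) hτ
  have h3 : ∀ t, halfTheta 5 2 3 t 0 τ = halfTheta 3 2 5 0 t τ := fun t => by
    rw [← halfTheta_neg 3 2 5, ← halfTheta_dual 3 (-2) 5]; rfl
  rw [h3, h3] at h2
  norm_num at h1 h2
  rw [h1, h2]
  simp [thetaP, thetaT]; ring

lemma formSeries_add_eq {τ : ℂ} (hτ : 0 < τ.im) :
    formSeries 7 0 8 (𝐞 (τ / 4)) + formSeries 3 2 19 (𝐞 (τ / 4)) =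
      (thetaS τ 0 + thetaT τ 0) + (thetaS τ 3 + thetaT τ 3) := by
  have h1 := formSeries_eq_halfTheta (a := 7) (b := 0) (c := 2)
    (fun n m => by nlinarith [sq_nonneg m, sq_nonneg n]) hτ
  have h2 := formSeries_eq_halfTheta (a := 3) (b := -2) (c := 5)
    (fun n m => by nlinarith [sq_nonneg (n - m), sq_nonneg m, sq_nonneg n]) hτ
  have h3 : ∀ t, halfTheta 7 0 2 t 0 τ = halfTheta 2 0 7 0 t τ := fun t => by
    simpa using halfTheta_dual 2 0 7 t 0 τ
  rw [h3, h3] at h1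
  rw [halfTheta_neg 3 2 5, halfTheta_neg 3 2 5] at h2
  norm_num at h1 h2
  rw [h1, formSeries_shear, h2]
  simp [thetaS, thetaT]; ring

/-- Components 0 and 1 of the vanishing defect suffice here; the other two were needed for
invariance. -/
lemma theta_identity {τ : ℂ} (hτ : 0 < τ.im) :
    (thetaP τ 0 - thetaT τ 0) + (thetaP τ 1 - thetaT τ 1) =
      etaQuot τ * ((thetaS τ 0 + thetaT τ 0) + (thetaS τ 3 + thetaT τ 3)) := by
  have h0 := defect_eq_zero hτ 0
  have h1 := defect_eq_zero hτ 1
  simp [defect, thetaDefect] at h0 h1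
  linear_combination h0 + h1

lemma norm_pow_lt_one {q : ℂ} (hq : ‖q‖ < 1) {n : ℕ} (hn : n ≠ 0) : ‖q ^ n‖ < 1 := by
  rw [norm_pow]; exact pow_lt_one₀ (norm_nonneg q) hq hn

lemma eulerE_mul_ne_zero {q : ℂ} (hq : ‖q‖ < 1) : eulerE (q ^ 8) * eulerE ((q ^ 7) ^ 4) ≠ 0 :=
  mul_ne_zero (eulerE_ne_zero (norm_pow_lt_one hq (by norm_num)))
    (eulerE_ne_zero (norm_pow_lt_one (norm_pow_lt_one hq (by norm_num)) (by norm_num)))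

lemma formSeries_identity {q : ℂ} (hq : ‖q‖ < 1) :
    (formSeries 1 0 56 q - formSeries 5 4 12 q) * (eulerE (q ^ 8) * eulerE ((q ^ 7) ^ 4)) =
      q * (eulerE (q ^ 4) * eulerE ((q ^ 7) ^ 8)) *
        (formSeries 7 0 8 q + formSeries 3 2 19 q) := by
  -- No `τ` corresponds to `q = 0`; there the form series equal 1 and both sides vanish.
  rcases eq_or_ne q 0 with rfl | h0
  · rw [formSeries_zero (fun n m => by nlinarith [sq_nonneg m]),
      formSeries_zero (fun n m => by nlinarith [sq_nonneg (n + m), sq_nonneg m, sq_nonneg n])]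
    simp
  have hE := eulerE_mul_ne_zero hq
  obtain ⟨τ, hτ, rfl⟩ := exists_expTwoPiI_eq h0 hq
  have he : 𝐞 τ = 𝐞 (τ / 4) ^ 4 := by
    rw [← expTwoPiI_nat_mul]; congr 1; push_cast; ring
  rw [formSeries_sub_eq hτ, formSeries_add_eq hτ, theta_identity hτ, etaQuot_eq, he]
  rw [← pow_mul] at hE ⊢
  simp only [← pow_mul] at hE ⊢
  rw [eulerE_eq_eulerProd (norm_pow_lt_one hq (by norm_num)),
    eulerE_eq_eulerProd (norm_pow_lt_one hq (by norm_num))] at hE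
  rw [eulerE_eq_eulerProd (norm_pow_lt_one hq (by norm_num)),
    eulerE_eq_eulerProd (norm_pow_lt_one hq (by norm_num)),
    eulerE_eq_eulerProd (norm_pow_lt_one hq (by norm_num)),
    eulerE_eq_eulerProd (norm_pow_lt_one hq (by norm_num))]
  norm_num at hE ⊢
  field_simp [hE.1, hE.2]

/-- The denominator is holomorphic on the connected disk and equals 2 at the origin, so it cannot
vanish identically near any point. -/
lemma eventually_denominator_ne_zero {z : ℂ} (hz : ‖z‖ < 1) :
    ∀ᶠ q in 𝓝[≠] z, formSeries 7 0 8 q + formSeries 3 2 19 q ≠ 0 := by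
  have h1 : ∀ n m : ℤ, n ^ 2 + m ^ 2 ≤ 7 * n ^ 2 + 0 * n * m + 8 * m ^ 2 := fun n m => by
    nlinarith [sq_nonneg m, sq_nonneg n]
  have h2 : ∀ n m : ℤ, n ^ 2 + m ^ 2 ≤ 3 * n ^ 2 + 2 * n * m + 19 * m ^ 2 := fun n m => by
    nlinarith [sq_nonneg m, sq_nonneg n, sq_nonneg (n + m)]
  have ha := ((differentiableOn_formSeries h1).add (differentiableOn_formSeries h2)).analyticOnNhd
    Metric.isOpen_ball
  have hz' : z ∈ Metric.ball (0 : ℂ) 1 := mem_ball_zero_iff.2 hz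
  refine (ha z hz').eventually_eq_zero_or_eventually_ne_zero.resolve_left fun h => ?_
  have h0 := ha.eqOn_zero_of_preconnected_of_eventuallyEq_zero
    (convex_ball (0 : ℂ) 1).isPreconnected hz' h (Metric.mem_ball_self one_pos)
  simp only [Pi.add_apply, formSeries_zero h1, formSeries_zero h2, Pi.zero_apply] at h0
  norm_num at h0

theorem mainTheorem9 :
    -- all the series involved converge absolutely in the unit disk
    (∀ q : ℂ, ‖q‖ < 1 →
      (∀ F ∈ ({(1, 0, 56), (5, 4, 12), (7, 0, 8), (3, 2, 19)} : Set (ℤ × ℤ × ℤ)),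
        Summable fun p : ℤ × ℤ =>
          ‖q ^ (F.1 * p.1 ^ 2 + F.2.1 * p.1 * p.2 + F.2.2 * p.2 ^ 2)‖) ∧
      Summable fun n : ℤ => ‖(-1 : ℂ) ^ n * q ^ (n * (3 * n - 1) / 2)‖) ∧
    -- the denominator on the right has no zero in the unit disk, and the zeros of the
    -- denominator on the left are isolated in it
    (∀ q : ℂ, ‖q‖ < 1 → eulerE (q ^ 8) * eulerE ((q ^ 7) ^ 4) ≠ 0) ∧
    (∀ z : ℂ, ‖z‖ < 1 → ∀ᶠ q in nhdsWithin z {z}ᶜ,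
      formSeries 7 0 8 q + formSeries 3 2 19 q ≠ 0) ∧
    -- the identity of quotients, wherever the left-hand side is defined
    (∀ q : ℂ, ‖q‖ < 1 → formSeries 7 0 8 q + formSeries 3 2 19 q ≠ 0 →
      (formSeries 1 0 56 q - formSeries 5 4 12 q) / (formSeries 7 0 8 q + formSeries 3 2 19 q) =
        q * (eulerE (q ^ 4) * eulerE ((q ^ 7) ^ 8)) / (eulerE (q ^ 8) * eulerE ((q ^ 7) ^ 4))) ∧
    -- the identity after clearing denominators, in the whole disk
    (∀ q : ℂ, ‖q‖ < 1 →
      (formSeries 1 0 56 q - formSeries 5 4 12 q) * (eulerE (q ^ 8) * eulerE ((q ^ 7) ^ 4)) =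
        q * (eulerE (q ^ 4) * eulerE ((q ^ 7) ^ 8)) *
          (formSeries 7 0 8 q + formSeries 3 2 19 q)) := by
  refine ⟨fun q hq => ⟨?_, summable_norm_eulerE hq⟩, fun q hq => eulerE_mul_ne_zero hq,
    fun z hz => eventually_denominator_ne_zero hz, fun q hq hD => ?_,
    fun q hq => formSeries_identity hq⟩
  · simp only [Set.mem_insert_iff, Set.mem_singleton_iff]
    rintro F (rfl | rfl | rfl | rfl) <;> refine summable_form (fun n m => ?_) hq <;>
      nlinarith [sq_nonneg m, sq_nonneg n, sq_nonneg (n + m)]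
  · rw [div_eq_div_iff hD (eulerE_mul_ne_zero hq)]
    exact formSeries_identity hq
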